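/- Let $S=\{(y,z)\in\mathbb{R}^2\times\mathbb{R} : z<0\}$ and put $Z_1=\partial_{y_1}$, $Z_2=\partial_{y_2}$, $Z_3=\frac{z}{1-z}\partial_z$, $Z^\alpha=Z_1^{\alpha_1}Z_2^{\alpha_2}Z_3^{\alpha_3}$. For a function $f(t,y,z)$ and an integer $m\ge 0$ define, at each time $t$, the $[0,\infty]$-valued norms $$\|f(t)\|_{X^{m,0}}=\Big(\sum_{j+|\alpha|\le m}\|\partial_t^jZ^\alpha f(t)\|_{L^2(S)}^2\Big)^{1/2},\qquad \|f(t)\|_{Y^{m,0}}=\sum_{j+|\alpha|\le m}\|\partial_t^jZ^\alpha f(t)\|_{L^\infty(S)},$$ and, for a function $h(t,y)$ on the boundary, $|h(t)|_{Y^{m,0}}=\sum_{j+a+b\le m}\|\partial_t^j\partial_{y_1}^a\partial_{y_2}^b h(t)\|_{L^\infty(\mathbb{R}^2)}$. For every integer $k\ge 0$ and all $T>0$, $R>0$, $M\ge 0$ there is a constant $C=C(k,T,R,M)$ with the following property. Let $\varepsilon>0$, let $w=(w_y,w_3)=(w_1,w_2,w_3)$ be a vector field and $\rho,\mathcal{H}$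 real functions, all smooth (up to the boundary) on $[0,T]\times\overline{S}$, such that $w_3=0$ and $\rho=0$ at $z=0$, such that $\rho$ and $\mathcal{H}$ vanish for $z<-R$, and such that $$\partial_t\rho+w\cdot\nabla\rho=\varepsilon\,\partial_{zz}\rho+\mathcal{H}\qquad\text{for } z<0 .$$ Assume that the boundary values of $w$ satisfy $$|w_1(t,\cdot,0)|_{Y^{k,0}}+|w_2(t,\cdot,0)|_{Y^{k,0}}+|\partial_zw_3(t,\cdot,0)|_{Y^{k,0}}\le M\qquad\text{for all } t\in[0,T].$$ Then for all $t\in[0,T]$ and all $(j,\alpha)$ with $j+|\alpha|=k$, $$\|\partial_t^jZ^\alpha\rho(t)\|_{L^\infty(S)}\le C\Big(\|\rho(0)\|_{Y^{k,0}}+\int_0^t\Big(\big(\|\partial_zw_y(\tau)\|_{Y^{k,0}}+\|\partial_{zz}w_3(\tau)\|_{Y^{k,0}}\big)\|\rho(\tau)\|_{X^{k+3,0}}+\|\mathcal{H}(\tau)\|_{Y^{k,0}}\Big)\,d\tau\Big),$$ where $\|\partial_zw_y\|_{Y^{k,0}}=\|\partial_zw_1\|_{Y^{k,0}}+\|\partial_zw_2\|_{Y^{k,0}}$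 and $\|\rho(0)\|_{Y^{k,0}}$ includes the time derivatives of $\rho$ at $t=0$. In particular, $C$ does not depend on $\varepsilon$, $\rho$ or $\mathcal{H}$. -/

import Mathlib

open MeasureTheory
open scoped NNReal ENNReal ContDiff

noncomputable section

/-- A point `(t, y₁, y₂, z)` of space-time. -/
abbrev SpaceTime : Type := ℝ × ℝ × ℝ × ℝ

/-- The closed space-time domain `[0,T] × ℝ² × (-∞,0]`. -/
def spaceTimeDomain (T : ℝ) : Set SpaceTime :=
  {p | p.1 ∈ Set.Icc 0 T ∧ p.2.2.2 ≤ 0}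

/-- The open half space `S = {(y₁, y₂, z) | z < 0}`. -/
def lowerHalfSpace : Set (ℝ × ℝ × ℝ) := {x | x.2.2 < 0}

/-- Partial derivative in the direction `e`, relative to the closed domain
(so one-sided at `t = 0`, `t = T` and `z = 0`). -/
def pderiv (T : ℝ) (e : SpaceTime) (f : SpaceTime → ℝ) : SpaceTime → ℝ :=
  fun p => fderivWithin ℝ f (spaceTimeDomain T) p e

/-- `∂_t` -/
def dt (T : ℝ) : (SpaceTime → ℝ) → SpaceTime → ℝ := pderiv T (1, 0, 0, 0)

/-- `∂_{y₁}`, which is also the conormal field `Z₁` -/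
def dy1 (T : ℝ) : (SpaceTime → ℝ) → SpaceTime → ℝ := pderiv T (0, 1, 0, 0)

/-- `∂_{y₂}`, which is also the conormal field `Z₂` -/
def dy2 (T : ℝ) : (SpaceTime → ℝ) → SpaceTime → ℝ := pderiv T (0, 0, 1, 0)

/-- `∂_z` -/
def dz (T : ℝ) : (SpaceTime → ℝ) → SpaceTime → ℝ := pderiv T (0, 0, 0, 1)

/-- The conormal field `Z₃ = z / (1 - z) ∂_z`. -/
def Z3 (T : ℝ) (f : SpaceTime → ℝ) : SpaceTime → ℝ :=
  fun p => p.2.2.2 / (1 - p.2.2.2) * dz T f p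

/-- `∂_t^{β₀} Z₁^{β₁} Z₂^{β₂} Z₃^{β₃} f`. -/
def conormalDeriv (T : ℝ) (β : Fin 4 → ℕ) (f : SpaceTime → ℝ) : SpaceTime → ℝ :=
  (dt T)^[β 0] ((dy1 T)^[β 1] ((dy2 T)^[β 2] ((Z3 T)^[β 3] f)))

/-- All multi-indices in `ℕⁿ` of total order at most `m`. -/
def multiIndices (n m : ℕ) : Finset (Fin n → ℕ) :=
  (Fintype.piFinset fun _ => Finset.range (m + 1)).filter fun β => ∑ i, β i ≤ m

/-- The `L^p` norm over the half space of the time slice `f(t, ·)`. -/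
def sliceNorm (p : ℝ≥0∞) (f : SpaceTime → ℝ) (t : ℝ) : ℝ≥0∞ :=
  eLpNorm (fun x : ℝ × ℝ × ℝ => f (t, x)) p (volume.restrict lowerHalfSpace)

/-- The norm `‖f(t)‖_{X^{m,0}}`: the square root of the sum, over `j + |α| ≤ m`, of
`‖∂_t^j Z^α f(t)‖²` in `L²`. -/
def XNorm (T : ℝ) (m : ℕ) (f : SpaceTime → ℝ) (t : ℝ) : ℝ≥0∞ :=
  (∑ β ∈ multiIndices 4 m, sliceNorm 2 (conormalDeriv T β f) t ^ 2) ^ (1 / 2 : ℝ)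

/-- The norm `‖f(t)‖_{Y^{m,0}}`: the sum, over `j + |α| ≤ m`, of `‖∂_t^j Z^α f(t)‖`
in `L^∞`. -/
def YNorm (T : ℝ) (m : ℕ) (f : SpaceTime → ℝ) (t : ℝ) : ℝ≥0∞ :=
  ∑ β ∈ multiIndices 4 m, sliceNorm ⊤ (conormalDeriv T β f) t

/-- The boundary norm `|f(t, ·, 0)|_{Y^{m,0}}` of the trace on `z = 0`: the sum, over
`j + a + b ≤ m`, of the `L^∞(ℝ²)` norms of `∂_t^j ∂_{y₁}^a ∂_{y₂}^b f (t, ·, 0)`. -/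
def traceYNorm (T : ℝ) (m : ℕ) (f : SpaceTime → ℝ) (t : ℝ) : ℝ≥0∞ :=
  ∑ β ∈ multiIndices 3 m,
    eLpNorm (fun y : ℝ × ℝ =>
      ((dt T)^[β 0] ((dy1 T)^[β 1] ((dy2 T)^[β 2] f))) (t, y.1, y.2, 0)) ⊤ volume

end

noncomputable section

namespace ConormalTransport

open Set Filter Topology

/-! ### Smooth functions on the closed domain -/

/-! The estimate is a maximum principle for every conormal derivative of `ρ` of order at most `k`,
closed by Grönwall. The commutators must therefore cost neither a factor depending on `ε` nor an
unweighted normal derivative of `ρ`.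

Since `ρ` vanishes below `-R`, everything happens on a strip where `z / (1 - z) ∂_z` may be traded
for the Euler field `z ∂_z` (`exists_euler_le_conormal`). The latter satisfies `∂_{zz} (z ∂_z) = (z
∂_z + 2) ∂_{zz}`, so moving `∂_{zz}` through a word of fields produces `Q ∂_{zz}` with `Q` of lower
order. The equation turns `ε Q ∂_{zz} ρ` into `Q (∂_t ρ + w·∇ρ - H)`: at most `k` derivatives of `ρ`
and no `ε`. With `w₃ ∂_z = (w₃ / z) z ∂_z` for the normal transport, this gives
`exists_abs_transport_word_le`.

Integrating from the boundary, `w₁`, `w₂` and `w₃ / z` have size at most a constant times `M + |z|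
y`, where `y` is the norm of `∂_z w_y` and `∂_{zz} w₃` (`exists_coefficient_bounds`). The part with
`M` goes into Grönwall. The part with `|z| y` is paid by the `L²` norm: as `∂_z (z f) = f + (1 - z)
Z₃ f`, the Sobolev inequality for `z f`, with one derivative in each direction, involves conormal
derivatives only (`exists_abs_mul_derivSize_le_XNorm`). The outcome is `exists_source_bounds`.

Nothing is known at positive times as `|(y₁, y₂)|` grows, so the maximum principle is used on a box,
with a cutoff in `(t, y)` whose support shrinks in time fast enough that transport by the boundary
velocity gives a term of good sign (`exists_cutoff`, `abs_cutoff_mul_le`). The rest of the velocity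
is again at most `|z| y` and is paid in the same way. Grönwall for the supremum of the cutoff times
all derivatives, read at a point where the cutoff is `1`, is `exists_derivSize_estimate`.

Functions live in `smoothAlg`: being constant along the retraction `clamp`, they are determined by
their values on the closed domain, so identities there are equalities in an algebra on which
derivatives act as linear endomorphisms. -/

/-- The retraction of space-time onto the closed domain. -/
def clamp (T : ℝ) (p : SpaceTime) : SpaceTime :=
  (max 0 (min p.1 T), p.2.1, p.2.2.1, min p.2.2.2 0)

lemma clamp_of_mem {T : ℝ} {p : SpaceTime} (hp : p ∈ spaceTimeDomain T) : clamp T p = p := by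
  obtain ⟨t, y₁, y₂, z⟩ := p
  obtain ⟨⟨h0, hT⟩, hz⟩ := hp
  simp only at h0 hT hz
  simp [clamp, h0, hT, hz]

lemma continuous_clamp (T : ℝ) : Continuous (clamp T) := by
  unfold clamp; fun_prop

lemma clamp_mem {T : ℝ} [hT : Fact (0 < T)] (p : SpaceTime) : clamp T p ∈ spaceTimeDomain T := by
  refine ⟨⟨le_max_left _ _, ?_⟩, min_le_right _ _⟩
  exact max_le hT.out.le (min_le_right _ _)

lemma spaceTimeDomain_eq_prod (T : ℝ) :
    spaceTimeDomain T = Icc 0 T ×ˢ (univ ×ˢ (univ ×ˢ Iic 0)) := by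
  ext ⟨t, y₁, y₂, z⟩
  simp [spaceTimeDomain]

lemma convex_spaceTimeDomain (T : ℝ) : Convex ℝ (spaceTimeDomain T) := by
  rw [spaceTimeDomain_eq_prod]
  exact (convex_Icc 0 T).prod (convex_univ.prod (convex_univ.prod (convex_Iic 0)))

lemma interior_spaceTimeDomain_nonempty {T : ℝ} (hT : 0 < T) :
    (interior (spaceTimeDomain T)).Nonempty := by
  refine ⟨(T / 2, 0, 0, -1), ?_⟩
  rw [spaceTimeDomain_eq_prod, interior_prod_eq, interior_prod_eq, interior_prod_eq]
  simp [hT]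

lemma uniqueDiffOn_spaceTimeDomain {T : ℝ} (hT : 0 < T) :
    UniqueDiffOn ℝ (spaceTimeDomain T) :=
  uniqueDiffOn_convex (convex_spaceTimeDomain T) (interior_spaceTimeDomain_nonempty hT)

lemma mem_closure_interior_spaceTimeDomain {T : ℝ} (hT : 0 < T) {p : SpaceTime}
    (hp : p ∈ spaceTimeDomain T) : p ∈ closure (interior (spaceTimeDomain T)) := by
  rw [(convex_spaceTimeDomain T).closure_interior_eq_closure_of_nonempty_interior
    (interior_spaceTimeDomain_nonempty hT)]
  exact subset_closure hp

lemma contDiffOn_pderiv {T : ℝ} (hT : 0 < T) {f : SpaceTime → ℝ} (e : SpaceTime)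
    (hf : ContDiffOn ℝ ∞ f (spaceTimeDomain T)) :
    ContDiffOn ℝ ∞ (pderiv T e f) (spaceTimeDomain T) :=
  (hf.fderivWithin (uniqueDiffOn_spaceTimeDomain hT) (m := ∞) le_rfl).clm_apply contDiffOn_const

lemma pderiv_congr {T : ℝ} {f g : SpaceTime → ℝ} (e : SpaceTime)
    (h : EqOn f g (spaceTimeDomain T)) :
    EqOn (pderiv T e f) (pderiv T e g) (spaceTimeDomain T) := by
  intro p hp
  simp only [pderiv]
  rw [fderivWithin_congr h (h hp)]

/-- Symmetry of the second derivative within a set needs the point to be in the closure of the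
interior. This covers the boundary because the domain is convex with nonempty interior. -/
lemma pderiv_comm {T : ℝ} (hT : 0 < T) {f : SpaceTime → ℝ}
    (hf : ContDiffOn ℝ ∞ f (spaceTimeDomain T)) (e e' : SpaceTime) :
    EqOn (pderiv T e (pderiv T e' f)) (pderiv T e' (pderiv T e f)) (spaceTimeDomain T) := by
  intro p hp
  have hU := uniqueDiffOn_spaceTimeDomain hT
  have hd : DifferentiableWithinAt ℝ (fderivWithin ℝ f (spaceTimeDomain T))
      (spaceTimeDomain T) p :=
    (hf.fderivWithin hU (m := ∞) le_rfl).differentiableOn (by simp) p hp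
  have key : ∀ a b : SpaceTime, pderiv T a (pderiv T b f) p
      = fderivWithin ℝ (fderivWithin ℝ f (spaceTimeDomain T)) (spaceTimeDomain T) p a b := by
    intro a b
    change fderivWithin ℝ (fun q => fderivWithin ℝ f (spaceTimeDomain T) q b) _ p a = _
    rw [fderivWithin_clm_apply (hU p hp) hd (differentiableWithinAt_const b)]
    simp
  rw [key, key]
  exact ((hf p hp).isSymmSndFDerivWithinAt
    (by rw [minSmoothness_of_isRCLikeNormedField]; exact WithTop.coe_le_coe.2 le_top) hU
    (mem_closure_interior_spaceTimeDomain hT hp) hp).eq _ _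

/-- Smooth functions on the closed domain, extended by `clamp`. -/
def smoothAlg (T : ℝ) : Subalgebra ℝ (SpaceTime → ℝ) where
  carrier := {f | ContDiffOn ℝ ∞ f (spaceTimeDomain T) ∧ ∀ p, f (clamp T p) = f p}
  mul_mem' := fun ha hb => ⟨ha.1.mul hb.1, fun p => by simp [ha.2 p, hb.2 p]⟩
  add_mem' := fun ha hb => ⟨ha.1.add hb.1, fun p => by simp [ha.2 p, hb.2 p]⟩
  algebraMap_mem' := fun r => ⟨contDiffOn_const, fun _ => rfl⟩

set_option linter.unusedSectionVars false

variable {T : ℝ}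

instance : CoeFun (smoothAlg T) fun _ => SpaceTime → ℝ := ⟨fun f => f.1⟩

@[simp] lemma add_apply (f g : smoothAlg T) (p : SpaceTime) : (f + g) p = f p + g p := rfl
@[simp] lemma sub_apply (f g : smoothAlg T) (p : SpaceTime) : (f - g) p = f p - g p := rfl
@[simp] lemma mul_apply (f g : smoothAlg T) (p : SpaceTime) : (f * g) p = f p * g p := rfl
@[simp] lemma smul_apply (c : ℝ) (f : smoothAlg T) (p : SpaceTime) : (c • f) p = c * f p := rfl
@[simp] lemma one_apply (p : SpaceTime) : (1 : smoothAlg T) p = 1 := rfl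

variable [hT : Fact (0 < T)]

lemma contDiffOn_coe (f : smoothAlg T) : ContDiffOn ℝ ∞ f (spaceTimeDomain T) := f.2.1

lemma apply_clamp (f : smoothAlg T) (p : SpaceTime) : f (clamp T p) = f p := f.2.2 p

lemma continuous_coe (f : smoothAlg T) : Continuous f := by
  have h : (f : SpaceTime → ℝ) = f ∘ clamp T := funext fun p => (apply_clamp f p).symm
  rw [h]
  exact (contDiffOn_coe f).continuousOn.comp_continuous (continuous_clamp T) clamp_mem

lemma smoothAlg_ext {f g : smoothAlg T} (h : EqOn f g (spaceTimeDomain T)) : f = g := by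
  refine Subtype.ext (funext fun p => ?_)
  rw [← apply_clamp f, ← apply_clamp g]
  exact h (clamp_mem p)

lemma mem_closure_neg {p : SpaceTime} (hp : p ∈ spaceTimeDomain T) :
    p ∈ closure {q : SpaceTime | q.1 = p.1 ∧ q.2.1 = p.2.1 ∧ q.2.2.1 = p.2.2.1 ∧ q.2.2.2 < 0} := by
  obtain ⟨t, y₁, y₂, z⟩ := p
  have h1 : Tendsto (fun s : ℝ => ((t, y₁, y₂, z - s) : SpaceTime)) (𝓝[>] 0)
      (𝓝 (t, y₁, y₂, z)) := by
    have : Continuous (fun s : ℝ => ((t, y₁, y₂, z - s) : SpaceTime)) := by fun_prop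
    have h := this.tendsto 0
    simp only [sub_zero] at h
    exact h.mono_left nhdsWithin_le_nhds
  refine mem_closure_of_tendsto h1 ?_
  filter_upwards [self_mem_nhdsWithin] with s hs
  have hz : z ≤ 0 := hp.2
  have hs' : (0 : ℝ) < s := hs
  exact ⟨rfl, rfl, rfl, by linarith⟩

/-- A closed condition on each vertical half line `z < 0` extends to the boundary. -/
lemma le_of_le_neg {f g : SpaceTime → ℝ} (hf : Continuous f) (hg : Continuous g)
    {p : SpaceTime} (hp : p ∈ spaceTimeDomain T)
    (h : ∀ q, q.1 = p.1 → q.2.1 = p.2.1 → q.2.2.1 = p.2.2.1 → q.2.2.2 < 0 → f q ≤ g q) :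
    f p ≤ g p := by
  have : closure {q : SpaceTime | q.1 = p.1 ∧ q.2.1 = p.2.1 ∧ q.2.2.1 = p.2.2.1 ∧ q.2.2.2 < 0}
      ⊆ {q | f q ≤ g q} :=
    closure_minimal (fun q hq => h q hq.1 hq.2.1 hq.2.2.1 hq.2.2.2) (isClosed_le hf hg)
  exact this (mem_closure_neg hp)

/-- The equation is assumed for `z < 0` only. Continuity carries it to `z = 0`, and it becomes an
identity in `smoothAlg` to which operators can be applied. -/
lemma smoothAlg_ext_neg {f g : smoothAlg T}
    (h : ∀ p ∈ spaceTimeDomain T, p.2.2.2 < 0 → f p = g p) : f = g := by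
  refine smoothAlg_ext fun p hp => ?_
  have hq : ∀ q : SpaceTime, q.1 = p.1 → q.2.1 = p.2.1 → q.2.2.1 = p.2.2.1 → q.2.2.2 < 0 →
      f q = g q := fun q h1 _ _ h4 => h q ⟨h1 ▸ hp.1, h4.le⟩ h4
  exact le_antisymm
    (le_of_le_neg (continuous_coe f) (continuous_coe g) hp fun q a b c d => (hq q a b c d).le)
    (le_of_le_neg (continuous_coe g) (continuous_coe f) hp fun q a b c d => (hq q a b c d).ge)

/-- The element of `smoothAlg T` given by a function smooth on the closed domain. -/
def ofFun (f : SpaceTime → ℝ) (hf : ContDiffOn ℝ ∞ f (spaceTimeDomain T)) : smoothAlg T :=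
  ⟨f ∘ clamp T, hf.congr fun p hp => by simp [clamp_of_mem hp],
    fun p => by simp [clamp_of_mem (clamp_mem p)]⟩

lemma ofFun_apply {f : SpaceTime → ℝ} (hf : ContDiffOn ℝ ∞ f (spaceTimeDomain T)) {p : SpaceTime}
    (hp : p ∈ spaceTimeDomain T) : ofFun f hf p = f p := by
  simp [ofFun, clamp_of_mem hp]

lemma eqOn_ofFun {f : SpaceTime → ℝ} (hf : ContDiffOn ℝ ∞ f (spaceTimeDomain T)) :
    EqOn (ofFun f hf) f (spaceTimeDomain T) := fun _ hp => ofFun_apply hf hp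

lemma differentiableWithinAt_coe (f : smoothAlg T) {p : SpaceTime} (hp : p ∈ spaceTimeDomain T) :
    DifferentiableWithinAt ℝ f (spaceTimeDomain T) p :=
  (contDiffOn_coe f).differentiableOn (by simp) p hp

/-- The partial derivative as an operator on smooth functions. -/
def pd (e : SpaceTime) : Module.End ℝ (smoothAlg T) where
  toFun f := ofFun (pderiv T e f) (contDiffOn_pderiv hT.out e (contDiffOn_coe f))
  map_add' f g := smoothAlg_ext fun p hp => by
    rw [add_apply, ofFun_apply _ hp, ofFun_apply _ hp, ofFun_apply _ hp]
    simp only [pderiv]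
    rw [show ((f + g : smoothAlg T) : SpaceTime → ℝ) = (f : SpaceTime → ℝ) + g from rfl,
      fderivWithin_add (uniqueDiffOn_spaceTimeDomain hT.out p hp) (differentiableWithinAt_coe f hp)
      (differentiableWithinAt_coe g hp)]
    rfl
  map_smul' c f := smoothAlg_ext fun p hp => by
    rw [RingHom.id_apply, smul_apply, ofFun_apply _ hp, ofFun_apply _ hp]
    simp only [pderiv]
    rw [show ((c • f : smoothAlg T) : SpaceTime → ℝ) = c • (f : SpaceTime → ℝ) from rfl,
      fderivWithin_const_smul (uniqueDiffOn_spaceTimeDomain hT.out p hp)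
        (differentiableWithinAt_coe f hp) c]
    rfl

lemma pd_apply (e : SpaceTime) (f : smoothAlg T) {p : SpaceTime} (hp : p ∈ spaceTimeDomain T) :
    pd e f p = pderiv T e f p :=
  ofFun_apply (contDiffOn_pderiv hT.out e (contDiffOn_coe f)) hp

lemma pd_apply_of_eqOn (e : SpaceTime) (f : smoothAlg T) {g : SpaceTime → ℝ}
    (h : EqOn f g (spaceTimeDomain T)) : EqOn (pd e f) (pderiv T e g) (spaceTimeDomain T) :=
  fun p hp => by rw [pd_apply e f hp, pderiv_congr e h hp]

lemma pd_mul (e : SpaceTime) (f g : smoothAlg T) : pd e (f * g) = pd e f * g + f * pd e g := by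
  refine smoothAlg_ext fun p hp => ?_
  rw [add_apply, mul_apply, mul_apply, pd_apply _ _ hp, pd_apply _ _ hp, pd_apply _ _ hp]
  simp only [pderiv]
  rw [show ((f * g : smoothAlg T) : SpaceTime → ℝ) = (f : SpaceTime → ℝ) * g from rfl,
    fderivWithin_mul (uniqueDiffOn_spaceTimeDomain hT.out p hp) (differentiableWithinAt_coe f hp)
      (differentiableWithinAt_coe g hp)]
  simp
  ring

lemma pd_comm (e e' : SpaceTime) (f : smoothAlg T) : pd e (pd e' f) = pd e' (pd e f) := by
  refine smoothAlg_ext fun p hp => ?_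
  rw [pd_apply_of_eqOn e _ (fun q hq => pd_apply e' f hq) hp,
    pd_apply_of_eqOn e' _ (fun q hq => pd_apply e f hq) hp]
  exact pderiv_comm hT.out (contDiffOn_coe f) e e' hp

/-- Along a line inside the domain, `pd` is the one-dimensional derivative. -/
lemma hasDerivWithinAt_line (e : SpaceTime) (f : smoothAlg T) {p : SpaceTime} {s : Set ℝ} {x : ℝ}
    (hs : ∀ r ∈ s, p + r • e ∈ spaceTimeDomain T) (hx : x ∈ s) :
    HasDerivWithinAt (fun r : ℝ => f (p + r • e)) (pd e f (p + x • e)) s x := by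
  rw [pd_apply e f (hs x hx)]
  have h1 := (differentiableWithinAt_coe f (hs x hx)).hasFDerivWithinAt
  have h2 : HasDerivWithinAt (fun r : ℝ => p + r • e) e s x := by
    simpa using (((hasDerivAt_id x).smul_const e).const_add p).hasDerivWithinAt
  exact h1.comp_hasDerivWithinAt x h2 hs

/-- The derivative of a globally smooth function. -/
lemma pd_ofFun_of_hasDerivAt {g : SpaceTime → ℝ} (hg : ContDiff ℝ ∞ g) (e : SpaceTime)
    {p : SpaceTime} (hp : p ∈ spaceTimeDomain T) {d : ℝ}
    (hd : HasDerivAt (fun r : ℝ => g (p + r • e)) d 0) :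
    pd e (ofFun (T := T) g hg.contDiffOn) p = d := by
  rw [pd_apply_of_eqOn e _ (eqOn_ofFun _) hp, pderiv,
    fderivWithin_eq_fderiv (uniqueDiffOn_spaceTimeDomain hT.out p hp)
      (hg.differentiable (by simp) p)]
  have h1 : HasFDerivAt g (fderiv ℝ g p) (p + (0 : ℝ) • e) := by
    simpa using (hg.differentiable (by simp) p).hasFDerivAt
  have h2 : HasDerivAt (fun r : ℝ => p + r • e) e 0 := by
    simpa using ((hasDerivAt_id (0 : ℝ)).smul_const e).const_add p
  exact (h1.comp_hasDerivAt 0 h2).unique hd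

/-! ### Words in a family of derivations -/

/-- The composition of the operators `X i` along a word. -/
def word (X : Fin 4 → Module.End ℝ (smoothAlg T)) (u : List (Fin 4)) :
    Module.End ℝ (smoothAlg T) := (u.map X).prod

@[simp] lemma word_nil (X : Fin 4 → Module.End ℝ (smoothAlg T)) : word X [] = 1 := rfl

@[simp] lemma word_cons (X : Fin 4 → Module.End ℝ (smoothAlg T)) (i : Fin 4) (u : List (Fin 4)) :
    word X (i :: u) = X i * word X u := rfl

@[simp] lemma word_append (X : Fin 4 → Module.End ℝ (smoothAlg T)) (u v : List (Fin 4)) :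
    word X (u ++ v) = word X u * word X v := by
  simp [word]

/-- The sum of `|X_u f|` at a point over all words `u` of length less than `n`. -/
def derivSize (X : Fin 4 → Module.End ℝ (smoothAlg T)) : ℕ → smoothAlg T → SpaceTime → ℝ
  | 0, _, _ => 0
  | n + 1, f, p => |f p| + ∑ i, derivSize X n (X i f) p

section

variable (X : Fin 4 → Module.End ℝ (smoothAlg T))

lemma derivSize_nonneg (n : ℕ) (f : smoothAlg T) (p : SpaceTime) : 0 ≤ derivSize X n f p := by
  induction n generalizing f with
  | zero => exact le_rfl
  | succ n ih => exact add_nonneg (abs_nonneg _) (Finset.sum_nonneg fun i _ => ih _)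

lemma derivSize_le_succ (n : ℕ) (f : smoothAlg T) (p : SpaceTime) :
    derivSize X n f p ≤ derivSize X (n + 1) f p := by
  induction n generalizing f with
  | zero => exact derivSize_nonneg X 1 f p
  | succ n ih =>
    change |f p| + ∑ i, derivSize X n (X i f) p ≤ |f p| + ∑ i, derivSize X (n + 1) (X i f) p
    gcongr with i _
    exact ih _

lemma derivSize_apply_le (n : ℕ) (i : Fin 4) (f : smoothAlg T) (p : SpaceTime) :
    derivSize X n (X i f) p ≤ derivSize X (n + 1) f p := by
  rw [derivSize]
  have := Finset.single_le_sum (f := fun i => derivSize X n (X i f) p)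
    (fun i _ => derivSize_nonneg X n (X i f) p) (Finset.mem_univ i)
  exact this.trans (le_add_of_nonneg_left (abs_nonneg _))

lemma abs_le_derivSize (n : ℕ) (f : smoothAlg T) (p : SpaceTime) :
    |f p| ≤ derivSize X (n + 1) f p := by
  rw [derivSize]
  exact le_add_of_nonneg_right (Finset.sum_nonneg fun i _ => derivSize_nonneg X _ _ _)

lemma continuous_derivSize (n : ℕ) (f : smoothAlg T) : Continuous (derivSize X n f) := by
  induction n generalizing f with
  | zero => exact continuous_const
  | succ n ih =>
    have h : derivSize X (n + 1) f = fun p => |f p| + ∑ i, derivSize X n (X i f) p := rfl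
    rw [h]
    exact (continuous_coe f).abs.add (continuous_finsetSum _ fun i _ => ih _)

lemma derivSize_add_le (n : ℕ) (f g : smoothAlg T) (p : SpaceTime) :
    derivSize X n (f + g) p ≤ derivSize X n f p + derivSize X n g p := by
  induction n generalizing f g with
  | zero => simp [derivSize]
  | succ n ih =>
    simp only [derivSize, map_add]
    calc _ ≤ (|f p| + |g p|) + ∑ i, (derivSize X n (X i f) p + derivSize X n (X i g) p) := by
          gcongr with i _
          · exact abs_add_le _ _
          · exact ih _ _
      _ = _ := by rw [Finset.sum_add_distrib]; ring

/-- `derivSize` unfolds at the operator that acts first, which is the last letter of the word; hence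
the induction from the right. -/
lemma abs_word_le {n : ℕ} {u : List (Fin 4)} (hu : u.length < n) (f : smoothAlg T)
    (p : SpaceTime) : |word X u f p| ≤ derivSize X n f p := by
  induction u using List.reverseRecOn generalizing n f with
  | nil =>
    obtain ⟨n, rfl⟩ := Nat.exists_eq_succ_of_ne_zero (Nat.ne_of_gt hu)
    exact abs_le_derivSize X n f p
  | append_singleton u i ih =>
    obtain ⟨n, rfl⟩ : ∃ m, n = m + 1 := ⟨n - 1, by simp at hu; omega⟩
    have h1 := ih (n := n) (by simpa using hu) (X i f)
    simp only [word_append, word_cons, word_nil, mul_one]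
    exact h1.trans (derivSize_apply_le X n i f p)

/-- Bounds on all words give a bound on `derivSize`. -/
lemma derivSize_le_of_words (n : ℕ) : ∃ C : ℝ, 0 ≤ C ∧ ∀ (f : smoothAlg T) (p : SpaceTime) (B : ℝ),
    (∀ u : List (Fin 4), u.length < n → |word X u f p| ≤ B) → derivSize X n f p ≤ C * B := by
  induction n with
  | zero => exact ⟨0, le_rfl, fun f p B _ => by simp [derivSize]⟩
  | succ n ih =>
    obtain ⟨C, hC, h⟩ := ih
    refine ⟨1 + 4 * C, by positivity, fun f p B hB => ?_⟩
    rw [derivSize]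
    have h0 : |f p| ≤ B := hB [] (by simp)
    have h1 : ∀ i, derivSize X n (X i f) p ≤ C * B := fun i => h _ _ _ fun u hu => by
      have := hB (u ++ [i]) (by simpa using hu)
      simpa using this
    calc _ ≤ B + ∑ _i : Fin 4, C * B := by gcongr with i _; exact h1 i
      _ = _ := by simp; ring

/-- The derivation property. -/
def IsDerivFamily : Prop := ∀ i (f g : smoothAlg T), X i (f * g) = X i f * g + f * X i g

variable {X}

/-- Leibniz, pointwise: each of the four fields produces two products, whence the `8 * C`. -/
lemma IsDerivFamily.derivSize_mul (hX : IsDerivFamily X) (n : ℕ) :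
    ∃ C : ℝ, 0 ≤ C ∧ ∀ (f g : smoothAlg T) (p : SpaceTime),
      derivSize X n (f * g) p ≤ C * derivSize X n f p * derivSize X n g p := by
  induction n with
  | zero => exact ⟨0, le_rfl, fun f g p => by simp [derivSize]⟩
  | succ n ih =>
    obtain ⟨C, hC, h⟩ := ih
    refine ⟨1 + 8 * C, by positivity, fun f g p => ?_⟩
    have hf := derivSize_nonneg X (n + 1) f p
    have hg := derivSize_nonneg X (n + 1) g p
    set F := derivSize X (n + 1) f p
    set G := derivSize X (n + 1) g p
    have h0 : |(f * g) p| ≤ F * G := by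
      rw [mul_apply, abs_mul]
      exact mul_le_mul (abs_le_derivSize X n f p) (abs_le_derivSize X n g p) (abs_nonneg _) hf
    have h1 : ∀ i, derivSize X n (X i (f * g)) p ≤ 2 * C * F * G := fun i => by
      rw [hX]
      refine (derivSize_add_le X n _ _ p).trans ?_
      have a1 : derivSize X n (X i f * g) p ≤ C * F * G :=
        (h _ _ _).trans <| by
          gcongr
          · exact derivSize_nonneg X _ _ _
          · exact derivSize_apply_le X n i f p
          · exact derivSize_le_succ X n g p
      have a2 : derivSize X n (f * X i g) p ≤ C * F * G :=
        (h _ _ _).trans <| by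
          gcongr
          · exact derivSize_nonneg X _ _ _
          · exact derivSize_le_succ X n f p
          · exact derivSize_apply_le X n i g p
      linarith
    calc derivSize X (n + 1) (f * g) p ≤ F * G + ∑ _i : Fin 4, 2 * C * F * G := by
          rw [derivSize]; gcongr with i _; exact h1 i
      _ = _ := by simp; ring

/-- The commutator of a word with a multiplication operator has lower order. -/
lemma IsDerivFamily.abs_word_mul_sub_le (hX : IsDerivFamily X) (n : ℕ) :
    ∃ C : ℝ, 0 ≤ C ∧ ∀ (u : List (Fin 4)), u.length ≤ n → ∀ (f g : smoothAlg T) (p : SpaceTime),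
      |word X u (f * g) p - f p * word X u g p|
        ≤ C * derivSize X (n + 1) f p * derivSize X n g p := by
  induction n with
  | zero =>
    refine ⟨0, le_rfl, fun u hu f g p => ?_⟩
    obtain rfl : u = [] := by simpa using hu
    simp
  | succ n ih =>
    obtain ⟨C, hC, h⟩ := ih
    obtain ⟨C', hC', h'⟩ := hX.derivSize_mul (n + 1)
    refine ⟨C' + C, by positivity, fun u hu f g p => ?_⟩
    have hf := derivSize_nonneg X (n + 2) f p
    have hg := derivSize_nonneg X (n + 1) g p
    rcases List.eq_nil_or_concat' u with rfl | ⟨v, i, rfl⟩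
    · simp; positivity
    have hv : v.length ≤ n := by simpa using hu
    have a1 : |word X v (X i f * g) p| ≤ C' * derivSize X (n + 2) f p * derivSize X (n + 1) g p := by
      refine (abs_word_le X (Nat.lt_succ_of_le hv) _ p).trans ((h' _ _ _).trans ?_)
      gcongr
      exact derivSize_apply_le X (n + 1) i f p
    have a2 : |word X v (f * X i g) p - f p * word X v (X i g) p|
        ≤ C * derivSize X (n + 2) f p * derivSize X (n + 1) g p := by
      refine (h v hv f (X i g) p).trans ?_
      gcongr
      · exact derivSize_nonneg X _ _ _
      · exact derivSize_le_succ X _ f p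
      · exact derivSize_apply_le X n i g p
    -- Leibniz for the innermost letter: one term where `f` has been differentiated, so that `g`
    -- carries one derivative less, and a shorter commutator acting on `X i g`.
    have e : word X (v ++ [i]) (f * g) p - f p * word X (v ++ [i]) g p
        = word X v (X i f * g) p + (word X v (f * X i g) p - f p * word X v (X i g) p) := by
      simp only [word_append, word_cons, word_nil, mul_one, Module.End.mul_apply, hX i f g, map_add,
        add_apply]
      ring
    rw [e]
    refine (abs_add_le _ _).trans ?_
    linarith

/-! ### Operators of bounded order, and passing them through shifted words -/

variable (X)

/-- The span of the words of length less than `n`. -/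
def wordSpan (n : ℕ) : Submodule ℝ (Module.End ℝ (smoothAlg T)) :=
  Submodule.span ℝ {Q | ∃ u : List (Fin 4), u.length < n ∧ word X u = Q}

lemma word_mem_wordSpan {n : ℕ} {u : List (Fin 4)} (hu : u.length < n) :
    word X u ∈ wordSpan X n := Submodule.subset_span ⟨u, hu, rfl⟩

lemma wordSpan_mono {m n : ℕ} (h : m ≤ n) : wordSpan X m ≤ wordSpan X n :=
  Submodule.span_mono fun _ ⟨u, hu, e⟩ => ⟨u, hu.trans_le h, e⟩

lemma mul_mem_wordSpan {n : ℕ} (i : Fin 4) {Q : Module.End ℝ (smoothAlg T)}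
    (hQ : Q ∈ wordSpan X n) : X i * Q ∈ wordSpan X (n + 1) := by
  induction hQ using Submodule.span_induction with
  | mem Q h =>
    obtain ⟨u, hu, rfl⟩ := h
    rw [← word_cons]
    exact word_mem_wordSpan X (by simpa using hu)
  | zero => simp
  | add a b _ _ ha hb => rw [mul_add]; exact add_mem ha hb
  | smul c a _ ha => rw [mul_smul_comm]; exact Submodule.smul_mem _ c ha

lemma exists_abs_apply_le {n : ℕ} {Q : Module.End ℝ (smoothAlg T)} (hQ : Q ∈ wordSpan X n) :
    ∃ C : ℝ, 0 ≤ C ∧ ∀ (f : smoothAlg T) (p : SpaceTime), |Q f p| ≤ C * derivSize X n f p := by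
  induction hQ using Submodule.span_induction with
  | mem Q h =>
    obtain ⟨u, hu, rfl⟩ := h
    exact ⟨1, zero_le_one, fun f p => by rw [one_mul]; exact abs_word_le X hu f p⟩
  | zero => exact ⟨0, le_rfl, fun f p => by simp⟩
  | add a b _ _ ha hb =>
    obtain ⟨C, hC, h⟩ := ha
    obtain ⟨C', hC', h'⟩ := hb
    refine ⟨C + C', by positivity, fun f p => ?_⟩
    rw [LinearMap.add_apply, add_apply, add_mul]
    exact (abs_add_le _ _).trans (add_le_add (h f p) (h' f p))
  | smul c a _ ha =>
    obtain ⟨C, hC, h⟩ := ha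
    refine ⟨|c| * C, by positivity, fun f p => ?_⟩
    rw [LinearMap.smul_apply, smul_apply, abs_mul, mul_assoc]
    exact mul_le_mul_of_nonneg_left (h f p) (abs_nonneg c)

/-- The family with `X 3` shifted by a constant. -/
def twist (c : ℝ) : Fin 4 → Module.End ℝ (smoothAlg T) :=
  fun i => X i + (if i = 3 then c else 0) • 1

/-- When the product of shifted letters is expanded, the only term of full length is the unshifted
word. -/
lemma exists_word_twist_eq (c : ℝ) (u : List (Fin 4)) :
    ∃ Q ∈ wordSpan X u.length, word (twist X c) u = word X u + Q := by
  induction u with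
  | nil => exact ⟨0, zero_mem _, by simp⟩
  | cons i u ih =>
    obtain ⟨Q, hQ, e⟩ := ih
    refine ⟨X i * Q + (if i = 3 then c else 0) • (word X u + Q),
      add_mem (mul_mem_wordSpan X i hQ) (Submodule.smul_mem _ _ (add_mem ?_ ?_)), ?_⟩
    · exact word_mem_wordSpan X (Nat.lt_succ_self _)
    · exact wordSpan_mono X (Nat.le_succ _) hQ
    · rw [word_cons, word_cons, e, twist, add_mul, mul_add, smul_mul_assoc, one_mul, add_assoc]

lemma word_twist_mem (c : ℝ) {n : ℕ} {u : List (Fin 4)} (hu : u.length < n) :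
    word (twist X c) u ∈ wordSpan X n := by
  obtain ⟨Q, hQ, e⟩ := exists_word_twist_eq X c u
  rw [e]
  exact add_mem (word_mem_wordSpan X hu) (wordSpan_mono X hu.le hQ)

variable {X}

/-- The one-letter relation is applied along the word. It serves for `S` equal to multiplication by
`z`, to `∂_z` and to `∂_{zz}`, with shifts `-1`, `1` and `2`. -/
lemma mul_word_of_twist {S : Module.End ℝ (smoothAlg T)} {c : ℝ}
    (h : ∀ i, S * X i = twist X c i * S) (u : List (Fin 4)) :
    S * word X u = word (twist X c) u * S := by
  induction u with
  | nil => simp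
  | cons i u ih => rw [word_cons, word_cons, ← mul_assoc, h, mul_assoc, ih, mul_assoc]

lemma exists_mul_eq_of_twist {S : Module.End ℝ (smoothAlg T)} {c : ℝ}
    (h : ∀ i, S * X i = twist X c i * S) {n : ℕ} {Q : Module.End ℝ (smoothAlg T)}
    (hQ : Q ∈ wordSpan X n) : ∃ Q' ∈ wordSpan X n, S * Q = Q' * S := by
  induction hQ using Submodule.span_induction with
  | mem Q h' =>
    obtain ⟨u, hu, rfl⟩ := h'
    exact ⟨_, word_twist_mem X c hu, mul_word_of_twist h u⟩
  | zero => exact ⟨0, zero_mem _, by simp⟩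
  | add a b _ _ ha hb =>
    obtain ⟨a', ha', e⟩ := ha
    obtain ⟨b', hb', e'⟩ := hb
    exact ⟨a' + b', add_mem ha' hb', by rw [mul_add, e, e', add_mul]⟩
  | smul r a _ ha =>
    obtain ⟨a', ha', e⟩ := ha
    exact ⟨r • a', Submodule.smul_mem _ r ha', by rw [mul_smul_comm, e, smul_mul_assoc]⟩

/-! ### From words to multi-indices -/

/-- Words in commuting operators can be sorted. -/
lemma word_eq_sorted (hX : ∀ i j, Commute (X i) (X j)) (u : List (Fin 4)) :
    word X u = X 0 ^ u.count 0 * X 1 ^ u.count 1 * X 2 ^ u.count 2 * X 3 ^ u.count 3 := by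
  induction u with
  | nil => simp
  | cons i u ih =>
    rw [word_cons, ih]
    have c1 := ((hX 1 0).pow_right (u.count 0)).eq
    have c2 := ((hX 2 0).pow_right (u.count 0)).eq
    have c2' := ((hX 2 1).pow_right (u.count 1)).eq
    have c3 := ((hX 3 0).pow_right (u.count 0)).eq
    have c3' := ((hX 3 1).pow_right (u.count 1)).eq
    have c3'' := ((hX 3 2).pow_right (u.count 2)).eq
    fin_cases i
    · simp [pow_succ', mul_assoc]
    · simp only [Fin.mk_one, Fin.isValue, List.count_cons]
      simp only [← mul_assoc, c1]
      simp [pow_succ', mul_assoc]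
    · simp only [Fin.reduceFinMk, Fin.isValue, List.count_cons]
      simp only [← mul_assoc, c2]
      rw [mul_assoc _ (X 2), c2']
      simp [pow_succ', mul_assoc]
    · simp only [Fin.reduceFinMk, Fin.isValue, List.count_cons]
      simp only [← mul_assoc, c3]
      rw [mul_assoc _ (X 3), c3', ← mul_assoc, mul_assoc _ (X 3), c3'']
      simp [pow_succ', mul_assoc]

/-- The sorted word of a multi-index. -/
def monomialWord (β : Fin 4 → ℕ) : List (Fin 4) :=
  List.replicate (β 0) 0 ++ List.replicate (β 1) 1 ++ List.replicate (β 2) 2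
    ++ List.replicate (β 3) 3

lemma length_monomialWord (β : Fin 4 → ℕ) : (monomialWord β).length = ∑ i, β i := by
  simp [monomialWord, Fin.sum_univ_four, add_assoc]

lemma word_replicate (i : Fin 4) (n : ℕ) : word X (List.replicate n i) = X i ^ n := by
  simp [word]

lemma word_monomialWord (β : Fin 4 → ℕ) :
    word X (monomialWord β) = X 0 ^ β 0 * X 1 ^ β 1 * X 2 ^ β 2 * X 3 ^ β 3 := by
  simp [monomialWord, word_replicate, mul_assoc]

lemma sum_count (u : List (Fin 4)) : ∑ i, u.count i = u.length := by
  induction u with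
  | nil => simp
  | cons a u ih => simp [List.count_cons, Finset.sum_add_distrib, ih]

lemma word_eq_monomial (hX : ∀ i j, Commute (X i) (X j)) (u : List (Fin 4)) :
    word X u = word X (monomialWord fun i => u.count i) := by
  rw [word_eq_sorted hX, word_monomialWord]

end

/-! ### The tangential and conormal vector fields -/

/-- The derivations `∂_t`, `∂_{y₁}`, `∂_{y₂}` and `φ ∂_z`. -/
def vectorFields (φ : smoothAlg T) : Fin 4 → Module.End ℝ (smoothAlg T) :=
  ![pd (1, 0, 0, 0), pd (0, 1, 0, 0), pd (0, 0, 1, 0),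
    LinearMap.mulLeft ℝ φ * pd (0, 0, 0, 1)]

lemma vectorFields_zero (φ f : smoothAlg T) : vectorFields φ 0 f = pd (1, 0, 0, 0) f := rfl
lemma vectorFields_one (φ f : smoothAlg T) : vectorFields φ 1 f = pd (0, 1, 0, 0) f := rfl
lemma vectorFields_two (φ f : smoothAlg T) : vectorFields φ 2 f = pd (0, 0, 1, 0) f := rfl
lemma vectorFields_three (φ f : smoothAlg T) :
    vectorFields φ 3 f = φ * pd (0, 0, 0, 1) f := rfl

lemma isDerivFamily_vectorFields (φ : smoothAlg T) : IsDerivFamily (vectorFields φ) := by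
  intro i f g
  fin_cases i
  · exact pd_mul _ f g
  · exact pd_mul _ f g
  · exact pd_mul _ f g
  · simp only [Fin.reduceFinMk, vectorFields_three, pd_mul]
    ring

/-- Functions of `z` alone, in the sense that the tangential derivatives vanish. -/
def IsNormal (φ : smoothAlg T) : Prop :=
  pd (1, 0, 0, 0) φ = 0 ∧ pd (0, 1, 0, 0) φ = 0 ∧ pd (0, 0, 1, 0) φ = 0

/-- A weight depending on `z` alone is killed by the tangential derivatives, so no Leibniz term
survives. -/
lemma commute_vectorFields {φ : smoothAlg T} (hφ : IsNormal φ) (i j : Fin 4) :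
    Commute (vectorFields φ i) (vectorFields φ j) := by
  obtain ⟨h0, h1, h2⟩ := hφ
  refine LinearMap.ext fun f => ?_
  simp only [Module.End.mul_apply]
  fin_cases i <;> fin_cases j <;>
    simp only [Fin.zero_eta, Fin.mk_one, Fin.reduceFinMk, vectorFields_zero, vectorFields_one,
      vectorFields_two, vectorFields_three, pd_mul, h0, h1, h2, zero_mul, zero_add] <;>
    first | rfl | exact pd_comm _ _ _ | rw [pd_comm]

/-- The coordinate `z`. -/
def zc : smoothAlg T := ofFun (fun p => p.2.2.2) (by fun_prop)

lemma zc_apply {p : SpaceTime} (hp : p ∈ spaceTimeDomain T) : (zc : smoothAlg T) p = p.2.2.2 :=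
  ofFun_apply _ hp

lemma pd_zc (e : SpaceTime) : pd e (zc : smoothAlg T) = e.2.2.2 • 1 := by
  refine smoothAlg_ext fun p hp => ?_
  rw [zc, pd_ofFun_of_hasDerivAt (g := fun p => p.2.2.2) (by fun_prop) e hp (d := e.2.2.2)]
  · simp
  · simpa using ((hasDerivAt_id (0 : ℝ)).mul_const e.2.2.2).const_add p.2.2.2

lemma isNormal_zc : IsNormal (zc : smoothAlg T) := by
  refine ⟨?_, ?_, ?_⟩ <;> simp [pd_zc]

lemma pd_one (e : SpaceTime) : pd e (1 : smoothAlg T) = 0 := by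
  have h := pd_mul e (1 : smoothAlg T) 1
  simpa using h

lemma pd_smul (e : SpaceTime) (c : ℝ) (f : smoothAlg T) : pd e (c • f) = c • pd e f :=
  map_smul _ _ _

/-- The function `1 / (1 - z)`. -/
def rc : smoothAlg T := ofFun (fun p => (1 - p.2.2.2)⁻¹)
  (ContDiffOn.inv (by fun_prop) fun p hp => by have : p.2.2.2 ≤ 0 := hp.2; linarith)

lemma rc_apply {p : SpaceTime} (hp : p ∈ spaceTimeDomain T) :
    (rc : smoothAlg T) p = (1 - p.2.2.2)⁻¹ :=
  ofFun_apply _ hp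

lemma rc_mul : (rc : smoothAlg T) * (1 - zc) = 1 := by
  refine smoothAlg_ext fun p hp => ?_
  have : p.2.2.2 ≤ 0 := hp.2
  rw [mul_apply, rc_apply hp, sub_apply, one_apply, zc_apply hp,
    inv_mul_cancel₀ (by linarith)]

/-- Differentiate `rc * (1 - zc) = 1`. The result is again polynomial in `rc`, which makes
`coeffAlg` stable under derivatives. -/
lemma pd_rc (e : SpaceTime) : pd e (rc : smoothAlg T) = e.2.2.2 • rc ^ 2 := by
  have h : pd e ((rc : smoothAlg T) * (1 - zc)) = 0 := by rw [rc_mul, pd_one]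
  rw [pd_mul, map_sub, pd_one, pd_zc] at h
  refine smoothAlg_ext fun p hp => ?_
  have h1 : pd e (rc : smoothAlg T) p * (1 - (zc : smoothAlg T) p)
      + (rc : smoothAlg T) p * (0 - e.2.2.2 * 1) = 0 :=
    congrArg (fun x : smoothAlg T => x p) h
  have h2 : (rc : smoothAlg T) p * (1 - (zc : smoothAlg T) p) = 1 :=
    congrArg (fun x : smoothAlg T => x p) rc_mul
  change _ = e.2.2.2 * ((rc : smoothAlg T) p) ^ 2
  linear_combination (rc : smoothAlg T) p * h1 - pd e (rc : smoothAlg T) p * h2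

/-- The function `z / (1 - z)`. -/
def phiZ : smoothAlg T := rc * zc

lemma zc_eq : (zc : smoothAlg T) = (1 - zc) * phiZ := by
  rw [phiZ, ← mul_assoc, mul_comm (1 - zc), rc_mul, one_mul]

lemma isNormal_phiZ : IsNormal (phiZ : smoothAlg T) := by
  refine ⟨?_, ?_, ?_⟩ <;> simp [phiZ, pd_mul, pd_zc, pd_rc]

lemma mulLeft_zc_mul (i : Fin 4) :
    LinearMap.mulLeft ℝ (zc : smoothAlg T) * vectorFields zc i
      = twist (vectorFields zc) (-1) i * LinearMap.mulLeft ℝ zc := by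
  refine LinearMap.ext fun f => ?_
  fin_cases i <;>
    simp [twist, vectorFields_zero, vectorFields_one, vectorFields_two, vectorFields_three,
      pd_mul, pd_zc, mul_add]

lemma pd_z_mul (i : Fin 4) :
    pd (0, 0, 0, 1) * vectorFields (zc : smoothAlg T) i
      = twist (vectorFields zc) 1 i * pd (0, 0, 0, 1) := by
  refine LinearMap.ext fun f => ?_
  fin_cases i <;>
    simp [twist, vectorFields_zero, vectorFields_one, vectorFields_two, vectorFields_three,
      pd_mul, pd_zc] <;> first | exact pd_comm _ _ _ | exact add_comm _ _

/-- This is the reason for replacing the weight `z / (1 - z)` by `z`: the commutator with `∂_{zz}`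
is a constant multiple of `∂_{zz}`, with no variable coefficient and no first-order remainder. -/
lemma pd_zz_mul (i : Fin 4) :
    (pd (0, 0, 0, 1) * pd (0, 0, 0, 1)) * vectorFields (zc : smoothAlg T) i
      = twist (vectorFields zc) 2 i * (pd (0, 0, 0, 1) * pd (0, 0, 0, 1)) := by
  refine LinearMap.ext fun f => ?_
  fin_cases i
  · simp [twist, vectorFields_zero]
    rw [pd_comm _ (1, 0, 0, 0), pd_comm _ (1, 0, 0, 0)]
  · simp [twist, vectorFields_one]
    rw [pd_comm _ (0, 1, 0, 0), pd_comm _ (0, 1, 0, 0)]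
  · simp [twist, vectorFields_two]
    rw [pd_comm _ (0, 0, 1, 0), pd_comm _ (0, 0, 1, 0)]
  · simp [twist, vectorFields_three, pd_mul, pd_zc, two_smul]
    abel

/-! ### Coefficients bounded in the strip -/

/-- The algebra generated by `1 / (1 - z)` and `1 - z`. -/
def coeffAlg : Subalgebra ℝ (smoothAlg T) := Algebra.adjoin ℝ {rc, 1 - zc}

lemma rc_mem : (rc : smoothAlg T) ∈ coeffAlg := Algebra.subset_adjoin (by simp)

lemma one_sub_zc_mem : (1 - zc : smoothAlg T) ∈ coeffAlg := Algebra.subset_adjoin (by simp)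

lemma zc_mem : (zc : smoothAlg T) ∈ coeffAlg := by
  have := sub_mem (one_mem (coeffAlg (T := T))) one_sub_zc_mem
  rwa [sub_sub_cancel] at this

lemma phiZ_mem : (phiZ : smoothAlg T) ∈ coeffAlg := mul_mem rc_mem zc_mem

lemma pd_mem_coeffAlg (e : SpaceTime) {b : smoothAlg T} (hb : b ∈ coeffAlg) :
    pd e b ∈ coeffAlg := by
  induction hb using Algebra.adjoin_induction with
  | mem x hx =>
    rcases hx with rfl | rfl
    · rw [pd_rc]; exact Subalgebra.smul_mem _ (pow_mem rc_mem 2) _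
    · rw [map_sub, pd_one, pd_zc]
      exact sub_mem (zero_mem _) (Subalgebra.smul_mem _ (one_mem _) _)
  | algebraMap r =>
    rw [Algebra.algebraMap_eq_smul_one, pd_smul, pd_one, smul_zero]
    exact zero_mem _
  | add x y _ _ hx hy => rw [map_add]; exact add_mem hx hy
  | mul x y hx' hy' hx hy =>
    rw [pd_mul]
    exact add_mem (mul_mem hx hy') (mul_mem hx' hy)

lemma vectorFields_mem_coeffAlg {φ b : smoothAlg T} (hφ : φ ∈ coeffAlg) (hb : b ∈ coeffAlg)
    (i : Fin 4) : vectorFields φ i b ∈ coeffAlg := by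
  fin_cases i
  · exact pd_mem_coeffAlg _ hb
  · exact pd_mem_coeffAlg _ hb
  · exact pd_mem_coeffAlg _ hb
  · exact mul_mem hφ (pd_mem_coeffAlg _ hb)

/-- The part `-R ≤ z ≤ 0` of the domain. -/
def strip (T R : ℝ) : Set SpaceTime := {p | p ∈ spaceTimeDomain T ∧ -R ≤ p.2.2.2}

lemma exists_bound_of_mem_coeffAlg (R : ℝ) {b : smoothAlg T} (hb : b ∈ coeffAlg) :
    ∃ C : ℝ, 0 ≤ C ∧ ∀ p ∈ strip T R, |b p| ≤ C := by
  induction hb using Algebra.adjoin_induction with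
  | mem x hx =>
    rcases hx with rfl | rfl
    · refine ⟨1, zero_le_one, fun p hp => ?_⟩
      have hz : p.2.2.2 ≤ 0 := hp.1.2
      rw [rc_apply hp.1, abs_inv, abs_of_nonneg (by linarith)]
      exact inv_le_one_of_one_le₀ (by linarith)
    · refine ⟨1 + |R|, by positivity, fun p hp => ?_⟩
      have hz : p.2.2.2 ≤ 0 := hp.1.2
      have hR := hp.2
      rw [sub_apply, one_apply, zc_apply hp.1, abs_of_nonneg (by linarith)]
      linarith [le_abs_self R]
  | algebraMap r => exact ⟨|r|, abs_nonneg r, fun p _ => le_of_eq rfl⟩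
  | add x y _ _ hx hy =>
    obtain ⟨C, hC, h⟩ := hx
    obtain ⟨C', hC', h'⟩ := hy
    exact ⟨C + C', by positivity, fun p hp =>
      (abs_add_le _ _).trans (add_le_add (h p hp) (h' p hp))⟩
  | mul x y _ _ hx hy =>
    obtain ⟨C, hC, h⟩ := hx
    obtain ⟨C', hC', h'⟩ := hy
    refine ⟨C * C', by positivity, fun p hp => ?_⟩
    rw [mul_apply, abs_mul]
    exact mul_le_mul (h p hp) (h' p hp) (abs_nonneg _) hC

lemma exists_derivSize_le_of_mem_coeffAlg (R : ℝ) {φ : smoothAlg T} (hφ : φ ∈ coeffAlg) (n : ℕ)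
    {b : smoothAlg T} (hb : b ∈ coeffAlg) :
    ∃ C : ℝ, 0 ≤ C ∧ ∀ p ∈ strip T R, derivSize (vectorFields φ) n b p ≤ C := by
  induction n generalizing b with
  | zero => exact ⟨0, le_rfl, fun p _ => le_rfl⟩
  | succ n ih =>
    obtain ⟨C, hC, h⟩ := exists_bound_of_mem_coeffAlg R hb
    choose C' hC' h' using fun i => ih (vectorFields_mem_coeffAlg hφ hb i)
    exact ⟨C + ∑ i, C' i, add_nonneg hC (Finset.sum_nonneg fun i _ => hC' i), fun p hp =>
      add_le_add (h p hp) (Finset.sum_le_sum fun i _ => h' i p hp)⟩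

/-- Changing the weight of the normal derivative by a coefficient. -/
lemma exists_derivSize_mul_le (R : ℝ) {φ g : smoothAlg T} (hφ : φ ∈ coeffAlg)
    (hg : g ∈ coeffAlg) (n : ℕ) :
    ∃ C : ℝ, 0 ≤ C ∧ ∀ p ∈ strip T R, ∀ f : smoothAlg T,
      derivSize (vectorFields (g * φ)) n f p ≤ C * derivSize (vectorFields φ) n f p := by
  induction n with
  | zero => exact ⟨0, le_rfl, fun p _ f => by simp [derivSize]⟩
  | succ n ih =>
    obtain ⟨C, hC, h⟩ := ih
    obtain ⟨C₁, hC₁, h₁⟩ := (isDerivFamily_vectorFields φ).derivSize_mul n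
    obtain ⟨C₂, hC₂, h₂⟩ := exists_derivSize_le_of_mem_coeffAlg R hφ n hg
    have hCC : 0 ≤ C * (C₁ * C₂) := by positivity
    refine ⟨1 + C + C * (C₁ * C₂), by positivity, fun p hp f => ?_⟩
    set D := fun i => derivSize (vectorFields φ) n (vectorFields φ i f) p
    have hD : ∀ i, 0 ≤ D i := fun i => derivSize_nonneg _ _ _ _
    have key : ∀ i, derivSize (vectorFields (g * φ)) n (vectorFields (g * φ) i f) p
        ≤ (C + C * (C₁ * C₂)) * D i := by
      intro i
      have hlt : derivSize (vectorFields (g * φ)) n (vectorFields φ i f) p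
          ≤ (C + C * (C₁ * C₂)) * D i :=
        (h p hp _).trans (mul_le_mul_of_nonneg_right (by linarith) (hD i))
      by_cases hi : i = 3
      · subst hi
        -- The new normal field applied to `f` is the product of `g` with the old one, so the
        -- product estimate and the bound on `g` in the strip apply.
        rw [vectorFields_three, mul_assoc, ← vectorFields_three]
        refine (h p hp _).trans ?_
        have := (h₁ g (vectorFields φ 3 f) p).trans
          (mul_le_mul_of_nonneg_right (mul_le_mul_of_nonneg_left (h₂ p hp) hC₁) (hD 3))
        calc _ ≤ C * (C₁ * C₂ * D 3) := mul_le_mul_of_nonneg_left this hC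
          _ ≤ _ := by nlinarith [mul_nonneg hC (hD 3)]
      · have e : vectorFields (g * φ) i f = vectorFields φ i f := by
          fin_cases i <;> first | rfl | exact absurd rfl hi
        rw [e]
        exact hlt
    have h0 := abs_nonneg (f p)
    have hsum : 0 ≤ ∑ i, D i := Finset.sum_nonneg fun i _ => hD i
    calc _ ≤ |f p| + ∑ i, (C + C * (C₁ * C₂)) * D i := by
          rw [derivSize]; gcongr with i _; exact key i
      _ ≤ (1 + C + C * (C₁ * C₂)) * (|f p| + ∑ i, D i) := by
          rw [← Finset.mul_sum]
          nlinarith [mul_nonneg hC h0, mul_nonneg hCC h0]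
      _ = _ := rfl

/-- The change of weight uses `g = 1 - z` here and `g = 1 / (1 - z)` in the converse; both are
bounded on the strip together with their derivatives. -/
lemma exists_euler_le_conormal (R : ℝ) (n : ℕ) :
    ∃ C : ℝ, 0 ≤ C ∧ ∀ p ∈ strip T R, ∀ f : smoothAlg T,
      derivSize (vectorFields zc) n f p ≤ C * derivSize (vectorFields phiZ) n f p := by
  have h := exists_derivSize_mul_le R (T := T) phiZ_mem one_sub_zc_mem n
  rwa [← zc_eq] at h

lemma exists_conormal_le_euler (R : ℝ) (n : ℕ) :
    ∃ C : ℝ, 0 ≤ C ∧ ∀ p ∈ strip T R, ∀ f : smoothAlg T,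
      derivSize (vectorFields phiZ) n f p ≤ C * derivSize (vectorFields zc) n f p :=
  exists_derivSize_mul_le R (T := T) zc_mem rc_mem n

/-! ### Commutator of the transport-diffusion operator with words -/

/-- The operator `∂_t + w·∇ - ε ∂_{zz}`. -/
def transport (ε : ℝ) (w₁ w₂ w₃ f : smoothAlg T) : smoothAlg T :=
  pd (1, 0, 0, 0) f + w₁ * pd (0, 1, 0, 0) f + w₂ * pd (0, 0, 1, 0) f + w₃ * pd (0, 0, 0, 1) f
    - ε • pd (0, 0, 0, 1) (pd (0, 0, 0, 1) f)

lemma commute_word {X : Fin 4 → Module.End ℝ (smoothAlg T)} (hX : ∀ i j, Commute (X i) (X j))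
    (i : Fin 4) (u : List (Fin 4)) (f : smoothAlg T) : X i (word X u f) = word X u (X i f) := by
  have h : Commute (X i) (word X u) := by
    refine Commute.list_prod_right _ _ fun x hx => ?_
    obtain ⟨j, _, rfl⟩ := List.mem_map.1 hx
    exact hX i j
  exact LinearMap.congr_fun h.eq f

/-- There are only finitely many words of bounded length. -/
lemma exists_uniform_of_forall_word (n : ℕ) {P : List (Fin 4) → ℝ → Prop}
    (hmono : ∀ u C C', C ≤ C' → P u C → P u C')
    (h : ∀ u : List (Fin 4), u.length ≤ n → ∃ C : ℝ, P u C) :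
    ∃ C : ℝ, 0 ≤ C ∧ ∀ u : List (Fin 4), u.length ≤ n → P u C := by
  choose! c hc using h
  obtain ⟨C, hC⟩ := ((List.finite_length_le (Fin 4) n).image c).bddAbove
  exact ⟨max C 0, le_max_right _ _, fun u hu =>
    hmono u _ _ ((hC ⟨u, hu, rfl⟩).trans (le_max_left _ _)) (hc u hu)⟩

/-- Three kinds of terms arise: commutators of the word with the coefficients, the diffusion
commutator `ε Q ∂_{zz} ρ` rewritten through the equation, and the normal transport, which becomes
conormal after multiplication by `z`. In each of them at most `n` derivatives fall on any factor,
and the constant does not see `ε`. -/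
lemma abs_transport_word_le_of_word (n : ℕ) (u : List (Fin 4)) (hu : u.length ≤ n) :
    ∃ C : ℝ, ∀ (ε : ℝ) (w₁ w₂ w₃ ρ H : smoothAlg T), transport ε w₁ w₂ w₃ ρ = H →
      ∀ p ∈ spaceTimeDomain T, p.2.2.2 < 0 →
        |transport ε w₁ w₂ w₃ (word (vectorFields zc) u ρ) p|
          ≤ C * ((1 + derivSize (vectorFields zc) (n + 1) w₁ p
              + derivSize (vectorFields zc) (n + 1) w₂ p
              + derivSize (vectorFields zc) (n + 1) w₃ p / |p.2.2.2|)
                * derivSize (vectorFields zc) (n + 1) ρ p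
              + derivSize (vectorFields zc) (n + 1) H p) := by
  set X := vectorFields (zc : smoothAlg T) with hXdef
  have hX : IsDerivFamily X := isDerivFamily_vectorFields _
  have hc : ∀ i j, Commute (X i) (X j) := commute_vectorFields isNormal_zc
  obtain ⟨C₁, hC₁, h₁⟩ := hX.abs_word_mul_sub_le n
  obtain ⟨C₂, hC₂, h₂⟩ := hX.derivSize_mul n
  obtain ⟨Q, hQ, eQ⟩ := exists_word_twist_eq X 2 u
  obtain ⟨Q', hQ', eQ'⟩ := exists_word_twist_eq X (-1) u
  replace hQ := wordSpan_mono X hu hQ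
  replace hQ' := wordSpan_mono X hu hQ'
  obtain ⟨Q'', hQ'', eQ''⟩ := exists_mul_eq_of_twist (X := X) mulLeft_zc_mul hQ
  obtain ⟨A, hA, bA⟩ := exists_abs_apply_le X hQ
  obtain ⟨A', hA', bA'⟩ := exists_abs_apply_le X hQ'
  obtain ⟨A'', hA'', bA''⟩ := exists_abs_apply_le X hQ''
  refine ⟨1 + A + C₁ + A * C₂ + C₁ + A' * C₂ + A'' * C₂, fun ε w₁ w₂ w₃ ρ H hρ p hp hz => ?_⟩
  have hz' : 0 < |p.2.2.2| := abs_pos.2 hz.ne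
  have Jn := fun f : smoothAlg T => derivSize_nonneg X (n + 1) f p
  set J := fun f : smoothAlg T => derivSize X (n + 1) f p with hJ
  have Jle : ∀ i (f : smoothAlg T), derivSize X n (X i f) p ≤ J f := fun i f =>
    derivSize_apply_le X n i f p
  have Jsucc : ∀ f : smoothAlg T, derivSize X n f p ≤ J f := fun f => derivSize_le_succ X n f p
  have prod_le : ∀ (w : smoothAlg T) (i : Fin 4), derivSize X n (w * X i ρ) p ≤ C₂ * (J w * J ρ) :=
    fun w i => (h₂ _ _ p).trans <| by
      rw [mul_assoc]
      exact mul_le_mul_of_nonneg_left (mul_le_mul (Jsucc w) (Jle i ρ) (derivSize_nonneg _ _ _ _)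
        (Jn w)) hC₂
  have comm_le : ∀ (w : smoothAlg T) (i : Fin 4),
      |word X u (w * X i ρ) p - w p * word X u (X i ρ) p| ≤ C₁ * (J w * J ρ) :=
    fun w i => (h₁ u hu w (X i ρ) p).trans <| by
      rw [mul_assoc]
      exact mul_le_mul_of_nonneg_left (mul_le_mul_of_nonneg_left (Jle i ρ) (Jn w)) hC₁
  have e1 : pd (0, 1, 0, 0) (word X u ρ) = word X u (X 1 ρ) := commute_word hc 1 u ρ
  have e2 : pd (0, 0, 1, 0) (word X u ρ) = word X u (X 2 ρ) := commute_word hc 2 u ρ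
  have e0 : pd (1, 0, 0, 0) (word X u ρ) = word X u (X 0 ρ) := commute_word hc 0 u ρ
  have ezz : pd (0, 0, 0, 1) (pd (0, 0, 0, 1) (word X u ρ))
      = word X u (pd (0, 0, 0, 1) (pd (0, 0, 0, 1) ρ))
        + Q (pd (0, 0, 0, 1) (pd (0, 0, 0, 1) ρ)) := by
    have := LinearMap.congr_fun (mul_word_of_twist (X := X) pd_zz_mul u) ρ
    rw [eQ] at this
    exact this
  -- the equation, differentiated
  have H1 : word X u H p = word X u (X 0 ρ) p + word X u (w₁ * X 1 ρ) p + word X u (w₂ * X 2 ρ) p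
      + word X u (w₃ * pd (0, 0, 0, 1) ρ) p
      - ε * word X u (pd (0, 0, 0, 1) (pd (0, 0, 0, 1) ρ)) p := by
    rw [← hρ, transport, map_sub, map_add, map_add, map_add, map_smul]; rfl
  -- Applying the lower-order operator `Q` to the equation expresses `ε Q ∂_{zz} ρ` by terms without
  -- `ε`. Eliminating it between `H1`, `H2` and `H3` is what makes the estimate uniform in `ε`.
  have H2 : Q H p = Q (X 0 ρ) p + Q (w₁ * X 1 ρ) p + Q (w₂ * X 2 ρ) p
      + Q (w₃ * pd (0, 0, 0, 1) ρ) p - ε * Q (pd (0, 0, 0, 1) (pd (0, 0, 0, 1) ρ)) p := by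
    rw [← hρ, transport, map_sub, map_add, map_add, map_add, map_smul]; rfl
  have H3 : transport ε w₁ w₂ w₃ (word X u ρ) p = word X u (X 0 ρ) p + w₁ p * word X u (X 1 ρ) p
      + w₂ p * word X u (X 2 ρ) p + w₃ p * pd (0, 0, 0, 1) (word X u ρ) p
      - ε * (word X u (pd (0, 0, 0, 1) (pd (0, 0, 0, 1) ρ)) p
        + Q (pd (0, 0, 0, 1) (pd (0, 0, 0, 1) ρ)) p) := by
    rw [transport, e0, e1, e2, ezz]; rfl
  set a₁ := word X u (w₁ * X 1 ρ) p - w₁ p * word X u (X 1 ρ) p with ha₁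
  set a₂ := word X u (w₂ * X 2 ρ) p - w₂ p * word X u (X 2 ρ) p with ha₂
  set a₃ := word X u (w₃ * pd (0, 0, 0, 1) ρ) p - w₃ p * pd (0, 0, 0, 1) (word X u ρ) p with ha₃
  have H4 : transport ε w₁ w₂ w₃ (word X u ρ) p = word X u H p - a₁ - a₂ - a₃
      + (Q H p - Q (X 0 ρ) p - Q (w₁ * X 1 ρ) p - Q (w₂ * X 2 ρ) p
        - Q (w₃ * pd (0, 0, 0, 1) ρ) p) := by
    linarith
  -- the normal transport term
  have hzw : zc * (w₃ * pd (0, 0, 0, 1) ρ) = w₃ * X 3 ρ := by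
    rw [hXdef, vectorFields_three]; ring
  have b₃ : |a₃| ≤ (C₁ + A' * C₂) * (J w₃ * J ρ / |p.2.2.2|) := by
    -- Multiplied by `z`, the term `w₃ ∂_z ρ` becomes `w₃ * X 3 ρ`. Passing `z` through the word
    -- shifts `X 3` by `-1`, and the lower-order discrepancy is `Q'`.
    rw [← mul_div_assoc, le_div_iff₀ hz', mul_comm, ← abs_mul]
    have q1 : p.2.2.2 * word X u (w₃ * pd (0, 0, 0, 1) ρ) p
        = word X u (w₃ * X 3 ρ) p + Q' (w₃ * X 3 ρ) p := by
      have := LinearMap.congr_fun (mul_word_of_twist (X := X) mulLeft_zc_mul u)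
        (w₃ * pd (0, 0, 0, 1) ρ)
      rw [eQ'] at this
      have h := congrArg (fun f : smoothAlg T => f p) this
      simp only [Module.End.mul_apply, LinearMap.mulLeft_apply, hzw] at h
      rw [← zc_apply hp]
      exact h
    have q2 : p.2.2.2 * pd (0, 0, 0, 1) (word X u ρ) p = word X u (X 3 ρ) p := by
      rw [← commute_word hc 3 u ρ, ← zc_apply hp]; rfl
    have q3 : p.2.2.2 * a₃ = (word X u (w₃ * X 3 ρ) p - w₃ p * word X u (X 3 ρ) p)
        + Q' (w₃ * X 3 ρ) p := by
      rw [← q2, ha₃, mul_sub, q1]; ring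
    rw [q3, add_mul]
    refine (abs_add_le _ _).trans (add_le_add (comm_le w₃ 3) ?_)
    rw [mul_assoc]
    exact (bA' _ p).trans (mul_le_mul_of_nonneg_left (prod_le w₃ 3) hA')
  have c₃ : |Q (w₃ * pd (0, 0, 0, 1) ρ) p| ≤ (A'' * C₂) * (J w₃ * J ρ / |p.2.2.2|) := by
    rw [← mul_div_assoc, le_div_iff₀ hz', mul_comm, ← abs_mul]
    have q1 : p.2.2.2 * Q (w₃ * pd (0, 0, 0, 1) ρ) p = Q'' (w₃ * X 3 ρ) p := by
      have h := congrArg (fun f : smoothAlg T => f p)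
        (LinearMap.congr_fun eQ'' (w₃ * pd (0, 0, 0, 1) ρ))
      simp only [Module.End.mul_apply, LinearMap.mulLeft_apply, hzw] at h
      rw [← zc_apply hp]
      exact h
    rw [q1, mul_assoc]
    exact (bA'' _ p).trans (mul_le_mul_of_nonneg_left (prod_le w₃ 3) hA'')
  have bH : |word X u H p| ≤ J H := abs_word_le X (Nat.lt_succ_of_le hu) H p
  have cH : |Q H p| ≤ A * J H := (bA _ p).trans (mul_le_mul_of_nonneg_left (Jsucc H) hA)
  have c₀ : |Q (X 0 ρ) p| ≤ A * J ρ := (bA _ p).trans (mul_le_mul_of_nonneg_left (Jle 0 ρ) hA)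
  have b₁ : |a₁| ≤ C₁ * (J w₁ * J ρ) := comm_le w₁ 1
  have b₂ : |a₂| ≤ C₁ * (J w₂ * J ρ) := comm_le w₂ 2
  have c₁ : |Q (w₁ * X 1 ρ) p| ≤ A * C₂ * (J w₁ * J ρ) := by
    rw [mul_assoc]; exact (bA _ p).trans (mul_le_mul_of_nonneg_left (prod_le w₁ 1) hA)
  have c₂ : |Q (w₂ * X 2 ρ) p| ≤ A * C₂ * (J w₂ * J ρ) := by
    rw [mul_assoc]; exact (bA _ p).trans (mul_le_mul_of_nonneg_left (prod_le w₂ 2) hA)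
  have tri : |transport ε w₁ w₂ w₃ (word X u ρ) p| ≤ |word X u H p| + |a₁| + |a₂| + |a₃|
      + (|Q H p| + |Q (X 0 ρ) p| + |Q (w₁ * X 1 ρ) p| + |Q (w₂ * X 2 ρ) p|
        + |Q (w₃ * pd (0, 0, 0, 1) ρ) p|) := by
    rw [H4]
    refine (abs_add_le _ _).trans (add_le_add ?_ ?_)
    · exact (abs_sub _ _).trans (add_le_add_left ((abs_sub _ _).trans (add_le_add_left
        (abs_sub _ _) _)) _)
    · exact (abs_sub _ _).trans (add_le_add_left ((abs_sub _ _).trans (add_le_add_left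
        ((abs_sub _ _).trans (add_le_add_left (abs_sub _ _) _)) _)) _)
  have P₀ := Jn ρ
  have P₁ : 0 ≤ J w₁ * J ρ := mul_nonneg (Jn _) (Jn _)
  have P₂ : 0 ≤ J w₂ * J ρ := mul_nonneg (Jn _) (Jn _)
  have P₃ : 0 ≤ J w₃ * J ρ / |p.2.2.2| := div_nonneg (mul_nonneg (Jn _) (Jn _)) hz'.le
  have P₄ := Jn H
  have hAC : 0 ≤ A * C₂ := mul_nonneg hA hC₂
  have hAC' : 0 ≤ A' * C₂ := mul_nonneg hA' hC₂
  have hAC'' : 0 ≤ A'' * C₂ := mul_nonneg hA'' hC₂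
  change _ ≤ _ * ((1 + J w₁ + J w₂ + J w₃ / |p.2.2.2|) * J ρ + J H)
  have eS : (1 + J w₁ + J w₂ + J w₃ / |p.2.2.2|) * J ρ + J H
      = J ρ + J w₁ * J ρ + J w₂ * J ρ + J w₃ * J ρ / |p.2.2.2| + J H := by ring
  rw [eS]
  change 0 ≤ J ρ at P₀
  change 0 ≤ J H at P₄
  clear_value a₁ a₂ a₃ J
  generalize J w₁ * J ρ = s₁ at *
  generalize J w₂ * J ρ = s₂ at *
  generalize J w₃ * J ρ / |p.2.2.2| = s₃ at *
  generalize A * C₂ = k₁ at *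
  generalize A' * C₂ = k₂ at *
  generalize A'' * C₂ = k₃ at *
  generalize J ρ = s₀ at *
  generalize J H = s₄ at *
  have t0 := mul_nonneg hA P₀
  have t1 := mul_nonneg hA P₁
  have t2 := mul_nonneg hA P₂
  have t3 := mul_nonneg hA P₃
  have u0 := mul_nonneg hC₁ P₀
  have u3 := mul_nonneg hC₁ P₃
  have u4 := mul_nonneg hC₁ P₄
  have u1 := mul_nonneg hC₁ P₁
  have u2 := mul_nonneg hC₁ P₂
  have v0 := mul_nonneg hAC P₀
  have v3 := mul_nonneg hAC P₃
  have v4 := mul_nonneg hAC P₄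
  have x0 := mul_nonneg hAC' P₀
  have x1 := mul_nonneg hAC' P₁
  have x2 := mul_nonneg hAC' P₂
  have x4 := mul_nonneg hAC' P₄
  have y0 := mul_nonneg hAC'' P₀
  have y1 := mul_nonneg hAC'' P₁
  have y2 := mul_nonneg hAC'' P₂
  have y4 := mul_nonneg hAC'' P₄
  nlinarith only [tri, b₁, b₂, b₃, c₀, c₁, c₂, c₃, bH, cH, t0, t1, t2, t3, u0, u1, u2, u3, u4, v0,
    v3, v4, x0, x1, x2, x4, y0, y1, y2, y4, P₀, P₁, P₂, P₃, P₄]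

lemma exists_abs_transport_word_le (n : ℕ) :
    ∃ C : ℝ, 0 ≤ C ∧ ∀ u : List (Fin 4), u.length ≤ n →
      ∀ (ε : ℝ) (w₁ w₂ w₃ ρ H : smoothAlg T), transport ε w₁ w₂ w₃ ρ = H →
      ∀ p ∈ spaceTimeDomain T, p.2.2.2 < 0 →
        |transport ε w₁ w₂ w₃ (word (vectorFields zc) u ρ) p|
          ≤ C * ((1 + derivSize (vectorFields zc) (n + 1) w₁ p
              + derivSize (vectorFields zc) (n + 1) w₂ p
              + derivSize (vectorFields zc) (n + 1) w₃ p / |p.2.2.2|)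
                * derivSize (vectorFields zc) (n + 1) ρ p
              + derivSize (vectorFields zc) (n + 1) H p) := by
  refine exists_uniform_of_forall_word n (fun u C C' hC h => ?_) (abs_transport_word_le_of_word n)
  intro ε w₁ w₂ w₃ ρ H hρ p hp hz
  refine (h ε w₁ w₂ w₃ ρ H hρ p hp hz).trans (mul_le_mul_of_nonneg_right hC ?_)
  have J := fun f => derivSize_nonneg (vectorFields (zc : smoothAlg T)) (n + 1) f p
  have := J w₁
  have := J w₂
  have := J ρ
  have := J H
  have := div_nonneg (J w₃) (abs_nonneg p.2.2.2)
  positivity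

/-! ### Growth away from the boundary -/

lemma abs_sub_trace_le (f : smoothAlg T) {t y₁ y₂ z B : ℝ} (ht : t ∈ Icc 0 T) (hz : z ≤ 0)
    (hf : ∀ ζ ∈ Icc z 0, |pd (0, 0, 0, 1) f (t, y₁, y₂, ζ)| ≤ B) :
    |f (t, y₁, y₂, z) - f (t, y₁, y₂, 0)| ≤ B * |z| := by
  have hline : ∀ r : ℝ, ((t, y₁, y₂, 0) : SpaceTime) + r • ((0, 0, 0, 1) : SpaceTime)
      = (t, y₁, y₂, r) := fun r => by simp
  have hmem : ∀ r ∈ Icc z 0, ((t, y₁, y₂, 0) : SpaceTime) + r • ((0, 0, 0, 1) : SpaceTime)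
      ∈ spaceTimeDomain T := fun r hr => by rw [hline]; exact ⟨ht, hr.2⟩
  have key := Convex.norm_image_sub_le_of_norm_hasDerivWithin_le (C := B)
    (f := fun r : ℝ => f ((t, y₁, y₂, 0) + r • ((0, 0, 0, 1) : SpaceTime)))
    (s := Icc z 0) (x := 0) (y := z)
    (fun r hr => hasDerivWithinAt_line (0, 0, 0, 1) f hmem hr)
    (fun r hr => by rw [hline]; exact hf r hr)
    (convex_Icc z 0) (right_mem_Icc.2 hz) (left_mem_Icc.2 hz)
  rwa [hline, hline, Real.norm_eq_abs, Real.norm_eq_abs, sub_zero] at key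

/-- `∂_z` of a word applied to `f` is a shifted word applied to `∂_z f`, so the mean value
inequality on `[z, 0]` loses no conormal derivative. -/
lemma abs_word_le_trace_add (n : ℕ) (u : List (Fin 4)) (hu : u.length ≤ n) :
    ∃ C : ℝ, ∀ (f : smoothAlg T) (t y₁ y₂ z B : ℝ), t ∈ Icc 0 T → z ≤ 0 → 0 ≤ B →
      (∀ ζ ∈ Icc z 0,
        derivSize (vectorFields zc) (n + 1) (pd (0, 0, 0, 1) f) (t, y₁, y₂, ζ) ≤ B) →
      |word (vectorFields zc) u f (t, y₁, y₂, z)|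
        ≤ |word (vectorFields zc) u f (t, y₁, y₂, 0)| + C * (|z| * B) := by
  set X := vectorFields (zc : smoothAlg T)
  obtain ⟨C, hC, h⟩ := exists_abs_apply_le X (word_twist_mem X 1 (Nat.lt_succ_of_le hu))
  refine ⟨C, fun f t y₁ y₂ z B ht hz hB hf => ?_⟩
  have ez : pd (0, 0, 0, 1) (word X u f) = word (twist X 1) u (pd (0, 0, 0, 1) f) :=
    LinearMap.congr_fun (mul_word_of_twist (X := X) pd_z_mul u) f
  have key := abs_sub_trace_le (word X u f) (y₁ := y₁) (y₂ := y₂) (B := C * B) ht hz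
    fun r hr => by
      rw [ez]
      exact (h _ _).trans (mul_le_mul_of_nonneg_left (hf r hr) hC)
  have := abs_sub_abs_le_abs_sub (word X u f (t, y₁, y₂, z)) (word X u f (t, y₁, y₂, 0))
  linarith [mul_right_comm C B |z|, mul_assoc C |z| B]

/-- By commutativity the letter `z ∂_z` can be brought to the front, where its weight vanishes.
Hence tangential derivatives of the trace are enough on the boundary. -/
lemma word_apply_eq_zero_of_mem {u : List (Fin 4)} (hu : 3 ∈ u) (f : smoothAlg T) {t y₁ y₂ : ℝ}
    (ht : t ∈ Icc 0 T) : word (vectorFields zc) u f (t, y₁, y₂, 0) = 0 := by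
  obtain ⟨v, v', rfl⟩ := List.append_of_mem hu
  rw [word_append, word_cons, Module.End.mul_apply, Module.End.mul_apply,
    ← commute_word (commute_vectorFields isNormal_zc), vectorFields_three, mul_apply,
    zc_apply ⟨ht, le_rfl⟩, zero_mul]

lemma exists_derivSize_le_trace_add (n : ℕ) :
    ∃ C : ℝ, 0 ≤ C ∧ ∀ (f : smoothAlg T) (t y₁ y₂ z B₀ B : ℝ), t ∈ Icc 0 T → z ≤ 0 →
      0 ≤ B₀ → 0 ≤ B →
      (∀ u : List (Fin 4), u.length ≤ n → 3 ∉ u →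
        |word (vectorFields zc) u f (t, y₁, y₂, 0)| ≤ B₀) →
      (∀ ζ ∈ Icc z 0,
        derivSize (vectorFields zc) (n + 1) (pd (0, 0, 0, 1) f) (t, y₁, y₂, ζ) ≤ B) →
      derivSize (vectorFields zc) (n + 1) f (t, y₁, y₂, z) ≤ C * (B₀ + |z| * B) := by
  obtain ⟨C, hC, h⟩ := exists_uniform_of_forall_word n (fun u C C' hC h => by
    intro f t y₁ y₂ z B ht hz hB hf
    refine (h f t y₁ y₂ z B ht hz hB hf).trans ?_
    gcongr) (abs_word_le_trace_add (T := T) n)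
  obtain ⟨C', hC', h'⟩ := derivSize_le_of_words (vectorFields (zc : smoothAlg T)) (n + 1)
  refine ⟨C' * (1 + C), by positivity, fun f t y₁ y₂ z B₀ B ht hz hB₀ hB htr hf => ?_⟩
  rw [mul_assoc]
  refine h' _ _ _ fun u hu => ?_
  have hu' := Nat.le_of_lt_succ hu
  have htr' : |word (vectorFields zc) u f (t, y₁, y₂, 0)| ≤ B₀ := by
    by_cases h3 : 3 ∈ u
    · rw [word_apply_eq_zero_of_mem h3 f ht, abs_zero]; exact hB₀
    · exact htr u hu' h3
  have hzB : 0 ≤ |z| * B := by positivity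
  nlinarith [h u hu' f t y₁ y₂ z B ht hz hB hf, mul_nonneg hC hB₀]

/-! ### Comparison with the norms of the statement -/

lemma eqOn_pow {A : Module.End ℝ (smoothAlg T)} {a : (SpaceTime → ℝ) → SpaceTime → ℝ}
    (h : ∀ (F : smoothAlg T) f, EqOn F f (spaceTimeDomain T) →
      EqOn (A F) (a f) (spaceTimeDomain T)) (n : ℕ) :
    ∀ (F : smoothAlg T) f, EqOn F f (spaceTimeDomain T) →
      EqOn ((A ^ n) F) (a^[n] f) (spaceTimeDomain T) := by
  induction n with
  | zero => exact fun F f hF => hF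
  | succ n ih =>
    intro F f hF
    rw [pow_succ, Module.End.mul_apply, Function.iterate_succ_apply]
    exact ih _ _ (h _ _ hF)

lemma eqOn_vectorFields_phiZ_three (F : smoothAlg T) (f : SpaceTime → ℝ)
    (h : EqOn F f (spaceTimeDomain T)) :
    EqOn (vectorFields phiZ 3 F) (Z3 T f) (spaceTimeDomain T) := by
  intro p hp
  rw [vectorFields_three, mul_apply, phiZ, mul_apply, rc_apply hp, zc_apply hp,
    pd_apply_of_eqOn _ _ h hp, Z3, dz, div_eq_inv_mul]

lemma eqOn_tangential (φ : smoothAlg T) (a b c : ℕ) (F : smoothAlg T) (f : SpaceTime → ℝ)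
    (h : EqOn F f (spaceTimeDomain T)) :
    EqOn ((vectorFields φ 0 ^ a * vectorFields φ 1 ^ b * vectorFields φ 2 ^ c) F)
      ((dt T)^[a] ((dy1 T)^[b] ((dy2 T)^[c] f))) (spaceTimeDomain T) := by
  rw [Module.End.mul_apply, Module.End.mul_apply]
  exact eqOn_pow (fun F f h => pd_apply_of_eqOn _ F h) a _ _
    (eqOn_pow (fun F f h => pd_apply_of_eqOn _ F h) b _ _
      (eqOn_pow (fun F f h => pd_apply_of_eqOn _ F h) c _ _ h))

lemma eqOn_conormalDeriv (β : Fin 4 → ℕ) (F : smoothAlg T) (f : SpaceTime → ℝ)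
    (h : EqOn F f (spaceTimeDomain T)) :
    EqOn (word (vectorFields phiZ) (monomialWord β) F) (conormalDeriv T β f)
      (spaceTimeDomain T) := by
  rw [word_monomialWord, Module.End.mul_apply]
  exact eqOn_tangential _ _ _ _ _ _ (eqOn_pow eqOn_vectorFields_phiZ_three _ _ _ h)

lemma mem_multiIndices {n m : ℕ} {β : Fin n → ℕ} : β ∈ multiIndices n m ↔ ∑ i, β i ≤ m := by
  simp only [multiIndices, Finset.mem_filter, Fintype.mem_piFinset, Finset.mem_range,
    and_iff_right_iff_imp]
  intro h i
  exact Nat.lt_succ_of_le ((Finset.single_le_sum (fun _ _ => Nat.zero_le _)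
    (Finset.mem_univ i)).trans h)

/-- A strict excess of `|g|` at `x` would persist on a nonempty open subset of `S`, which has
positive measure. Agreement is needed on `S` only, as the given functions are arbitrary off the
domain. -/
lemma enorm_le_eLpNorm_top {α : Type*} [TopologicalSpace α] [MeasurableSpace α] [BorelSpace α]
    {μ : Measure α} [μ.IsOpenPosMeasure] {S : Set α} (hS : IsOpen S) {f g : α → ℝ}
    (hg : Continuous g) (hfg : EqOn f g S) {x : α} (hx : x ∈ S) :
    ENNReal.ofReal |g x| ≤ eLpNorm f ⊤ (μ.restrict S) := by
  by_contra! hlt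
  set c := eLpNorm f ⊤ (μ.restrict S)
  set V := S ∩ {y | c < ENNReal.ofReal |g y|}
  have hV : IsOpen V := hS.inter (isOpen_lt continuous_const
    (ENNReal.continuous_ofReal.comp hg.abs))
  have hae : ∀ᵐ y ∂μ.restrict S, ‖f y‖ₑ ≤ c := by
    have := ae_le_eLpNormEssSup (f := f) (μ := μ.restrict S)
    simpa only [c, eLpNorm_exponent_top] using this
  rw [ae_restrict_iff' hS.measurableSet] at hae
  have hnull : μ V = 0 := by
    refine measure_mono_null ?_ hae
    intro y hy hy'
    have h1 := hy' hy.1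
    rw [hfg hy.1, Real.enorm_eq_ofReal_abs] at h1
    exact absurd hy.2 (not_lt.2 h1)
  exact (hV.measure_pos μ ⟨x, hx, hlt⟩).ne' hnull

lemma isOpen_lowerHalfSpace : IsOpen lowerHalfSpace :=
  isOpen_lt (by fun_prop) continuous_const

lemma ofReal_abs_le_sliceNorm {F : smoothAlg T} {f : SpaceTime → ℝ}
    (h : EqOn F f (spaceTimeDomain T)) {p : SpaceTime} (hp : p ∈ spaceTimeDomain T)
    (hz : p.2.2.2 < 0) : ENNReal.ofReal |F p| ≤ sliceNorm ⊤ f p.1 := by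
  refine enorm_le_eLpNorm_top isOpen_lowerHalfSpace (g := fun x => F (p.1, x))
    ((continuous_coe F).comp (by fun_prop)) (fun x hx => ?_) (x := p.2) hz
  exact (h (x := ((p.1, x) : SpaceTime)) ⟨hp.1, le_of_lt (show x.2.2 < 0 from hx)⟩).symm

lemma sliceNorm_top_le {f : SpaceTime → ℝ} {t : ℝ} {c : ℝ≥0∞}
    (h : ∀ x ∈ lowerHalfSpace, ENNReal.ofReal |f (t, x)| ≤ c) : sliceNorm ⊤ f t ≤ c := by
  rw [sliceNorm, eLpNorm_exponent_top]
  refine eLpNormEssSup_le_of_ae_enorm_bound ?_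
  rw [ae_restrict_iff' isOpen_lowerHalfSpace.measurableSet]
  exact ae_of_all _ fun x hx => by rw [Real.enorm_eq_ofReal_abs]; exact h x hx

lemma sum_count_mem {u : List (Fin 4)} {k : ℕ} (hu : u.length ≤ k) :
    (fun i => u.count i) ∈ multiIndices 4 k := by
  rw [mem_multiIndices, sum_count]
  exact hu

lemma ofReal_abs_word_le_YNorm {F : smoothAlg T} {f : SpaceTime → ℝ}
    (h : EqOn F f (spaceTimeDomain T)) {p : SpaceTime} (hp : p ∈ spaceTimeDomain T)
    (hz : p.2.2.2 < 0) {k : ℕ} {u : List (Fin 4)} (hu : u.length ≤ k) :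
    ENNReal.ofReal |word (vectorFields phiZ) u F p| ≤ YNorm T k f p.1 := by
  rw [word_eq_monomial (commute_vectorFields isNormal_phiZ)]
  refine (ofReal_abs_le_sliceNorm (eqOn_conormalDeriv _ F f h) hp hz).trans ?_
  exact Finset.single_le_sum (f := fun β => sliceNorm ⊤ (conormalDeriv T β f) p.1)
    (fun _ _ => zero_le) (sum_count_mem hu)

/-- On a strip, `derivSize` for `z ∂_z` is bounded by the `L^∞` conormal norm. -/
lemma exists_derivSize_le_YNorm (R : ℝ) (k : ℕ) :
    ∃ C : ℝ≥0, C ≠ 0 ∧ ∀ (F : smoothAlg T) (f : SpaceTime → ℝ), EqOn F f (spaceTimeDomain T) →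
      ∀ p ∈ strip T R, p.2.2.2 < 0 →
        ENNReal.ofReal (derivSize (vectorFields zc) (k + 1) F p) ≤ C * YNorm T k f p.1 := by
  obtain ⟨C, hC, h⟩ := exists_euler_le_conormal (T := T) R (k + 1)
  obtain ⟨C', hC', h'⟩ := derivSize_le_of_words (vectorFields (phiZ : smoothAlg T)) (k + 1)
  -- The added `1` keeps the constant nonzero, so that the bound is trivial when the norm is
  -- infinite.
  refine ⟨(C * C').toNNReal + 1, by positivity, fun F f hF p hp hz => ?_⟩
  rcases eq_or_ne (YNorm T k f p.1) ⊤ with htop | hfin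
  · rw [htop, ENNReal.mul_top (by simp)]
    exact le_top
  have hw : ∀ u : List (Fin 4), u.length < k + 1 →
      |word (vectorFields phiZ) u F p| ≤ (YNorm T k f p.1).toReal := fun u hu =>
    (ENNReal.ofReal_le_iff_le_toReal hfin).1
      (ofReal_abs_word_le_YNorm hF hp.1 hz (Nat.le_of_lt_succ hu))
  have h1 := (h p hp F).trans (mul_le_mul_of_nonneg_left (h' F p _ hw) hC)
  rw [← mul_assoc] at h1
  calc _ ≤ ENNReal.ofReal (C * C' * (YNorm T k f p.1).toReal) := ENNReal.ofReal_le_ofReal h1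
    _ = (C * C').toNNReal * YNorm T k f p.1 := by
      rw [ENNReal.ofReal_mul (by positivity), ENNReal.ofReal_toReal hfin]; rfl
    _ ≤ _ := by gcongr; simp

/-- The trace norm bounds tangential words on the boundary. -/
lemma ofReal_abs_word_le_traceYNorm {F : smoothAlg T} {f : SpaceTime → ℝ}
    (h : EqOn F f (spaceTimeDomain T)) {k : ℕ} {u : List (Fin 4)} (hu : u.length ≤ k)
    (h3 : 3 ∉ u) {t : ℝ} (ht : t ∈ Icc 0 T) (y₁ y₂ : ℝ) :
    ENNReal.ofReal |word (vectorFields zc) u F (t, y₁, y₂, 0)| ≤ traceYNorm T k f t := by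
  have hsum := sum_count u
  rw [Fin.sum_univ_four, List.count_eq_zero.2 h3, add_zero] at hsum
  set β : Fin 3 → ℕ := ![u.count 0, u.count 1, u.count 2] with hβ
  have hmem : β ∈ multiIndices 3 k := by
    rw [mem_multiIndices, Fin.sum_univ_three]
    exact hsum.le.trans hu
  refine le_trans ?_ (Finset.single_le_sum (f := fun β : Fin 3 → ℕ => eLpNorm (fun y : ℝ × ℝ =>
      ((dt T)^[β 0] ((dy1 T)^[β 1] ((dy2 T)^[β 2] f))) (t, y.1, y.2, 0)) ⊤ volume)
    (fun _ _ => zero_le) hmem)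
  rw [word_eq_sorted (commute_vectorFields isNormal_zc), List.count_eq_zero.2 h3, pow_zero, mul_one]
  rw [← Measure.restrict_univ (μ := (volume : Measure (ℝ × ℝ)))]
  refine enorm_le_eLpNorm_top isOpen_univ (g := fun y : ℝ × ℝ =>
    ((vectorFields zc 0 ^ u.count 0 * vectorFields zc 1 ^ u.count 1
      * vectorFields zc 2 ^ u.count 2 : Module.End ℝ (smoothAlg T)) F) (t, y.1, y.2, 0))
    ((continuous_coe _).comp (by fun_prop)) (fun y _ => ?_) (x := (y₁, y₂)) (mem_univ _)
  exact (eqOn_tangential _ _ _ _ _ _ h ⟨ht, le_rfl⟩).symm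

/-! ### Vanishing below a level -/

/-- The function vanishes for `z < -R`. -/
def VanishesBelow (R : ℝ) (f : smoothAlg T) : Prop :=
  ∀ p ∈ spaceTimeDomain T, p.2.2.2 < -R → f p = 0

lemma VanishesBelow.pd {R : ℝ} {f : smoothAlg T} (h : VanishesBelow R f) (e : SpaceTime) :
    VanishesBelow R (pd e f) := by
  intro p hp hz
  rw [pd_apply e f hp, pderiv]
  have : (f : SpaceTime → ℝ) =ᶠ[𝓝[spaceTimeDomain T] p] fun _ => 0 := by
    have hopen : IsOpen {q : SpaceTime | q.2.2.2 < -R} := isOpen_lt (by fun_prop) continuous_const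
    filter_upwards [self_mem_nhdsWithin, mem_nhdsWithin_of_mem_nhds (hopen.mem_nhds hz)]
      with q hq hq'
    exact h q hq hq'
  rw [this.fderivWithin_eq (h p hp hz)]
  simp

lemma VanishesBelow.mul_left {R : ℝ} {f : smoothAlg T} (h : VanishesBelow R f) (g : smoothAlg T) :
    VanishesBelow R (g * f) := fun p hp hz => by rw [mul_apply, h p hp hz, mul_zero]

lemma VanishesBelow.vectorFields {R : ℝ} {f : smoothAlg T} (h : VanishesBelow R f)
    (φ : smoothAlg T) (i : Fin 4) : VanishesBelow R (vectorFields φ i f) := by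
  fin_cases i
  · exact h.pd _
  · exact h.pd _
  · exact h.pd _
  · exact (h.pd _).mul_left φ

lemma VanishesBelow.word {R : ℝ} {f : smoothAlg T} (h : VanishesBelow R f)
    (φ : smoothAlg T) (u : List (Fin 4)) :
    VanishesBelow R (word (ConormalTransport.vectorFields φ) u f) := by
  induction u with
  | nil => exact h
  | cons i u ih => exact ih.vectorFields φ i

/-! ### The anisotropic Sobolev inequality -/

/-- One-dimensional Sobolev inequality on a unit interval: the minimum of `g²` is at most its mean,
and `g²` varies by at most `∫ |2 g g'| ≤ ∫ (g² + g'²)`. -/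
lemma sq_le_two_mul_integral {g g' : ℝ → ℝ} {a x : ℝ} (hx : x ∈ Icc a (a + 1))
    (hg : ∀ r ∈ Icc a (a + 1), HasDerivAt g (g' r) r) (hgc : Continuous g)
    (hgc' : Continuous g') :
    g x ^ 2 ≤ 2 * ∫ r in Icc a (a + 1), (g r ^ 2 + g' r ^ 2) := by
  obtain ⟨y, hy, hmin⟩ := isCompact_Icc.exists_isMinOn (nonempty_Icc.2 (by linarith : a ≤ a + 1))
    (hgc.pow 2).continuousOn
  have hint : ∀ h : ℝ → ℝ, Continuous h → IntegrableOn h (Icc a (a + 1)) := fun h hh =>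
    hh.continuousOn.integrableOn_Icc
  have hq : Continuous fun r => g r ^ 2 + g' r ^ 2 := (hgc.pow 2).add (hgc'.pow 2)
  have h1 : g y ^ 2 ≤ ∫ r in Icc a (a + 1), (g r ^ 2 + g' r ^ 2) := by
    have h2 : ∫ _r in Icc a (a + 1), g y ^ 2 = g y ^ 2 := by simp
    rw [← h2]
    refine setIntegral_mono_on (hint _ continuous_const) (hint _ hq) measurableSet_Icc
      fun r hr => ?_
    have : g y ^ 2 ≤ g r ^ 2 := hmin hr
    nlinarith [sq_nonneg (g' r)]
  have h3 : |g x ^ 2 - g y ^ 2| ≤ ∫ r in Icc a (a + 1), (g r ^ 2 + g' r ^ 2) := by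
    have hsub : uIcc y x ⊆ Icc a (a + 1) := uIcc_subset_Icc hy hx
    have h4 := intervalIntegral.integral_eq_sub_of_hasDerivAt (a := y) (b := x)
      (f := fun r => g r ^ 2) (f' := fun r => 2 * g r * g' r)
      (fun r hr => by simpa using (hg r (hsub hr)).fun_pow 2)
      (((continuous_const.mul hgc).mul hgc').intervalIntegrable _ _)
    rw [← h4]
    have h5 := intervalIntegral.norm_integral_le_integral_norm_uIoc (μ := volume)
      (f := fun r => 2 * g r * g' r) (a := y) (b := x)
    rw [Real.norm_eq_abs] at h5
    refine h5.trans ?_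
    have hsub' : uIoc y x ⊆ Icc a (a + 1) := uIoc_subset_uIcc.trans hsub
    calc ∫ r in uIoc y x, ‖2 * g r * g' r‖ ≤ ∫ r in uIoc y x, (g r ^ 2 + g' r ^ 2) := by
          refine setIntegral_mono_on ((hint _ (by fun_prop)).mono_set hsub')
            ((hint _ hq).mono_set hsub') measurableSet_uIoc fun r _ => ?_
          rw [Real.norm_eq_abs, abs_le]
          constructor <;> nlinarith [sq_nonneg (g r + g' r), sq_nonneg (g r - g' r)]
      _ ≤ _ := setIntegral_mono_set (hint _ hq) (ae_of_all _ fun r => by positivity)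
          hsub'.eventuallyLE
  have := (abs_le.1 h3).2
  linarith

/-- The square of a function, as an extended nonnegative real. -/
def sqE (f : smoothAlg T) (p : SpaceTime) : ℝ≥0∞ := ENNReal.ofReal (f p ^ 2)

lemma continuous_sqE (f : smoothAlg T) : Continuous (sqE f) :=
  ENNReal.continuous_ofReal.comp ((continuous_coe f).pow 2)

lemma sqE_le_lintegral_line (e : SpaceTime) (F : smoothAlg T) (p : SpaceTime) (a x : ℝ)
    (hx : x ∈ Icc a (a + 1)) {s : Set ℝ} (hs : IsOpen s) (has : Icc a (a + 1) ⊆ s)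
    (hdom : ∀ r ∈ s, p + r • e ∈ spaceTimeDomain T) :
    sqE F (p + x • e)
      ≤ 2 * ∫⁻ r in Icc a (a + 1), (sqE F (p + r • e) + sqE (pd e F) (p + r • e)) := by
  have hline : Continuous fun r : ℝ => p + r • e := by fun_prop
  have hc : ∀ G : smoothAlg T, Continuous fun r : ℝ => G (p + r • e) := fun G =>
    (continuous_coe G).comp hline
  have h := sq_le_two_mul_integral hx (g := fun r => F (p + r • e))
    (g' := fun r => pd e F (p + r • e))
    (fun r hr => (hasDerivWithinAt_line e F hdom (has hr)).hasDerivAt (hs.mem_nhds (has hr)))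
    (hc F) (hc _)
  have hq : Continuous fun r : ℝ => F (p + r • e) ^ 2 + pd e F (p + r • e) ^ 2 :=
    ((hc F).pow 2).add ((hc _).pow 2)
  calc sqE F (p + x • e) ≤ ENNReal.ofReal
        (2 * ∫ r in Icc a (a + 1), (F (p + r • e) ^ 2 + pd e F (p + r • e) ^ 2)) :=
        ENNReal.ofReal_le_ofReal h
    _ = _ := by
      rw [ENNReal.ofReal_mul (by norm_num), ofReal_integral_eq_lintegral_ofReal
        hq.continuousOn.integrableOn_Icc (ae_of_all _ fun r => by positivity)]
      congr 1
      · simp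
      · refine lintegral_congr fun r => ?_
        rw [ENNReal.ofReal_add (by positivity) (by positivity)]
        rfl

lemma sqE_le_lintegral_y1 (F : smoothAlg T) {t : ℝ} (ht : t ∈ Icc 0 T) (y₁ y₂ : ℝ) {z : ℝ}
    (hz : z ≤ 0) :
    sqE F (t, y₁, y₂, z) ≤ 2 * ∫⁻ r in Icc y₁ (y₁ + 1),
      (sqE F (t, r, y₂, z) + sqE (pd (0, 1, 0, 0) F) (t, r, y₂, z)) := by
  have hl : ∀ r : ℝ, ((t, 0, y₂, z) : SpaceTime) + r • ((0, 1, 0, 0) : SpaceTime)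
      = (t, r, y₂, z) := fun r => by simp
  have h := sqE_le_lintegral_line (0, 1, 0, 0) F (t, 0, y₂, z) y₁ y₁
    (left_mem_Icc.2 (by linarith)) isOpen_univ (subset_univ _)
    (fun r _ => by rw [hl]; exact ⟨ht, hz⟩)
  simpa only [hl] using h

lemma sqE_le_lintegral_y2 (F : smoothAlg T) {t : ℝ} (ht : t ∈ Icc 0 T) (y₁ y₂ : ℝ) {z : ℝ}
    (hz : z ≤ 0) :
    sqE F (t, y₁, y₂, z) ≤ 2 * ∫⁻ r in Icc y₂ (y₂ + 1),
      (sqE F (t, y₁, r, z) + sqE (pd (0, 0, 1, 0) F) (t, y₁, r, z)) := by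
  have hl : ∀ r : ℝ, ((t, y₁, 0, z) : SpaceTime) + r • ((0, 0, 1, 0) : SpaceTime)
      = (t, y₁, r, z) := fun r => by simp
  have h := sqE_le_lintegral_line (0, 0, 1, 0) F (t, y₁, 0, z) y₂ y₂
    (left_mem_Icc.2 (by linarith)) isOpen_univ (subset_univ _)
    (fun r _ => by rw [hl]; exact ⟨ht, hz⟩)
  simpa only [hl] using h

/-- The unit interval lies below `z`, so it stays in the open half space however close `z` is to the
boundary. -/
lemma sqE_le_lintegral_z (F : smoothAlg T) {t : ℝ} (ht : t ∈ Icc 0 T) (y₁ y₂ : ℝ) {z : ℝ}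
    (hz : z < 0) :
    sqE F (t, y₁, y₂, z) ≤ 2 * ∫⁻ r in Icc (z - 1) z,
      (sqE F (t, y₁, y₂, r) + sqE (pd (0, 0, 0, 1) F) (t, y₁, y₂, r)) := by
  have hl : ∀ r : ℝ, ((t, y₁, y₂, 0) : SpaceTime) + r • ((0, 0, 0, 1) : SpaceTime)
      = (t, y₁, y₂, r) := fun r => by simp
  have h := sqE_le_lintegral_line (0, 0, 0, 1) F (t, y₁, y₂, 0) (z - 1) z
    ⟨by linarith, by linarith⟩ (isOpen_Iio (a := (0 : ℝ)))
    (fun r hr => by have := hr.2; simp only [mem_Iio]; linarith)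
    (fun r hr => by rw [hl]; exact ⟨ht, le_of_lt hr⟩)
  simpa only [hl, sub_add_cancel] using h

/-- The sum of squares over a function and its derivative in the direction `e`. -/
def withDeriv (e : SpaceTime) (Q : smoothAlg T → SpaceTime → ℝ≥0∞) (F : smoothAlg T)
    (p : SpaceTime) : ℝ≥0∞ := Q F p + Q (pd e F) p

lemma continuous_withDeriv {e : SpaceTime} {Q : smoothAlg T → SpaceTime → ℝ≥0∞}
    (hQ : ∀ F, Continuous (Q F)) (F : smoothAlg T) : Continuous (withDeriv e Q F) :=
  (hQ F).add (hQ _)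

/-- The sum of the squares of the eight derivatives `∂_{y₁}^a ∂_{y₂}^b ∂_z^c F`. -/
def mixedSq : smoothAlg T → SpaceTime → ℝ≥0∞ :=
  withDeriv (0, 1, 0, 0) (withDeriv (0, 0, 1, 0) (withDeriv (0, 0, 0, 1) sqE))

/-- The one-dimensional inequality is used once in each direction, at the price of a factor `2` and
one derivative each time. The resulting unit box has its top at height `z < 0`. -/
lemma sqE_le_lintegral_mixedSq (F : smoothAlg T) {t : ℝ} (ht : t ∈ Icc 0 T) (y₁ y₂ : ℝ) {z : ℝ}
    (hz : z < 0) :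
    sqE F (t, y₁, y₂, z) ≤ 8 * ∫⁻ x in lowerHalfSpace, mixedSq F (t, x) := by
  set Q₃ : smoothAlg T → SpaceTime → ℝ≥0∞ := withDeriv (0, 0, 0, 1) sqE
  set Q₂ : smoothAlg T → SpaceTime → ℝ≥0∞ := withDeriv (0, 0, 1, 0) Q₃
  have c₃ : ∀ G, Continuous (Q₃ G) := continuous_withDeriv continuous_sqE
  have c₂ : ∀ G, Continuous (Q₂ G) := continuous_withDeriv c₃
  have c₁ : Continuous (mixedSq F) := continuous_withDeriv c₂ F
  have s₃ : ∀ G a b, sqE G (t, a, b, z) ≤ 2 * ∫⁻ r in Icc (z - 1) z, Q₃ G (t, a, b, r) :=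
    fun G a b => sqE_le_lintegral_z G ht a b hz
  have m₃ : ∀ G a b, Measurable fun r => Q₃ G (t, a, b, r) := fun G a b =>
    ((c₃ G).comp (by fun_prop : Continuous fun r : ℝ => ((t, a, b, r) : SpaceTime))).measurable
  have s₂ : ∀ G a, sqE G (t, a, y₂, z)
      ≤ 4 * ∫⁻ b in Icc y₂ (y₂ + 1), ∫⁻ r in Icc (z - 1) z, Q₂ G (t, a, b, r) := by
    intro G a
    refine (sqE_le_lintegral_y2 G ht a y₂ hz.le).trans ?_
    calc _ ≤ 2 * ∫⁻ b in Icc y₂ (y₂ + 1), 2 * ∫⁻ r in Icc (z - 1) z, Q₂ G (t, a, b, r) := by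
          gcongr with b
          refine (add_le_add (s₃ G a b) (s₃ _ a b)).trans (le_of_eq ?_)
          rw [← mul_add, ← lintegral_add_left (m₃ G a b)]
          rfl
      _ = _ := by
          rw [lintegral_const_mul' _ _ (by simp), ← mul_assoc]
          norm_num
  have m₂ : ∀ G, Measurable fun a => ∫⁻ b in Icc y₂ (y₂ + 1), ∫⁻ r in Icc (z - 1) z,
      Q₂ G (t, a, b, r) := fun G =>
    Measurable.lintegral_prod_right'
      (f := fun x : ℝ × ℝ => ∫⁻ r in Icc (z - 1) z, Q₂ G (t, x.1, x.2, r))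
      (Measurable.lintegral_prod_right'
        (f := fun x : (ℝ × ℝ) × ℝ => Q₂ G (t, x.1.1, x.1.2, x.2))
        ((c₂ G).comp (by fun_prop : Continuous fun x : (ℝ × ℝ) × ℝ =>
          ((t, x.1.1, x.1.2, x.2) : SpaceTime))).measurable)
  have m₂' : ∀ G a, Measurable fun b => ∫⁻ r in Icc (z - 1) z, Q₂ G (t, a, b, r) := fun G a =>
    Measurable.lintegral_prod_right'
      (f := fun x : ℝ × ℝ => Q₂ G (t, a, x.1, x.2))
      ((c₂ G).comp (by fun_prop : Continuous fun x : ℝ × ℝ =>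
        ((t, a, x.1, x.2) : SpaceTime))).measurable
  have m₂'' : ∀ G a b, Measurable fun r => Q₂ G (t, a, b, r) := fun G a b =>
    ((c₂ G).comp (by fun_prop : Continuous fun r : ℝ => ((t, a, b, r) : SpaceTime))).measurable
  have s₁ : sqE F (t, y₁, y₂, z) ≤ 8 * ∫⁻ a in Icc y₁ (y₁ + 1), ∫⁻ b in Icc y₂ (y₂ + 1),
      ∫⁻ r in Icc (z - 1) z, mixedSq F (t, a, b, r) := by
    refine (sqE_le_lintegral_y1 F ht y₁ y₂ hz.le).trans ?_
    calc _ ≤ 2 * ∫⁻ a in Icc y₁ (y₁ + 1), 4 * ∫⁻ b in Icc y₂ (y₂ + 1),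
            ∫⁻ r in Icc (z - 1) z, mixedSq F (t, a, b, r) := by
          gcongr with a
          refine (add_le_add (s₂ F a) (s₂ _ a)).trans (le_of_eq ?_)
          rw [← mul_add, ← lintegral_add_left (m₂' F a)]
          congr 1
          refine lintegral_congr fun b => ?_
          rw [← lintegral_add_left (m₂'' F a b)]
          rfl
      _ = _ := by
          rw [lintegral_const_mul' _ _ (by simp), ← mul_assoc]
          norm_num
  refine s₁.trans ?_
  gcongr
  have hcx : Continuous fun x : ℝ × ℝ × ℝ => mixedSq F (t, x) := c₁.comp (by fun_prop)
  calc _ = ∫⁻ x, mixedSq F (t, x) ∂((volume.restrict (Icc y₁ (y₁ + 1))).prod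
          ((volume.restrict (Icc y₂ (y₂ + 1))).prod (volume.restrict (Icc (z - 1) z)))) := by
        rw [lintegral_prod _ hcx.measurable.aemeasurable]
        refine lintegral_congr fun a => ?_
        exact (lintegral_prod (fun x : ℝ × ℝ => mixedSq F (t, a, x))
          (hcx.comp (by fun_prop : Continuous fun x : ℝ × ℝ =>
            ((a, x) : ℝ × ℝ × ℝ))).measurable.aemeasurable).symm
    _ = ∫⁻ x in Icc y₁ (y₁ + 1) ×ˢ Icc y₂ (y₂ + 1) ×ˢ Icc (z - 1) z, mixedSq F (t, x) := by
        rw [Measure.prod_restrict, Measure.prod_restrict]; rfl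
    _ ≤ _ := by
        refine lintegral_mono_set fun x hx => ?_
        exact lt_of_le_of_lt hx.2.2.2 hz

/-- Slices of `z f` in `L^∞` are controlled by conormal derivatives in `L²`. -/
lemma exists_mixedSq_zc_mul_le (R : ℝ) (hR : 0 < R) :
    ∃ C : ℝ≥0, ∀ f : smoothAlg T, VanishesBelow R f → ∀ p ∈ spaceTimeDomain T,
      mixedSq (zc * f) p ≤ C * ∑ i ∈ ({[], [2], [1], [2, 1], [3], [3, 2], [3, 1], [3, 2, 1]} :
        Finset (List (Fin 4))), sqE (word (vectorFields phiZ) i f) p := by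
  refine ⟨(4 * (2 + R) ^ 2).toNNReal, fun f hf p hp => ?_⟩
  have key : ∀ g : smoothAlg T, VanishesBelow R g →
      withDeriv (0, 0, 0, 1) sqE (zc * g) p
        ≤ (4 * (2 + R) ^ 2).toNNReal * (sqE g p + sqE (vectorFields phiZ 3 g) p) := by
    intro g hg
    have e1 : (zc * g : smoothAlg T) p = p.2.2.2 * g p := by rw [mul_apply, zc_apply hp]
    -- The weight `z` makes the full normal derivative conormal, up to the factor `1 - z`.
    have e2 : pd (0, 0, 0, 1) (zc * g) p = g p + (1 - p.2.2.2) * vectorFields phiZ 3 g p := by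
      have : pd (0, 0, 0, 1) (zc * g) = g + (1 - zc) * vectorFields phiZ 3 g := by
        rw [vectorFields_three, ← mul_assoc, ← zc_eq, pd_mul, pd_zc]
        simp
      rw [this, add_apply, mul_apply, sub_apply, one_apply, zc_apply hp]
    simp only [withDeriv, sqE]
    rw [e1, e2, ← ENNReal.ofReal_add (by positivity) (by positivity),
      ← ENNReal.ofReal_add (by positivity) (by positivity)]
    change _ ≤ ENNReal.ofReal _ * _
    rw [← ENNReal.ofReal_mul (by positivity)]
    apply ENNReal.ofReal_le_ofReal
    -- Where `g` does not vanish, `|z| ≤ R` and `1 - z ≤ 1 + R`; this is where the support condition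
    -- enters.
    by_cases hz : p.2.2.2 < -R
    · rw [hg p hp hz, (hg.vectorFields phiZ 3) p hp hz]; simp
    · have h0 : p.2.2.2 ≤ 0 := hp.2
      push Not at hz
      generalize p.2.2.2 = z at *
      generalize g p = x at *
      generalize vectorFields phiZ 3 g p = y at *
      have a1 : (z * x) ^ 2 ≤ R ^ 2 * x ^ 2 := by
        rw [mul_pow]; exact mul_le_mul_of_nonneg_right (by nlinarith) (sq_nonneg x)
      have a2 : (x + (1 - z) * y) ^ 2 ≤ 2 * x ^ 2 + 2 * ((1 - z) * y) ^ 2 := by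
        nlinarith [sq_nonneg (x - (1 - z) * y)]
      have a3 : ((1 - z) * y) ^ 2 ≤ (1 + R) ^ 2 * y ^ 2 := by
        rw [mul_pow]; exact mul_le_mul_of_nonneg_right (by nlinarith) (sq_nonneg y)
      nlinarith [sq_nonneg x, sq_nonneg y, mul_nonneg hR.le (sq_nonneg x),
        mul_nonneg hR.le (sq_nonneg y), mul_nonneg (sq_nonneg R) (sq_nonneg x),
        mul_nonneg (sq_nonneg R) (sq_nonneg y)]
  have d1 : ∀ g : smoothAlg T, pd (0, 1, 0, 0) (zc * g) = zc * pd (0, 1, 0, 0) g := fun g => by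
    rw [pd_mul, isNormal_zc.2.1, zero_mul, zero_add]
  have d2 : ∀ g : smoothAlg T, pd (0, 0, 1, 0) (zc * g) = zc * pd (0, 0, 1, 0) g := fun g => by
    rw [pd_mul, isNormal_zc.2.2, zero_mul, zero_add]
  have hX1 := hf.pd (0, 1, 0, 0)
  have k1 := key _ hf
  have k2 := key _ (hf.pd (0, 0, 1, 0))
  have k3 := key _ hX1
  have k4 := key _ (hX1.pd (0, 0, 1, 0))
  change (withDeriv (0, 0, 0, 1) sqE (zc * f) p
      + withDeriv (0, 0, 0, 1) sqE (pd (0, 0, 1, 0) (zc * f)) p)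
    + (withDeriv (0, 0, 0, 1) sqE (pd (0, 1, 0, 0) (zc * f)) p
      + withDeriv (0, 0, 0, 1) sqE (pd (0, 0, 1, 0) (pd (0, 1, 0, 0) (zc * f))) p) ≤ _
  rw [d1, d2, d2]
  refine (add_le_add (add_le_add k1 k2) (add_le_add k3 k4)).trans (le_of_eq ?_)
  rw [← mul_add, ← mul_add, ← mul_add]
  congr 1
  rw [Finset.sum_insert (by decide), Finset.sum_insert (by decide), Finset.sum_insert (by decide),
    Finset.sum_insert (by decide), Finset.sum_insert (by decide), Finset.sum_insert (by decide),
    Finset.sum_insert (by decide), Finset.sum_singleton]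
  simp only [word_cons, word_nil, mul_one, Module.End.mul_apply, Module.End.one_apply]
  simp only [vectorFields_one, vectorFields_two]
  ring

lemma lintegral_sqE_word_le {F : smoothAlg T} {f : SpaceTime → ℝ}
    (h : EqOn F f (spaceTimeDomain T)) {m : ℕ} {u : List (Fin 4)} (hu : u.length ≤ m)
    {t : ℝ} (ht : t ∈ Icc 0 T) :
    ∫⁻ x in lowerHalfSpace, sqE (word (vectorFields phiZ) u F) (t, x) ≤ XNorm T m f t ^ 2 := by
  have hX : XNorm T m f t ^ 2
      = ∑ β ∈ multiIndices 4 m, sliceNorm 2 (conormalDeriv T β f) t ^ 2 := by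
    rw [XNorm, ← ENNReal.rpow_natCast, ← ENNReal.rpow_mul]
    norm_num
  rw [hX, word_eq_monomial (commute_vectorFields isNormal_phiZ)]
  refine le_trans (le_of_eq ?_) (Finset.single_le_sum
    (f := fun β => sliceNorm 2 (conormalDeriv T β f) t ^ 2)
    (fun _ _ => zero_le) (sum_count_mem hu))
  rw [sliceNorm, eLpNorm_eq_lintegral_rpow_enorm_toReal (by simp) (by simp),
    ← ENNReal.rpow_natCast, ← ENNReal.rpow_mul]
  simp only [ENNReal.toReal_ofNat, Nat.cast_ofNat, one_div, isUnit_iff_ne_zero, ne_eq,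
    OfNat.ofNat_ne_zero, not_false_eq_true, IsUnit.inv_mul_cancel, ENNReal.rpow_one]
  refine setLIntegral_congr_fun isOpen_lowerHalfSpace.measurableSet fun x hx => ?_
  have hp : ((t, x) : SpaceTime) ∈ spaceTimeDomain T := ⟨ht, le_of_lt (show x.2.2 < 0 from hx)⟩
  rw [← eqOn_conormalDeriv _ F f h hp, sqE, Real.enorm_eq_ofReal_abs, ENNReal.rpow_ofNat,
    ← ENNReal.ofReal_pow (abs_nonneg _), sq_abs]

/-- Sobolev for `z` times the derivative. The eight additional words have length at most `3`, which
accounts for the index `k + 3`. -/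
lemma exists_abs_mul_word_le_XNorm (R : ℝ) (hR : 0 < R) (k : ℕ) :
    ∃ C : ℝ≥0, ∀ (F : smoothAlg T) (f : SpaceTime → ℝ), EqOn F f (spaceTimeDomain T) →
      VanishesBelow R F → ∀ u : List (Fin 4), u.length ≤ k →
      ∀ p ∈ spaceTimeDomain T, p.2.2.2 < 0 →
        ENNReal.ofReal (|p.2.2.2| * |word (vectorFields phiZ) u F p|)
          ≤ C * XNorm T (k + 3) f p.1 := by
  obtain ⟨C, hC⟩ := exists_mixedSq_zc_mul_le (T := T) R hR
  -- The Sobolev constant `8` and the eight words give `64 C` for the squares, and `64 C ≤ (8 C +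
  -- 8)²`.
  refine ⟨8 * C + 8, fun F f hF hv u hu p hp hz => ?_⟩
  obtain ⟨t, y₁, y₂, z⟩ := p
  have ht : t ∈ Icc 0 T := hp.1
  set g := word (vectorFields phiZ) u F with hg
  set S : Finset (List (Fin 4)) := {[], [2], [1], [2, 1], [3], [3, 2], [3, 1], [3, 2, 1]} with hS
  have hgv : VanishesBelow R g := hv.word phiZ u
  have hSlen : ∀ i ∈ S, i.length ≤ 3 := by rw [hS]; decide
  have hScard : S.card = 8 := by rw [hS]; decide
  have hmeas : ∀ i, Measurable fun x : ℝ × ℝ × ℝ => sqE (word (vectorFields phiZ) i g) (t, x) :=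
    fun i => ((continuous_sqE _).comp (by fun_prop)).measurable
  have h1 : ENNReal.ofReal (|z| * |g (t, y₁, y₂, z)|) ^ 2
      ≤ (8 * C + 8 : ℝ≥0) ^ 2 * XNorm T (k + 3) f t ^ 2 := by
    calc ENNReal.ofReal (|z| * |g (t, y₁, y₂, z)|) ^ 2 = sqE (zc * g) (t, y₁, y₂, z) := by
          rw [sqE, mul_apply, zc_apply hp, ← ENNReal.ofReal_pow (by positivity), ← abs_mul, sq_abs]
      _ ≤ 8 * ∫⁻ x in lowerHalfSpace, mixedSq (zc * g) (t, x) :=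
          sqE_le_lintegral_mixedSq _ ht y₁ y₂ hz
      _ ≤ 8 * ∫⁻ x in lowerHalfSpace, C * ∑ i ∈ S, sqE (word (vectorFields phiZ) i g) (t, x) := by
          gcongr 8 * ?_
          exact setLIntegral_mono' isOpen_lowerHalfSpace.measurableSet fun x hx =>
            hC g hgv (t, x) ⟨ht, le_of_lt (show x.2.2 < 0 from hx)⟩
      _ = 8 * (C * ∑ i ∈ S, ∫⁻ x in lowerHalfSpace,
            sqE (word (vectorFields phiZ) i g) (t, x)) := by
          rw [lintegral_const_mul' _ _ (by simp), lintegral_finsetSum _ fun i _ => hmeas i]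
      _ ≤ 8 * (C * ∑ _i ∈ S, XNorm T (k + 3) f t ^ 2) := by
          gcongr with i hi
          have e : word (vectorFields phiZ) i g = word (vectorFields phiZ) (i ++ u) F := by
            rw [word_append]; rfl
          rw [e]
          refine lintegral_sqE_word_le hF ?_ ht
          have := hSlen i hi
          rw [List.length_append]
          omega
      _ = (64 * C : ℝ≥0) * XNorm T (k + 3) f t ^ 2 := by
          rw [Finset.sum_const, hScard, nsmul_eq_mul]
          push_cast
          ring
      _ ≤ _ := by
          gcongr
          rw [← ENNReal.coe_pow, ENNReal.coe_le_coe]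
          nlinarith [zero_le (a := C), sq_nonneg (C : ℝ≥0)]
  rw [← mul_pow] at h1
  exact (ENNReal.pow_le_pow_left_iff two_ne_zero).1 h1

/-- Weighted bound of `derivSize` by the `L²` conormal norm of three more orders. -/
lemma exists_abs_mul_derivSize_le_XNorm (R : ℝ) (hR : 0 < R) (k : ℕ) :
    ∃ C : ℝ≥0, ∀ (F : smoothAlg T) (f : SpaceTime → ℝ), EqOn F f (spaceTimeDomain T) →
      VanishesBelow R F → ∀ p ∈ strip T (R + 1), p.2.2.2 < 0 →
        ENNReal.ofReal (|p.2.2.2| * derivSize (vectorFields zc) (k + 1) F p)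
          ≤ C * XNorm T (k + 3) f p.1 := by
  obtain ⟨C₀, h₀⟩ := exists_abs_mul_word_le_XNorm (T := T) R hR k
  obtain ⟨C, hC, h⟩ := exists_euler_le_conormal (T := T) (R + 1) (k + 1)
  obtain ⟨C', hC', h'⟩ := derivSize_le_of_words (vectorFields (phiZ : smoothAlg T)) (k + 1)
  refine ⟨((C * C').toNNReal + 1) * (C₀ + 1), fun F f hF hv p hp hz => ?_⟩
  rcases eq_or_ne (XNorm T (k + 3) f p.1) ⊤ with htop | hfin
  · rw [htop, ENNReal.mul_top (by simp)]
    exact le_top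
  have hz' : 0 < |p.2.2.2| := abs_pos.2 hz.ne
  have hw : ∀ u : List (Fin 4), u.length < k + 1 →
      |word (vectorFields phiZ) u F p| ≤ C₀ * (XNorm T (k + 3) f p.1).toReal / |p.2.2.2| := by
    intro u hu
    rw [le_div_iff₀ hz', mul_comm]
    have := (ENNReal.ofReal_le_iff_le_toReal (ENNReal.mul_ne_top (by simp) hfin)).1
      (h₀ F f hF hv u (Nat.le_of_lt_succ hu) p hp.1 hz)
    simpa using this
  have h1 := (h p hp F).trans (mul_le_mul_of_nonneg_left (h' F p _ hw) hC)
  have h2 : |p.2.2.2| * derivSize (vectorFields zc) (k + 1) F p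
      ≤ C * C' * C₀ * (XNorm T (k + 3) f p.1).toReal := by
    refine (mul_le_mul_of_nonneg_left h1 hz'.le).trans (le_of_eq ?_)
    field_simp
  calc _ ≤ ENNReal.ofReal (C * C' * C₀ * (XNorm T (k + 3) f p.1).toReal) :=
        ENNReal.ofReal_le_ofReal h2
    _ = ((C * C').toNNReal * C₀ : ℝ≥0) * XNorm T (k + 3) f p.1 := by
      rw [ENNReal.ofReal_mul (by positivity), ENNReal.ofReal_toReal hfin,
        ENNReal.ofReal_mul (by positivity), ENNReal.ofReal_coe_nnreal, ENNReal.coe_mul]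
      rfl
    _ ≤ _ := by gcongr <;> simp

/-! ### A cutoff transported inwards -/

lemma exists_abs_deriv_smoothTransition_le :
    ∃ C : ℝ, 0 ≤ C ∧ ∀ x, |deriv Real.smoothTransition x| ≤ C := by
  have hc : Continuous (deriv Real.smoothTransition) :=
    (Real.smoothTransition.contDiff (n := 1)).continuous_deriv le_rfl
  obtain ⟨C, hC⟩ := isCompact_Icc.exists_bound_of_continuousOn (s := Icc (0 : ℝ) 1) hc.continuousOn
  refine ⟨max C 0, le_max_right _ _, fun x => ?_⟩
  by_cases hx : x ∈ Icc (0 : ℝ) 1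
  · exact (hC x hx).trans (le_max_left _ _)
  · have : deriv Real.smoothTransition x = 0 := by
      rcases lt_or_ge x 0 with h | h
      · have : Real.smoothTransition =ᶠ[𝓝 x] fun _ => 0 := by
          filter_upwards [Iio_mem_nhds h] with y hy
          exact Real.smoothTransition.zero_of_nonpos (le_of_lt hy)
        rw [this.deriv_eq]; simp
      · have h1 : 1 < x := by
          by_contra! h'
          exact hx ⟨h, h'⟩
        have : Real.smoothTransition =ᶠ[𝓝 x] fun _ => 1 := by
          filter_upwards [Ioi_mem_nhds h1] with y hy
          exact Real.smoothTransition.one_of_one_le (le_of_lt hy)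
        rw [this.deriv_eq]; simp
    rw [this, abs_zero]
    exact le_max_right _ _

lemma hasDerivAt_sqrt_one_add_sq (x c : ℝ) :
    HasDerivAt (fun r : ℝ => √(1 + (x + r * c) ^ 2)) (x / √(1 + x ^ 2) * c) 0 := by
  have h1 : HasDerivAt (fun r : ℝ => 1 + (x + r * c) ^ 2) (2 * x * c) 0 := by
    have := ((((hasDerivAt_id (0 : ℝ)).mul_const c).const_add x).fun_pow 2).const_add 1
    simpa [mul_assoc] using this
  have h2 := h1.sqrt (by simp only [zero_mul, add_zero]; positivity)
  refine h2.congr_deriv ?_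
  simp only [zero_mul, add_zero]
  have : √(1 + x ^ 2) ≠ 0 := by positivity
  field_simp

lemma abs_div_sqrt_one_add_sq_le (x : ℝ) : |x / √(1 + x ^ 2)| ≤ 1 := by
  rw [abs_div, abs_of_nonneg (Real.sqrt_nonneg _)]
  refine div_le_one_of_le₀ ?_ (Real.sqrt_nonneg _)
  rw [← Real.sqrt_sq_eq_abs]
  exact Real.sqrt_le_sqrt (by linarith)

/-- The cutoff is `Real.smoothTransition (1 - q)` with `q = √(1 + (y₁ - a₁)²) + √(1 + (y₂ - a₂)²) -
2 + M (t - t₀)`, a smooth substitute for a shrinking cone. Both space derivatives of `q` are at most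
`1` in absolute value, so `q` does not decrease along velocities with `|b₁| + |b₂| ≤ M`. Also `q =
0` above `(t₀, a₁, a₂)`, and `q ≥ 1` once one coordinate is at distance `2 + M T`. The bound on the
gradient depends only on the profile. -/
lemma exists_cutoff : ∃ C : ℝ, 0 ≤ C ∧ ∀ M : ℝ, 0 ≤ M → ∀ t₀ ∈ Icc 0 T, ∀ a₁ a₂ : ℝ,
    ∃ χ : smoothAlg T, (∀ p ∈ spaceTimeDomain T, 0 ≤ χ p ∧ χ p ≤ 1) ∧
      (∀ z ≤ 0, χ (t₀, a₁, a₂, z) = 1) ∧ pd (0, 0, 0, 1) χ = 0 ∧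
      (∀ p ∈ spaceTimeDomain T, |pd (0, 1, 0, 0) χ p| ≤ C ∧ |pd (0, 0, 1, 0) χ p| ≤ C) ∧
      (∀ p ∈ spaceTimeDomain T, ∀ b₁ b₂ : ℝ, |b₁| + |b₂| ≤ M →
        pd (1, 0, 0, 0) χ p + b₁ * pd (0, 1, 0, 0) χ p + b₂ * pd (0, 0, 1, 0) χ p ≤ 0) ∧
      (∀ p ∈ spaceTimeDomain T, 2 + M * T ≤ |p.2.1 - a₁| ∨ 2 + M * T ≤ |p.2.2.1 - a₂| →
        χ p = 0) := by
  obtain ⟨C, hC, hst⟩ := exists_abs_deriv_smoothTransition_le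
  refine ⟨C, hC, fun M hM t₀ ht₀ a₁ a₂ => ?_⟩
  set q : SpaceTime → ℝ := fun p =>
    √(1 + (p.2.1 - a₁) ^ 2) + √(1 + (p.2.2.1 - a₂) ^ 2) - 2 + M * (p.1 - t₀) with hq
  set g : SpaceTime → ℝ := fun p => Real.smoothTransition (1 - q p) with hgdef
  have hqs : ContDiff ℝ ∞ q := by
    refine ContDiff.add (ContDiff.sub (ContDiff.add ?_ ?_) contDiff_const) (by fun_prop)
    · exact ContDiff.sqrt (by fun_prop) fun p => by positivity
    · exact ContDiff.sqrt (by fun_prop) fun p => by positivity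
  have hg : ContDiff ℝ ∞ g := Real.smoothTransition.contDiff.comp (contDiff_const.sub hqs)
  have hgp : ∀ e : SpaceTime, ∀ p ∈ spaceTimeDomain T,
      pd e (ofFun (T := T) g hg.contDiffOn) p = deriv Real.smoothTransition (1 - q p)
        * (-((p.2.1 - a₁) / √(1 + (p.2.1 - a₁) ^ 2) * e.2.1
          + (p.2.2.1 - a₂) / √(1 + (p.2.2.1 - a₂) ^ 2) * e.2.2.1 + M * e.1)) := by
    intro e p hp
    refine pd_ofFun_of_hasDerivAt hg e hp ?_
    have d1 := hasDerivAt_sqrt_one_add_sq (p.2.1 - a₁) e.2.1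
    have d2 := hasDerivAt_sqrt_one_add_sq (p.2.2.1 - a₂) e.2.2.1
    have d3 : HasDerivAt (fun r : ℝ => M * (p.1 - t₀ + r * e.1)) (M * e.1) 0 := by
      simpa using (((hasDerivAt_id (0 : ℝ)).mul_const e.1).const_add (p.1 - t₀)).const_mul M
    have d4 := ((((d1.fun_add d2).sub_const 2).fun_add d3).const_sub 1)
    have d5 : HasDerivAt (fun r : ℝ => 1 - q (p + r • e))
        (-((p.2.1 - a₁) / √(1 + (p.2.1 - a₁) ^ 2) * e.2.1
          + (p.2.2.1 - a₂) / √(1 + (p.2.2.1 - a₂) ^ 2) * e.2.2.1 + M * e.1)) 0 := by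
      refine d4.congr_of_eventuallyEq (Eventually.of_forall fun r => ?_)
      simp only [hq, Prod.snd_add, Prod.fst_add, Prod.smul_snd, Prod.smul_fst, smul_eq_mul,
        add_sub_right_comm]
    have d6 : HasDerivAt Real.smoothTransition (deriv Real.smoothTransition (1 - q p))
        (1 - q (p + (0 : ℝ) • e)) := by
      rw [zero_smul, add_zero]
      exact ((Real.smoothTransition.contDiff (n := 1)).differentiable (by simp) _).hasDerivAt
    exact d6.comp 0 d5
  have n₁ : ∀ p : SpaceTime, |(p.2.1 - a₁) / √(1 + (p.2.1 - a₁) ^ 2)| ≤ 1 :=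
    fun p => abs_div_sqrt_one_add_sq_le _
  have n₂ : ∀ p : SpaceTime, |(p.2.2.1 - a₂) / √(1 + (p.2.2.1 - a₂) ^ 2)| ≤ 1 :=
    fun p => abs_div_sqrt_one_add_sq_le _
  have hd0 : ∀ x, 0 ≤ deriv Real.smoothTransition x := fun x =>
    Real.smoothTransition.monotone.deriv_nonneg
  refine ⟨ofFun g hg.contDiffOn, ?_, ?_, ?_, ?_, ?_, ?_⟩
  · intro p hp
    rw [ofFun_apply _ hp]
    exact ⟨Real.smoothTransition.nonneg _, Real.smoothTransition.le_one _⟩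
  · intro z hz
    rw [ofFun_apply _ ⟨ht₀, hz⟩]
    refine Real.smoothTransition.one_of_one_le ?_
    simp only [hq, sub_self]
    norm_num
  · refine smoothAlg_ext fun p hp => ?_
    rw [hgp _ p hp]
    simp
  · intro p hp
    rw [hgp _ p hp, hgp _ p hp]
    simp only [mul_zero, mul_one, add_zero, zero_add, abs_mul, abs_neg]
    constructor
    · nlinarith [hst (1 - q p), n₁ p, abs_nonneg (deriv Real.smoothTransition (1 - q p)),
        abs_nonneg ((p.2.1 - a₁) / √(1 + (p.2.1 - a₁) ^ 2))]
    · nlinarith [hst (1 - q p), n₂ p, abs_nonneg (deriv Real.smoothTransition (1 - q p)),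
        abs_nonneg ((p.2.2.1 - a₂) / √(1 + (p.2.2.1 - a₂) ^ 2))]
  · intro p hp b₁ b₂ hb
    rw [hgp _ p hp, hgp _ p hp, hgp _ p hp]
    simp only [mul_zero, mul_one, add_zero, zero_add]
    have h1 := n₁ p
    have h2 := n₂ p
    generalize (p.2.1 - a₁) / √(1 + (p.2.1 - a₁) ^ 2) = x at *
    generalize (p.2.2.1 - a₂) / √(1 + (p.2.2.1 - a₂) ^ 2) = y at *
    have h3 : |b₁ * x| ≤ |b₁| := by
      rw [abs_mul]; exact mul_le_of_le_one_right (abs_nonneg _) h1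
    have h4 : |b₂ * y| ≤ |b₂| := by
      rw [abs_mul]; exact mul_le_of_le_one_right (abs_nonneg _) h2
    have h5 := neg_abs_le (b₁ * x)
    have h6 := neg_abs_le (b₂ * y)
    nlinarith [mul_nonneg (hd0 (1 - q p)) (by linarith : 0 ≤ M + b₁ * x + b₂ * y)]
  · intro p hp hfar
    rw [ofFun_apply _ hp]
    refine Real.smoothTransition.zero_of_nonpos ?_
    have s1 : |p.2.1 - a₁| ≤ √(1 + (p.2.1 - a₁) ^ 2) := by
      rw [← Real.sqrt_sq_eq_abs]; exact Real.sqrt_le_sqrt (by linarith)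
    have s2 : |p.2.2.1 - a₂| ≤ √(1 + (p.2.2.1 - a₂) ^ 2) := by
      rw [← Real.sqrt_sq_eq_abs]; exact Real.sqrt_le_sqrt (by linarith)
    have s3 : 1 ≤ √(1 + (p.2.1 - a₁) ^ 2) := Real.one_le_sqrt.2 (by nlinarith [sq_nonneg (p.2.1 - a₁)])
    have s4 : 1 ≤ √(1 + (p.2.2.1 - a₂) ^ 2) :=
      Real.one_le_sqrt.2 (by nlinarith [sq_nonneg (p.2.2.1 - a₂)])
    have s5 : M * (t₀ - p.1) ≤ M * T :=
      mul_le_mul_of_nonneg_left (by linarith [hp.1.1, ht₀.2]) hM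
    simp only [hq]
    rcases hfar with h | h <;> nlinarith

/-! ### The maximum principle -/

/-- If `g''` were positive, the point would also be a local minimum, so `g` would be locally
constant and `g''` would vanish. -/
lemma second_deriv_nonpos_of_isLocalMax {g g' : ℝ → ℝ} {g'' x : ℝ} (hmax : IsLocalMax g x)
    (h1 : ∀ᶠ r in 𝓝 x, HasDerivAt g (g' r) r) (h2 : HasDerivAt g' g'' x) : g'' ≤ 0 := by
  by_contra! hpos
  have e1 : deriv g =ᶠ[𝓝 x] g' := h1.mono fun r hr => hr.deriv
  have e2 : deriv (deriv g) x = g'' := by rw [e1.deriv_eq, h2.deriv]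
  have hmin : IsLocalMin g x := isLocalMin_of_deriv_deriv_pos (by rw [e2]; exact hpos)
    hmax.deriv_eq_zero h1.self_of_nhds.continuousAt
  have hconst : g =ᶠ[𝓝 x] fun _ => g x := by
    filter_upwards [hmax, hmin] with r h h'
    exact le_antisymm h h'
  have e3 : deriv g =ᶠ[𝓝 x] fun _ => 0 := by
    have := hconst.deriv
    simpa using this
  have e4 := e3.deriv_eq
  simp only [deriv_const] at e4
  linarith

lemma deriv_nonneg_of_max_left {g : ℝ → ℝ} {d t : ℝ} (ht : 0 < t)
    (hd : HasDerivWithinAt g d (Icc 0 t) t) (hmax : ∀ r ∈ Icc 0 t, g r ≤ g t) : 0 ≤ d := by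
  have h1 : HasDerivWithinAt g d (Ioo 0 t) t := hd.mono Ioo_subset_Icc_self
  rw [hasDerivWithinAt_iff_tendsto_slope' (by simp)] at h1
  have : (𝓝[Ioo 0 t] t).NeBot := by
    rw [← mem_closure_iff_nhdsWithin_neBot, closure_Ioo ht.ne]
    exact right_mem_Icc.2 ht.le
  refine ge_of_tendsto h1 ?_
  filter_upwards [self_mem_nhdsWithin] with r hr
  rw [slope_def_field]
  have := hmax r (Ioo_subset_Icc_self hr)
  exact div_nonneg_of_nonpos (by linarith) (by linarith [hr.2])

/-- Weak maximum principle on a box, with a time-dependent source bound. -/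
lemma le_add_integral_of_transport_le {ε : ℝ} (hε : 0 < ε) (w₁ w₂ w₃ V : smoothAlg T)
    {l₁ r₁ l₂ r₂ Z B : ℝ} {G : ℝ → ℝ} (hG : Continuous G) (hG0 : ∀ t, 0 ≤ G t) (hB : 0 ≤ B)
    (hbd : ∀ t ∈ Icc 0 T, ∀ y₁ ∈ Icc l₁ r₁, ∀ y₂ ∈ Icc l₂ r₂, ∀ z ∈ Icc (-Z) 0,
      (y₁ = l₁ ∨ y₁ = r₁ ∨ y₂ = l₂ ∨ y₂ = r₂ ∨ z = -Z ∨ z = 0) → V (t, y₁, y₂, z) ≤ 0)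
    (hinit : ∀ y₁ ∈ Icc l₁ r₁, ∀ y₂ ∈ Icc l₂ r₂, ∀ z ∈ Icc (-Z) 0, V (0, y₁, y₂, z) ≤ B)
    (hsrc : ∀ t ∈ Icc 0 T, ∀ y₁ ∈ Ioo l₁ r₁, ∀ y₂ ∈ Ioo l₂ r₂, ∀ z ∈ Ioo (-Z) 0,
      0 < V (t, y₁, y₂, z) → transport ε w₁ w₂ w₃ V (t, y₁, y₂, z) ≤ G t)
    {t y₁ y₂ z : ℝ} (ht : t ∈ Icc 0 T) (hy₁ : y₁ ∈ Icc l₁ r₁) (hy₂ : y₂ ∈ Icc l₂ r₂)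
    (hz : z ∈ Icc (-Z) 0) :
    V (t, y₁, y₂, z) ≤ B + ∫ τ in (0 : ℝ)..t, G τ := by
  have hint : ∀ s, 0 ≤ s → 0 ≤ ∫ τ in (0 : ℝ)..s, G τ := fun s hs =>
    intervalIntegral.integral_nonneg hs fun r _ => hG0 r
  -- With this slack the barrier grows strictly faster than `G`. At a positive maximum of `V - E`
  -- one has `∂_t V ≥ G + δ`, zero gradient and `∂_{zz} V ≤ 0`, contradicting the non-strict bound
  -- on the source.
  suffices h : ∀ δ : ℝ, 0 < δ → V (t, y₁, y₂, z) ≤ (B + ∫ τ in (0 : ℝ)..t, G τ) + δ * (1 + t) by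
    refine le_of_forall_pos_le_add fun δ hδ => ?_
    have h1 : 0 < 1 + t := by linarith [ht.1]
    have := h (δ / (1 + t)) (div_pos hδ h1)
    rwa [div_mul_cancel₀ _ h1.ne'] at this
  intro δ hδ
  set E : ℝ → ℝ := fun s => (B + ∫ τ in (0 : ℝ)..s, G τ) + δ * (1 + s) with hE
  have hEd : ∀ s, HasDerivAt E (G s + δ) s := by
    intro s
    have h1 := (hG.integral_hasStrictDerivAt 0 s).hasDerivAt
    have h2 := ((hasDerivAt_id s).const_add 1).const_mul δ
    simpa using (h1.const_add B).fun_add h2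
  have hEpos : ∀ s, 0 ≤ s → 0 < E s := fun s hs => by
    have := hint s hs
    have : 0 < δ * (1 + s) := by positivity
    simp only [hE]; linarith
  have hEc : Continuous E := continuous_iff_continuousAt.2 fun s => (hEd s).continuousAt
  set K : Set SpaceTime := Icc 0 T ×ˢ (Icc l₁ r₁ ×ˢ (Icc l₂ r₂ ×ˢ Icc (-Z) 0)) with hK
  have hKc : IsCompact K := isCompact_Icc.prod (isCompact_Icc.prod (isCompact_Icc.prod isCompact_Icc))
  have hΦ : Continuous fun p : SpaceTime => V p - E p.1 :=
    (continuous_coe V).sub (hEc.comp continuous_fst)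
  obtain ⟨⟨s, x₁, x₂, ζ⟩, ⟨hs, hx₁, hx₂, hζ⟩, hmax⟩ := hKc.exists_isMaxOn
    ⟨(t, y₁, y₂, z), ⟨ht, hy₁, hy₂, hz⟩⟩ hΦ.continuousOn
  simp only at hs hx₁ hx₂ hζ
  have hmax' : ∀ s' ∈ Icc 0 T, ∀ x₁' ∈ Icc l₁ r₁, ∀ x₂' ∈ Icc l₂ r₂, ∀ ζ' ∈ Icc (-Z) 0,
      V (s', x₁', x₂', ζ') - E s' ≤ V (s, x₁, x₂, ζ) - E s :=
    fun s' h1 x₁' h2 x₂' h3 ζ' h4 =>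
      hmax (show ((s', x₁', x₂', ζ') : SpaceTime) ∈ K from ⟨h1, h2, h3, h4⟩)
  by_contra! hlt
  have hpos : 0 < V (s, x₁, x₂, ζ) - E s := by
    have := hmax' t ht y₁ hy₁ y₂ hy₂ z hz
    simp only [hE] at this ⊢
    linarith
  have hEs := hEpos s hs.1
  have hVpos : 0 < V (s, x₁, x₂, ζ) := by linarith
  have hs0 : 0 < s := by
    rcases hs.1.eq_or_lt with h | h
    · exfalso
      subst h
      have h1 := hinit x₁ hx₁ x₂ hx₂ ζ hζ
      have h2 : E 0 = B + δ := by simp [hE]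
      linarith
    · exact h
  have hint' : ¬ (x₁ = l₁ ∨ x₁ = r₁ ∨ x₂ = l₂ ∨ x₂ = r₂ ∨ ζ = -Z ∨ ζ = 0) := fun h =>
    absurd (hbd s hs x₁ hx₁ x₂ hx₂ ζ hζ h) (by linarith)
  push Not at hint'
  obtain ⟨i1, i2, i3, i4, i5, i6⟩ := hint'
  have jx₁ : x₁ ∈ Ioo l₁ r₁ := ⟨lt_of_le_of_ne hx₁.1 i1.symm, lt_of_le_of_ne hx₁.2 i2⟩
  have jx₂ : x₂ ∈ Ioo l₂ r₂ := ⟨lt_of_le_of_ne hx₂.1 i3.symm, lt_of_le_of_ne hx₂.2 i4⟩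
  have jζ : ζ ∈ Ioo (-Z) 0 := ⟨lt_of_le_of_ne hζ.1 i5.symm, lt_of_le_of_ne hζ.2 i6⟩
  -- time derivative
  have dt_ge : G s + δ ≤ pd (1, 0, 0, 0) V (s, x₁, x₂, ζ) := by
    have hl : ∀ r : ℝ, ((0, x₁, x₂, ζ) : SpaceTime) + r • ((1, 0, 0, 0) : SpaceTime)
        = (r, x₁, x₂, ζ) := fun r => by simp
    have hd := hasDerivWithinAt_line (1, 0, 0, 0) V (p := (0, x₁, x₂, ζ)) (s := Icc 0 s) (x := s)
      (fun r hr => by rw [hl]; exact ⟨⟨hr.1, hr.2.trans hs.2⟩, hζ.2⟩) (right_mem_Icc.2 hs0.le)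
    simp only [hl] at hd
    have hd' := hd.fun_sub (hEd s).hasDerivWithinAt
    have := deriv_nonneg_of_max_left hs0 hd' fun r hr =>
      hmax' r ⟨hr.1, hr.2.trans hs.2⟩ x₁ hx₁ x₂ hx₂ ζ hζ
    linarith
  -- tangential derivatives
  have d1 : pd (0, 1, 0, 0) V (s, x₁, x₂, ζ) = 0 := by
    have hl : ∀ r : ℝ, ((s, 0, x₂, ζ) : SpaceTime) + r • ((0, 1, 0, 0) : SpaceTime)
        = (s, r, x₂, ζ) := fun r => by simp
    have hd := (hasDerivWithinAt_line (0, 1, 0, 0) V (p := (s, 0, x₂, ζ)) (s := univ) (x := x₁)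
      (fun r _ => by rw [hl]; exact ⟨hs, hζ.2⟩) (mem_univ _)).hasDerivAt univ_mem
    simp only [hl] at hd
    refine IsLocalMax.hasDerivAt_eq_zero ?_ hd
    filter_upwards [Icc_mem_nhds jx₁.1 jx₁.2] with r hr
    have := hmax' s hs r hr x₂ hx₂ ζ hζ
    linarith
  have d2 : pd (0, 0, 1, 0) V (s, x₁, x₂, ζ) = 0 := by
    have hl : ∀ r : ℝ, ((s, x₁, 0, ζ) : SpaceTime) + r • ((0, 0, 1, 0) : SpaceTime)
        = (s, x₁, r, ζ) := fun r => by simp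
    have hd := (hasDerivWithinAt_line (0, 0, 1, 0) V (p := (s, x₁, 0, ζ)) (s := univ) (x := x₂)
      (fun r _ => by rw [hl]; exact ⟨hs, hζ.2⟩) (mem_univ _)).hasDerivAt univ_mem
    simp only [hl] at hd
    refine IsLocalMax.hasDerivAt_eq_zero ?_ hd
    filter_upwards [Icc_mem_nhds jx₂.1 jx₂.2] with r hr
    have := hmax' s hs x₁ hx₁ r hr ζ hζ
    linarith
  -- normal derivatives
  have hl : ∀ r : ℝ, ((s, x₁, x₂, 0) : SpaceTime) + r • ((0, 0, 0, 1) : SpaceTime)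
      = (s, x₁, x₂, r) := fun r => by simp
  have dz : ∀ F : smoothAlg T, ∀ r ∈ Iio (0 : ℝ),
      HasDerivAt (fun r => F (s, x₁, x₂, r)) (pd (0, 0, 0, 1) F (s, x₁, x₂, r)) r := by
    intro F r hr
    have hd := (hasDerivWithinAt_line (0, 0, 0, 1) F (p := (s, x₁, x₂, 0)) (s := Iio 0) (x := r)
      (fun r hr => by rw [hl]; exact ⟨hs, le_of_lt hr⟩) hr).hasDerivAt (Iio_mem_nhds hr)
    simpa only [hl] using hd
  have hmaxz : IsLocalMax (fun r => V (s, x₁, x₂, r)) ζ := by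
    filter_upwards [Icc_mem_nhds jζ.1 jζ.2] with r hr
    have := hmax' s hs x₁ hx₁ x₂ hx₂ r hr
    linarith
  have d3 : pd (0, 0, 0, 1) V (s, x₁, x₂, ζ) = 0 := hmaxz.hasDerivAt_eq_zero (dz V ζ jζ.2)
  have d33 : pd (0, 0, 0, 1) (pd (0, 0, 0, 1) V) (s, x₁, x₂, ζ) ≤ 0 :=
    second_deriv_nonpos_of_isLocalMax hmaxz
      ((Iio_mem_nhds jζ.2 : Iio (0 : ℝ) ∈ 𝓝 ζ) |> fun h => by
        filter_upwards [h] with r hr using dz V r hr)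
      (dz _ ζ jζ.2)
  have hfin := hsrc s hs x₁ jx₁ x₂ jx₂ ζ jζ hVpos
  have e : transport ε w₁ w₂ w₃ V (s, x₁, x₂, ζ)
      = pd (1, 0, 0, 0) V (s, x₁, x₂, ζ) + w₁ (s, x₁, x₂, ζ) * pd (0, 1, 0, 0) V (s, x₁, x₂, ζ)
        + w₂ (s, x₁, x₂, ζ) * pd (0, 0, 1, 0) V (s, x₁, x₂, ζ)
        + w₃ (s, x₁, x₂, ζ) * pd (0, 0, 0, 1) V (s, x₁, x₂, ζ)
        - ε * pd (0, 0, 0, 1) (pd (0, 0, 0, 1) V) (s, x₁, x₂, ζ) := rfl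
  rw [e, d1, d2, d3] at hfin
  nlinarith [mul_nonpos_of_nonneg_of_nonpos hε.le d33]

/-! ### Bounds on the coefficients -/

lemma le_on_Icc_of_le_on_Ioo {h : ℝ → ℝ} (hc : Continuous h) {a b B : ℝ} (hab : a < b)
    (hB : ∀ ζ ∈ Ioo a b, h ζ ≤ B) : ∀ ζ ∈ Icc a b, h ζ ≤ B := by
  intro ζ hζ
  rw [← closure_Ioo hab.ne] at hζ
  exact (closure_minimal (fun x hx => hB x hx) (isClosed_le hc continuous_const) :
    closure (Ioo a b) ⊆ {x | h x ≤ B}) hζ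

/-- On vertical segments in the strip, `derivSize` is bounded by the `L^∞` conormal norm, up to
the boundary. -/
lemma exists_derivSize_le_YNorm_toReal (R : ℝ) (k : ℕ) :
    ∃ C : ℝ, 0 ≤ C ∧ ∀ (F : smoothAlg T) (f : SpaceTime → ℝ), EqOn F f (spaceTimeDomain T) →
      ∀ t ∈ Icc 0 T, YNorm T k f t ≠ ⊤ → ∀ y₁ y₂ : ℝ, ∀ z < 0, -R ≤ z → ∀ ζ ∈ Icc z 0,
        derivSize (vectorFields zc) (k + 1) F (t, y₁, y₂, ζ) ≤ C * (YNorm T k f t).toReal := by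
  obtain ⟨C, _, h⟩ := exists_derivSize_le_YNorm (T := T) R k
  refine ⟨C, C.2, fun F f hF t ht hfin y₁ y₂ z hz hR => ?_⟩
  refine le_on_Icc_of_le_on_Ioo ((continuous_derivSize _ _ F).comp (by fun_prop)) hz
    fun ζ hζ => ?_
  have := h F f hF (t, y₁, y₂, ζ) ⟨⟨ht, hζ.2.le⟩, hR.trans hζ.1.le⟩ hζ.2
  have := (ENNReal.ofReal_le_iff_le_toReal (ENNReal.mul_ne_top (by simp) hfin)).1 this
  simpa using this

lemma exists_derivSize_le_trace_add_YNorm (R : ℝ) (k : ℕ) :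
    ∃ C : ℝ, 0 ≤ C ∧ ∀ (F : smoothAlg T) (f : SpaceTime → ℝ), EqOn F f (spaceTimeDomain T) →
      ∀ t ∈ Icc 0 T, ∀ M : ℝ≥0, traceYNorm T k f t ≤ M → YNorm T k (dz T f) t ≠ ⊤ →
      ∀ y₁ y₂ : ℝ, ∀ z < 0, -R ≤ z →
        derivSize (vectorFields zc) (k + 1) F (t, y₁, y₂, z)
          ≤ C * (M + |z| * (YNorm T k (dz T f) t).toReal) := by
  obtain ⟨C, hC, h⟩ := exists_derivSize_le_trace_add (T := T) k
  obtain ⟨C', hC', h'⟩ := exists_derivSize_le_YNorm_toReal (T := T) R k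
  refine ⟨C * (1 + C'), by positivity, fun F f hF t ht M hM hfin y₁ y₂ z hz hR => ?_⟩
  have hw := h F t y₁ y₂ z M (C' * (YNorm T k (dz T f) t).toReal) ht hz.le M.2 (by positivity)
    (fun u hu h3 => by
      have := (ofReal_abs_word_le_traceYNorm hF hu h3 ht y₁ y₂).trans hM
      rwa [ENNReal.ofReal_le_iff_le_toReal (by simp), ENNReal.coe_toReal] at this)
    (h' (pd (0, 0, 0, 1) F) (dz T f) (pd_apply_of_eqOn _ F hF) t ht hfin y₁ y₂ z hz hR)
  refine hw.trans ?_
  rw [mul_assoc]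
  refine mul_le_mul_of_nonneg_left ?_ hC
  have : 0 ≤ |z| * (YNorm T k (dz T f) t).toReal := by positivity
  have : (0 : ℝ) ≤ C' * M := mul_nonneg hC' M.2
  linarith

/-- Derivatives in `t`, `y₁`, `y₂` are taken along the boundary and preserve a zero trace; the
fourth field carries the factor `φ`, which vanishes there. -/
lemma abs_word_trace_eq_zero {F : smoothAlg T}
    (h : ∀ t ∈ Icc 0 T, ∀ y₁ y₂ : ℝ, F (t, y₁, y₂, 0) = 0) (φ : smoothAlg T)
    (hφ : ∀ t ∈ Icc 0 T, ∀ y₁ y₂ : ℝ, φ (t, y₁, y₂, 0) = 0) (u : List (Fin 4)) :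
    ∀ t ∈ Icc 0 T, ∀ y₁ y₂ : ℝ, word (vectorFields φ) u F (t, y₁, y₂, 0) = 0 := by
  induction u with
  | nil => exact h
  | cons i u ih =>
    intro t ht y₁ y₂
    rw [word_cons, Module.End.mul_apply]
    generalize word (vectorFields φ) u F = g at ih
    fin_cases i
    · have hl : ∀ r : ℝ, ((0, y₁, y₂, 0) : SpaceTime) + r • ((1, 0, 0, 0) : SpaceTime)
          = (r, y₁, y₂, 0) := fun r => by simp
      have hd := hasDerivWithinAt_line (1, 0, 0, 0) g (p := (0, y₁, y₂, 0)) (s := Icc 0 T) (x := t)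
        (fun r hr => by rw [hl]; exact ⟨hr, le_rfl⟩) ht
      simp only [hl] at hd
      have h0 : HasDerivWithinAt (fun r : ℝ => g (r, y₁, y₂, 0)) 0 (Icc 0 T) t :=
        (hasDerivWithinAt_const t _ 0).congr (fun r hr => ih r hr y₁ y₂) (ih t ht y₁ y₂)
      exact (uniqueDiffOn_Icc hT.out t ht).eq_deriv _ hd h0
    · have hl : ∀ r : ℝ, ((t, 0, y₂, 0) : SpaceTime) + r • ((0, 1, 0, 0) : SpaceTime)
          = (t, r, y₂, 0) := fun r => by simp
      have hd := (hasDerivWithinAt_line (0, 1, 0, 0) g (p := (t, 0, y₂, 0)) (s := univ) (x := y₁)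
        (fun r _ => by rw [hl]; exact ⟨ht, le_rfl⟩) (mem_univ _)).hasDerivAt univ_mem
      simp only [hl, ih t ht] at hd
      exact hd.unique (hasDerivAt_const _ _)
    · have hl : ∀ r : ℝ, ((t, y₁, 0, 0) : SpaceTime) + r • ((0, 0, 1, 0) : SpaceTime)
          = (t, y₁, r, 0) := fun r => by simp
      have hd := (hasDerivWithinAt_line (0, 0, 1, 0) g (p := (t, y₁, 0, 0)) (s := univ) (x := y₂)
        (fun r _ => by rw [hl]; exact ⟨ht, le_rfl⟩) (mem_univ _)).hasDerivAt univ_mem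
      simp only [hl, ih t ht] at hd
      exact hd.unique (hasDerivAt_const _ _)
    · simp only [Fin.reduceFinMk, vectorFields_three, mul_apply, hφ t ht, zero_mul]

lemma zc_trace (t : ℝ) (ht : t ∈ Icc 0 T) (y₁ y₂ : ℝ) : (zc : smoothAlg T) (t, y₁, y₂, 0) = 0 :=
  zc_apply ⟨ht, le_rfl⟩

/-- The coefficients at a fixed time: traces bounded by `M`, normal derivatives bounded. -/
lemma exists_coefficient_bounds (R : ℝ) (k : ℕ) :
    ∃ C : ℝ, 0 ≤ C ∧ ∀ (W₁ W₂ W₃ : smoothAlg T) (w₁ w₂ w₃ : SpaceTime → ℝ),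
      EqOn W₁ w₁ (spaceTimeDomain T) → EqOn W₂ w₂ (spaceTimeDomain T) →
      EqOn W₃ w₃ (spaceTimeDomain T) →
      (∀ t ∈ Icc 0 T, ∀ y₁ y₂ : ℝ, W₃ (t, y₁, y₂, 0) = 0) →
      ∀ t ∈ Icc 0 T, ∀ M : ℝ≥0,
      traceYNorm T k w₁ t + traceYNorm T k w₂ t + traceYNorm T k (dz T w₃) t ≤ M →
      ∀ y : ℝ, 0 ≤ y →
      YNorm T k (dz T w₁) t + YNorm T k (dz T w₂) t + YNorm T k (dz T (dz T w₃)) t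
        = ENNReal.ofReal y →
      ∀ y₁ y₂ : ℝ, ∀ z < 0, -R ≤ z →
        derivSize (vectorFields zc) (k + 1) W₁ (t, y₁, y₂, z) ≤ C * (M + |z| * y) ∧
        derivSize (vectorFields zc) (k + 1) W₂ (t, y₁, y₂, z) ≤ C * (M + |z| * y) ∧
        derivSize (vectorFields zc) (k + 1) W₃ (t, y₁, y₂, z) / |z| ≤ C * (M + |z| * y) ∧
        |W₁ (t, y₁, y₂, z) - W₁ (t, y₁, y₂, 0)| ≤ C * (|z| * y) ∧
        |W₂ (t, y₁, y₂, z) - W₂ (t, y₁, y₂, 0)| ≤ C * (|z| * y) := by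
  obtain ⟨C₁, hC₁, h₁⟩ := exists_derivSize_le_trace_add_YNorm (T := T) R k
  obtain ⟨C₂, hC₂, h₂⟩ := exists_derivSize_le_trace_add (T := T) k
  obtain ⟨C₃, hC₃, h₃⟩ := exists_derivSize_le_YNorm_toReal (T := T) R k
  refine ⟨C₁ + C₂ * C₁ + C₃, by positivity, fun W₁ W₂ W₃ w₁ w₂ w₃ e₁ e₂ e₃ htr t ht M hM y hy hY
    y₁ y₂ z hz hzR => ?_⟩
  have hz' : 0 < |z| := abs_pos.2 hz.ne
  have m₁ : traceYNorm T k w₁ t ≤ M := le_self_add.trans (le_self_add.trans hM)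
  have m₂ : traceYNorm T k w₂ t ≤ M := le_add_self.trans (le_self_add.trans hM)
  have m₃ : traceYNorm T k (dz T w₃) t ≤ M := le_add_self.trans hM
  have n₁ : YNorm T k (dz T w₁) t ≤ ENNReal.ofReal y := by
    rw [← hY]; exact le_self_add.trans le_self_add
  have n₂ : YNorm T k (dz T w₂) t ≤ ENNReal.ofReal y := by
    rw [← hY]; exact le_add_self.trans le_self_add
  have n₃ : YNorm T k (dz T (dz T w₃)) t ≤ ENNReal.ofReal y := by
    rw [← hY]; exact le_add_self
  have fin : ∀ {a : ℝ≥0∞}, a ≤ ENNReal.ofReal y → a ≠ ⊤ := fun h => ne_top_of_le_ne_top (by simp) h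
  have real : ∀ {a : ℝ≥0∞}, a ≤ ENNReal.ofReal y → a.toReal ≤ y := fun h =>
    ENNReal.toReal_le_of_le_ofReal hy h
  have hM0 : (0 : ℝ) ≤ M := M.2
  have hzy : 0 ≤ |z| * y := by positivity
  have hS : 0 ≤ M + |z| * y := by positivity
  have j₁ : derivSize (vectorFields zc) (k + 1) W₁ (t, y₁, y₂, z) ≤ C₁ * (M + |z| * y) :=
    (h₁ W₁ w₁ e₁ t ht M m₁ (fin n₁) y₁ y₂ z hz hzR).trans (by gcongr; exact real n₁)
  have j₂ : derivSize (vectorFields zc) (k + 1) W₂ (t, y₁, y₂, z) ≤ C₁ * (M + |z| * y) :=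
    (h₁ W₂ w₂ e₂ t ht M m₂ (fin n₂) y₁ y₂ z hz hzR).trans (by gcongr; exact real n₂)
  -- Two integrations in `z`: `W₃` has zero trace, so it is controlled by `|z|` times `∂_z W₃`,
  -- itself controlled by its trace and `∂_{zz} W₃`. The outer `|z|` pays for the later division.
  have j₃ : derivSize (vectorFields zc) (k + 1) W₃ (t, y₁, y₂, z)
      ≤ C₂ * (0 + |z| * (C₁ * (M + |z| * y))) := by
    refine h₂ W₃ t y₁ y₂ z 0 _ ht hz.le le_rfl (by positivity) (fun u hu _ => ?_) ?_
    · rw [abs_word_trace_eq_zero htr zc zc_trace u t ht, abs_zero]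
    · refine le_on_Icc_of_le_on_Ioo ((continuous_derivSize _ _ _).comp (by fun_prop)) hz
        fun ζ hζ => ?_
      refine (h₁ (pd (0, 0, 0, 1) W₃) (dz T w₃) (pd_apply_of_eqOn _ _ e₃) t ht M m₃ (fin n₃)
        y₁ y₂ ζ hζ.2 (hzR.trans hζ.1.le)).trans ?_
      have hζz : |ζ| ≤ |z| := by
        rw [abs_of_neg hζ.2, abs_of_neg hz]; linarith [hζ.1]
      gcongr
      exact real n₃
  have d : ∀ (W : smoothAlg T) (w : SpaceTime → ℝ), EqOn W w (spaceTimeDomain T) →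
      YNorm T k (dz T w) t ≤ ENNReal.ofReal y →
      |W (t, y₁, y₂, z) - W (t, y₁, y₂, 0)| ≤ C₃ * (|z| * y) := by
    intro W w e n
    refine (abs_sub_trace_le W ht hz.le (B := C₃ * y) fun ζ hζ => ?_).trans (by
      apply le_of_eq; ring)
    refine (abs_le_derivSize (vectorFields zc) k _ _).trans ?_
    refine (h₃ (pd (0, 0, 0, 1) W) (dz T w) (pd_apply_of_eqOn _ _ e) t ht (fin n) y₁ y₂ z hz hzR ζ
      hζ).trans ?_
    gcongr
    exact real n
  have q₁ := mul_nonneg (mul_nonneg hC₂ hC₁) hS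
  have q₂ := mul_nonneg hC₃ hS
  have q₃ := mul_nonneg hC₁ hS
  have q₄ := mul_nonneg (mul_nonneg hC₂ hC₁) hzy
  have q₅ := mul_nonneg hC₁ hzy
  refine ⟨by linarith, by linarith, ?_, ?_, ?_⟩
  · rw [div_le_iff₀ hz']
    refine j₃.trans ?_
    have : C₂ * (0 + |z| * (C₁ * (M + |z| * y))) = C₂ * C₁ * (M + |z| * y) * |z| := by ring
    rw [this]
    exact mul_le_mul_of_nonneg_right (by linarith) hz'.le
  · have := d W₁ w₁ e₁ n₁; linarith
  · have := d W₂ w₂ e₂ n₂; linarith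

/-- The integrand on the right-hand side of the estimate. -/
def sourceNorm (T : ℝ) (k : ℕ) (w₁ w₂ w₃ ρ H : SpaceTime → ℝ) (t : ℝ) : ℝ≥0∞ :=
  (YNorm T k (dz T w₁) t + YNorm T k (dz T w₂) t + YNorm T k (dz T (dz T w₃)) t)
    * XNorm T (k + 3) ρ t + YNorm T k H t

/-- Pointwise bound of the commutator source by `derivSize` and the integrand. -/
lemma exists_source_bounds (R : ℝ) (hR : 0 < R) (k : ℕ) (M : ℝ≥0) :
    ∃ C : ℝ, 0 ≤ C ∧ ∀ (ε : ℝ) (W₁ W₂ W₃ P Q : smoothAlg T) (w₁ w₂ w₃ ρ H : SpaceTime → ℝ),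
      EqOn W₁ w₁ (spaceTimeDomain T) → EqOn W₂ w₂ (spaceTimeDomain T) →
      EqOn W₃ w₃ (spaceTimeDomain T) → EqOn P ρ (spaceTimeDomain T) →
      EqOn Q H (spaceTimeDomain T) →
      (∀ t ∈ Icc 0 T, ∀ y₁ y₂ : ℝ, W₃ (t, y₁, y₂, 0) = 0) →
      VanishesBelow R P → transport ε W₁ W₂ W₃ P = Q →
      ∀ t ∈ Icc 0 T,
      traceYNorm T k w₁ t + traceYNorm T k w₂ t + traceYNorm T k (dz T w₃) t ≤ M →
      sourceNorm T k w₁ w₂ w₃ ρ H t ≠ ⊤ →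
      ∀ y₁ y₂ : ℝ, ∀ z < 0, -(R + 1) ≤ z → ∀ u : List (Fin 4), u.length ≤ k →
        |transport ε W₁ W₂ W₃ (word (vectorFields zc) u P) (t, y₁, y₂, z)|
          ≤ C * (derivSize (vectorFields zc) (k + 1) P (t, y₁, y₂, z)
            + (sourceNorm T k w₁ w₂ w₃ ρ H t).toReal) ∧
        |word (vectorFields zc) u P (t, y₁, y₂, z)|
            * (|W₁ (t, y₁, y₂, z) - W₁ (t, y₁, y₂, 0)|
              + |W₂ (t, y₁, y₂, z) - W₂ (t, y₁, y₂, 0)|)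
          ≤ C * (sourceNorm T k w₁ w₂ w₃ ρ H t).toReal := by
  obtain ⟨C₁, hC₁, h₁⟩ := exists_abs_transport_word_le (T := T) k
  obtain ⟨C₂, hC₂, h₂⟩ := exists_coefficient_bounds (T := T) (R + 1) k
  obtain ⟨C₃, h₃⟩ := exists_abs_mul_derivSize_le_XNorm (T := T) R hR k
  obtain ⟨C₄, _, h₄⟩ := exists_derivSize_le_YNorm (T := T) (R + 1) k
  have hM : (0 : ℝ) ≤ M := M.2
  have hC₃ : (0 : ℝ) ≤ C₃ := C₃.2
  have hC₄ : (0 : ℝ) ≤ C₄ := C₄.2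
  refine ⟨C₁ * (1 + 3 * C₂ * M + 3 * C₂ * C₃ + C₄) + 2 * C₂ * C₃, by positivity,
    fun ε W₁ W₂ W₃ P Q w₁ w₂ w₃ ρ H e₁ e₂ e₃ eP eQ htr hP heq t ht hMt hfin y₁ y₂ z hz hzR u hu => ?_⟩
  have hp : ((t, y₁, y₂, z) : SpaceTime) ∈ strip T (R + 1) := ⟨⟨ht, hz.le⟩, hzR⟩
  have hz' : 0 < |z| := abs_pos.2 hz.ne
  set s := (sourceNorm T k w₁ w₂ w₃ ρ H t).toReal with hs
  have hs0 : 0 ≤ s := ENNReal.toReal_nonneg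
  set J := derivSize (vectorFields zc) (k + 1) P (t, y₁, y₂, z) with hJ
  have hJ0 : 0 ≤ J := derivSize_nonneg _ _ _ _
  have hword : |word (vectorFields zc) u P (t, y₁, y₂, z)| ≤ J :=
    abs_word_le _ (Nat.lt_succ_of_le hu) _ _
  have key := h₁ u hu ε W₁ W₂ W₃ P Q heq (t, y₁, y₂, z) hp.1 hz
  have hfin' := hfin
  rw [sourceNorm, ENNReal.add_ne_top] at hfin'
  -- the contribution of the source term
  have hQ : derivSize (vectorFields zc) (k + 1) Q (t, y₁, y₂, z) ≤ C₄ * s := by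
    have q1 := h₄ Q H eQ (t, y₁, y₂, z) hp hz
    have q2 := (ENNReal.ofReal_le_iff_le_toReal (ENNReal.mul_ne_top (by simp) hfin'.2)).1 q1
    rw [ENNReal.toReal_mul, ENNReal.coe_toReal] at q2
    refine q2.trans (mul_le_mul_of_nonneg_left ?_ hC₄)
    exact ENNReal.toReal_mono hfin le_add_self
  have hX := h₃ P ρ eP hP (t, y₁, y₂, z) hp hz
  simp only at hX key
  set Y := YNorm T k (dz T w₁) t + YNorm T k (dz T w₂) t + YNorm T k (dz T (dz T w₃)) t with hY
  -- The integrand is finite, so an infinite coefficient norm forces `XNorm` to be zero. The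
  -- weighted Sobolev bound then makes `J` vanish at this point, and only the source `H` is left.
  rcases eq_or_ne Y ⊤ with htop | hYfin
  · have hX0 : XNorm T (k + 3) ρ t = 0 := by
      by_contra hne
      exact hfin'.1 (by rw [htop, ENNReal.top_mul hne])
    rw [hX0, mul_zero, nonpos_iff_eq_zero, ENNReal.ofReal_eq_zero] at hX
    have hJ' : J = 0 := by
      have h0 : |z| * J = 0 := le_antisymm hX (by positivity)
      exact (mul_eq_zero.1 h0).resolve_left hz'.ne'
    rw [← hJ, hJ', mul_zero, zero_add] at key
    have hw0 : |word (vectorFields zc) u P (t, y₁, y₂, z)| = 0 :=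
      le_antisymm (hJ' ▸ hword) (abs_nonneg _)
    rw [hJ', hw0, zero_add, zero_mul]
    refine ⟨?_, by positivity⟩
    refine key.trans ((mul_le_mul_of_nonneg_left hQ hC₁).trans ?_)
    rw [← mul_assoc]
    refine mul_le_mul_of_nonneg_right ?_ hs0
    have : 0 ≤ C₁ * (1 + 3 * C₂ * M + 3 * C₂ * C₃) + 2 * C₂ * C₃ := by positivity
    linarith
  · set y := Y.toReal with hy
    have hy0 : 0 ≤ y := ENNReal.toReal_nonneg
    obtain ⟨b₁, b₂, b₃, d₁, d₂⟩ := h₂ W₁ W₂ W₃ w₁ w₂ w₃ e₁ e₂ e₃ htr t ht M hMt y hy0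
      (ENNReal.ofReal_toReal hYfin).symm y₁ y₂ z hz hzR
    -- The part of the coefficients growing with `|z|` is absorbed here: its weight is exactly the
    -- one that the Sobolev bound requires.
    have hyJ : |z| * y * J ≤ C₃ * s := by
      have q1 : ENNReal.ofReal (y * (|z| * J)) ≤ C₃ * (Y * XNorm T (k + 3) ρ t) := by
        rw [ENNReal.ofReal_mul hy0, ENNReal.ofReal_toReal hYfin, mul_left_comm]
        gcongr
      have q2 := (ENNReal.ofReal_le_iff_le_toReal (ENNReal.mul_ne_top (by simp) hfin'.1)).1 q1
      rw [ENNReal.toReal_mul, ENNReal.coe_toReal] at q2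
      have q3 : (Y * XNorm T (k + 3) ρ t).toReal ≤ s := ENNReal.toReal_mono hfin le_self_add
      have q4 := mul_le_mul_of_nonneg_left q3 hC₃
      linarith
    constructor
    · refine key.trans ?_
      set j₁ := derivSize (vectorFields zc) (k + 1) W₁ (t, y₁, y₂, z)
      set j₂ := derivSize (vectorFields zc) (k + 1) W₂ (t, y₁, y₂, z)
      set j₃ := derivSize (vectorFields zc) (k + 1) W₃ (t, y₁, y₂, z) / |z|
      have f₁ : (1 + j₁ + j₂ + j₃) * J ≤ (1 + 3 * (C₂ * (M + |z| * y))) * J :=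
        mul_le_mul_of_nonneg_right (by linarith) hJ0
      have f₂ : (1 + 3 * (C₂ * (M + |z| * y))) * J
          = (1 + 3 * C₂ * M) * J + 3 * C₂ * (|z| * y * J) := by ring
      have f₃ : 3 * C₂ * (|z| * y * J) ≤ 3 * C₂ * (C₃ * s) :=
        mul_le_mul_of_nonneg_left hyJ (by positivity)
      have f₄ : (1 + j₁ + j₂ + j₃) * J + derivSize (vectorFields zc) (k + 1) Q (t, y₁, y₂, z)
          ≤ (1 + 3 * C₂ * M + 3 * C₂ * C₃ + C₄) * (J + s) := by
        have g₁ : 0 ≤ (3 * C₂ * C₃ + C₄) * J := by positivity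
        have g₂ : 0 ≤ (1 + 3 * C₂ * M) * s := by positivity
        linarith
      refine (mul_le_mul_of_nonneg_left f₄ hC₁).trans ?_
      rw [← mul_assoc]
      refine mul_le_mul_of_nonneg_right ?_ (by positivity)
      have : 0 ≤ 2 * C₂ * C₃ := by positivity
      linarith
    · calc _ ≤ J * (C₂ * (|z| * y) + C₂ * (|z| * y)) := by gcongr
        _ = 2 * C₂ * (|z| * y * J) := by ring
        _ ≤ 2 * C₂ * (C₃ * s) := mul_le_mul_of_nonneg_left hyJ (by positivity)
        _ ≤ _ := by
          have : 0 ≤ C₁ * (1 + 3 * C₂ * M + 3 * C₂ * C₃ + C₄) * s := by positivity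
          linarith

/-! ### The localized estimate -/

/-- The source of the equation satisfied by `χ v`, without the part of favourable sign. -/
def cutoffSource (ε : ℝ) (W₁ W₂ W₃ χ v : smoothAlg T) (p : SpaceTime) : ℝ :=
  χ p * transport ε W₁ W₂ W₃ v p
    + v p * ((W₁ p - W₁ (p.1, p.2.1, p.2.2.1, 0)) * pd (0, 1, 0, 0) χ p
      + (W₂ p - W₂ (p.1, p.2.1, p.2.2.1, 0)) * pd (0, 0, 1, 0) χ p)

lemma continuous_cutoffSource (ε : ℝ) (W₁ W₂ W₃ χ v : smoothAlg T) :
    Continuous (cutoffSource ε W₁ W₂ W₃ χ v) := by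
  have htr : ∀ W : smoothAlg T, Continuous fun p : SpaceTime => W (p.1, p.2.1, p.2.2.1, 0) :=
    fun W => (continuous_coe W).comp (by fun_prop)
  exact ((continuous_coe χ).mul (continuous_coe _)).add ((continuous_coe v).mul
    ((((continuous_coe W₁).sub (htr W₁)).mul (continuous_coe _)).add
      (((continuous_coe W₂).sub (htr W₂)).mul (continuous_coe _))))

lemma transport_apply (ε : ℝ) (W₁ W₂ W₃ v : smoothAlg T) (p : SpaceTime) :
    transport ε W₁ W₂ W₃ v p = pd (1, 0, 0, 0) v p + W₁ p * pd (0, 1, 0, 0) v p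
      + W₂ p * pd (0, 0, 1, 0) v p + W₃ p * pd (0, 0, 0, 1) v p
      - ε * pd (0, 0, 0, 1) (pd (0, 0, 0, 1) v) p := rfl

lemma transport_smul_apply (ε c : ℝ) (W₁ W₂ W₃ v : smoothAlg T) (p : SpaceTime) :
    transport ε W₁ W₂ W₃ (c • v) p = c * transport ε W₁ W₂ W₃ v p := by
  simp only [transport_apply, pd_smul, smul_apply]
  ring

/-- As `χ` does not depend on `z`, diffusion creates no cross term. The velocity acting on `χ` is
split at its boundary value, the part for which the cutoff has a sign. -/
lemma transport_mul_apply (ε : ℝ) (W₁ W₂ W₃ v : smoothAlg T) {χ : smoothAlg T}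
    (hχ : pd (0, 0, 0, 1) χ = 0) (p : SpaceTime) :
    transport ε W₁ W₂ W₃ (χ * v) p = cutoffSource ε W₁ W₂ W₃ χ v p
      + v p * (pd (1, 0, 0, 0) χ p + W₁ (p.1, p.2.1, p.2.2.1, 0) * pd (0, 1, 0, 0) χ p
        + W₂ (p.1, p.2.1, p.2.2.1, 0) * pd (0, 0, 1, 0) χ p) := by
  simp only [transport_apply, cutoffSource, pd_mul, hχ, zero_mul, zero_add, add_apply, mul_apply]
  ring

/-- The maximum principle is applied to `χ v` and `-χ v`. Where the product is positive, the
derivative of `χ` along the boundary velocity contributes a nonpositive term, which is dropped. The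
product vanishes on the lateral faces because of `χ`, at the top by the zero trace of `v`, and at
the bottom because `-(R + 1) < -R`. -/
lemma abs_cutoff_mul_le {ε : ℝ} (hε : 0 < ε) (W₁ W₂ W₃ χ v : smoothAlg T)
    {R M a₁ a₂ B : ℝ}
    (hχ0 : ∀ p ∈ spaceTimeDomain T, 0 ≤ χ p) (hχz : pd (0, 0, 0, 1) χ = 0)
    (hχt : ∀ p ∈ spaceTimeDomain T, ∀ b₁ b₂ : ℝ, |b₁| + |b₂| ≤ M →
      pd (1, 0, 0, 0) χ p + b₁ * pd (0, 1, 0, 0) χ p + b₂ * pd (0, 0, 1, 0) χ p ≤ 0)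
    (hχs : ∀ p ∈ spaceTimeDomain T, 2 + M * T ≤ |p.2.1 - a₁| ∨ 2 + M * T ≤ |p.2.2.1 - a₂| →
      χ p = 0)
    (htr : ∀ t ∈ Icc 0 T, ∀ y₁ y₂ : ℝ, |W₁ (t, y₁, y₂, 0)| + |W₂ (t, y₁, y₂, 0)| ≤ M)
    (hv : VanishesBelow R v) (hv0 : ∀ t ∈ Icc 0 T, ∀ y₁ y₂ : ℝ, v (t, y₁, y₂, 0) = 0)
    {G : ℝ → ℝ} (hG : Continuous G) (hG0 : ∀ t, 0 ≤ G t) (hB : 0 ≤ B)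
    (hsrc : ∀ t ∈ Icc 0 T, ∀ y₁ ∈ Icc (a₁ - (2 + M * T)) (a₁ + (2 + M * T)),
      ∀ y₂ ∈ Icc (a₂ - (2 + M * T)) (a₂ + (2 + M * T)), ∀ z ∈ Icc (-(R + 1)) 0,
      |cutoffSource ε W₁ W₂ W₃ χ v (t, y₁, y₂, z)| ≤ G t)
    (hinit : ∀ y₁ ∈ Icc (a₁ - (2 + M * T)) (a₁ + (2 + M * T)),
      ∀ y₂ ∈ Icc (a₂ - (2 + M * T)) (a₂ + (2 + M * T)), ∀ z ∈ Icc (-(R + 1)) 0,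
      χ (0, y₁, y₂, z) * |v (0, y₁, y₂, z)| ≤ B)
    {t y₁ y₂ z : ℝ} (ht : t ∈ Icc 0 T) (hy₁ : y₁ ∈ Icc (a₁ - (2 + M * T)) (a₁ + (2 + M * T)))
    (hy₂ : y₂ ∈ Icc (a₂ - (2 + M * T)) (a₂ + (2 + M * T))) (hz : z ∈ Icc (-(R + 1)) 0) :
    χ (t, y₁, y₂, z) * |v (t, y₁, y₂, z)| ≤ B + ∫ τ in (0 : ℝ)..t, G τ := by
  have h0T : (0 : ℝ) ∈ Icc 0 T := ⟨le_rfl, hT.out.le⟩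
  have signed : ∀ c : ℝ, |c| = 1 →
      c * (χ (t, y₁, y₂, z) * v (t, y₁, y₂, z)) ≤ B + ∫ τ in (0 : ℝ)..t, G τ := by
    intro c hc
    have hV : ∀ p, (χ * (c • v) : smoothAlg T) p = χ p * (c * v p) := fun p => rfl
    have := le_add_integral_of_transport_le hε W₁ W₂ W₃ (χ * (c • v)) hG hG0 hB
      (l₁ := a₁ - (2 + M * T)) (r₁ := a₁ + (2 + M * T)) (l₂ := a₂ - (2 + M * T))
      (r₂ := a₂ + (2 + M * T)) (Z := R + 1) ?_ ?_ ?_ ht hy₁ hy₂ hz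
    · rw [hV] at this
      linarith
    · intro s hs x₁ hx₁ x₂ hx₂ ζ hζ hb
      have hp : ((s, x₁, x₂, ζ) : SpaceTime) ∈ spaceTimeDomain T := ⟨hs, hζ.2⟩
      refine le_of_eq ?_
      rw [hV]
      rcases hb with rfl | rfl | rfl | rfl | rfl | rfl
      · rw [hχs _ hp (Or.inl (by rw [sub_sub_cancel_left, abs_neg]; exact le_abs_self _)), zero_mul]
      · rw [hχs _ hp (Or.inl (by rw [add_sub_cancel_left]; exact le_abs_self _)), zero_mul]
      · rw [hχs _ hp (Or.inr (by rw [sub_sub_cancel_left, abs_neg]; exact le_abs_self _)), zero_mul]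
      · rw [hχs _ hp (Or.inr (by rw [add_sub_cancel_left]; exact le_abs_self _)), zero_mul]
      · rw [hv _ hp (by simp), mul_zero, mul_zero]
      · rw [hv0 s hs, mul_zero, mul_zero]
    · intro x₁ hx₁ x₂ hx₂ ζ hζ
      refine le_trans ?_ (hinit x₁ hx₁ x₂ hx₂ ζ hζ)
      rw [hV]
      refine mul_le_mul_of_nonneg_left ?_ (hχ0 _ ⟨h0T, hζ.2⟩)
      refine (le_abs_self _).trans ?_
      rw [abs_mul, hc, one_mul]
    · intro s hs x₁ hx₁ x₂ hx₂ ζ hζ hpos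
      have hp : ((s, x₁, x₂, ζ) : SpaceTime) ∈ spaceTimeDomain T := ⟨hs, hζ.2.le⟩
      rw [hV] at hpos
      have hvpos : 0 ≤ c * v (s, x₁, x₂, ζ) := by
        by_contra! hneg
        exact absurd hpos (not_lt.2 (mul_nonpos_of_nonneg_of_nonpos (hχ0 _ hp) hneg.le))
      rw [transport_mul_apply _ _ _ _ _ hχz]
      have h1 : cutoffSource ε W₁ W₂ W₃ χ (c • v) (s, x₁, x₂, ζ)
          = c * cutoffSource ε W₁ W₂ W₃ χ v (s, x₁, x₂, ζ) := by
        simp only [cutoffSource, transport_smul_apply, smul_apply]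
        ring
      have h2 := hsrc s hs x₁ (Ioo_subset_Icc_self hx₁) x₂ (Ioo_subset_Icc_self hx₂) ζ
        (Ioo_subset_Icc_self hζ)
      have h3 : c * cutoffSource ε W₁ W₂ W₃ χ v (s, x₁, x₂, ζ) ≤ G s := by
        refine (le_abs_self _).trans ?_
        rwa [abs_mul, hc, one_mul]
      have h4 := mul_nonpos_of_nonneg_of_nonpos hvpos (hχt _ hp _ _ (htr s hs x₁ x₂))
      rw [h1, smul_apply]
      simp only
      linarith
  have hχp : 0 ≤ χ (t, y₁, y₂, z) := hχ0 _ ⟨ht, hz.2⟩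
  rw [← abs_of_nonneg hχp, ← abs_mul, abs_le']
  exact ⟨by simpa using signed 1 (by simp), by simpa using signed (-1) (by simp)⟩

/-- Differential Grönwall for the primitive of `N`, whose derivative is `N`, followed by
substitution into the hypothesis. -/
lemma le_exp_of_le_integral {N : ℝ → ℝ} (hN : Continuous N) (hN0 : ∀ s, 0 ≤ N s) {A c t : ℝ}
    (hc : 0 < c) (ht : 0 ≤ t)
    (h : ∀ s ∈ Icc 0 t, N s ≤ A + c * ∫ τ in (0 : ℝ)..s, N τ) : N t ≤ A * Real.exp (c * t) := by
  have hI : ∀ s, 0 ≤ s → 0 ≤ ∫ τ in (0 : ℝ)..s, N τ := fun s hs =>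
    intervalIntegral.integral_nonneg hs fun r _ => hN0 r
  have hd : ∀ s, HasDerivAt (fun s => ∫ τ in (0 : ℝ)..s, N τ) (N s) s := fun s =>
    (hN.integral_hasStrictDerivAt 0 s).hasDerivAt
  have key := norm_le_gronwallBound_of_norm_deriv_right_le
    (f := fun s => ∫ τ in (0 : ℝ)..s, N τ) (f' := N) (δ := 0) (K := c) (ε := A) (a := 0) (b := t)
    (fun s _ => (hd s).continuousAt.continuousWithinAt) (fun s _ => (hd s).hasDerivWithinAt)
    (by simp)
    (fun s hs => by
      rw [Real.norm_of_nonneg (hN0 s), Real.norm_of_nonneg (hI s hs.1)]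
      linarith [h s ⟨hs.1, hs.2.le⟩])
    t ⟨ht, le_rfl⟩
  rw [Real.norm_of_nonneg (hI t ht), gronwallBound_of_K_ne_0 hc.ne', sub_zero] at key
  simp only [zero_mul, zero_add] at key
  have h1 := h t ⟨ht, le_rfl⟩
  have h2 := mul_le_mul_of_nonneg_left key hc.le
  have h3 : c * (A / c * (Real.exp (c * t) - 1)) = A * Real.exp (c * t) - A := by
    field_simp
  linarith

/-- The supremum over a set of space variables at a given time. -/
def supOn (K : Set (ℝ × ℝ × ℝ)) (h : SpaceTime → ℝ) (t : ℝ) : ℝ :=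
  sSup ((fun x => h (t, x)) '' K)

lemma continuous_supOn {K : Set (ℝ × ℝ × ℝ)} (hK : IsCompact K) {h : SpaceTime → ℝ}
    (hc : Continuous h) : Continuous (supOn K h) :=
  hK.continuous_sSup (f := fun t x => h (t, x)) hc

lemma le_supOn {K : Set (ℝ × ℝ × ℝ)} (hK : IsCompact K) {h : SpaceTime → ℝ}
    (hc : Continuous h) (t : ℝ) {x : ℝ × ℝ × ℝ} (hx : x ∈ K) : h (t, x) ≤ supOn K h t :=
  le_csSup (hK.image (f := fun x => h (t, x)) (hc.comp (by fun_prop))).bddAbove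
    (mem_image_of_mem _ hx)

lemma supOn_le {K : Set (ℝ × ℝ × ℝ)} (hK : K.Nonempty) {h : SpaceTime → ℝ} {t B : ℝ}
    (hB : ∀ x ∈ K, h (t, x) ≤ B) : supOn K h t ≤ B :=
  csSup_le (hK.image _) fun _ ⟨x, hx, e⟩ => e ▸ hB x hx

lemma supOn_nonneg {K : Set (ℝ × ℝ × ℝ)} {h : SpaceTime → ℝ} (hh : ∀ p, 0 ≤ h p) (t : ℝ) :
    0 ≤ supOn K h t :=
  Real.sSup_nonneg fun _ ⟨_, _, e⟩ => e ▸ hh _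

/-- Integrating a pointwise bound by an extended real function that need not be measurable. -/
lemma integral_le_of_le_toReal {G N : ℝ → ℝ} {S : ℝ → ℝ≥0∞} (hG : Continuous G)
    (hG0 : ∀ s, 0 ≤ G s) (hN : Continuous N) (hN0 : ∀ s, 0 ≤ N s) {c t s : ℝ} (hc : 0 < c)
    (hs : 0 ≤ s) (hst : s ≤ t) (h : ∀ τ ∈ Icc 0 t, S τ ≠ ⊤ → G τ ≤ c * (N τ + (S τ).toReal))
    (hfin : ∫⁻ τ in Icc 0 t, S τ ≠ ⊤) :
    ∫ τ in (0 : ℝ)..s, G τ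
      ≤ c * (∫ τ in (0 : ℝ)..s, N τ) + c * (∫⁻ τ in Icc 0 t, S τ).toReal := by
  have conv : ∀ F : ℝ → ℝ, Continuous F → (∀ r, 0 ≤ F r) →
      ENNReal.ofReal (∫ τ in (0 : ℝ)..s, F τ) = ∫⁻ τ in Ioc 0 s, ENNReal.ofReal (F τ) := by
    intro F hF hF0
    rw [intervalIntegral.integral_of_le hs]
    exact ofReal_integral_eq_lintegral_ofReal
      ((hF.continuousOn.integrableOn_Icc (a := 0) (b := s)).mono_set Ioc_subset_Icc_self)
      (ae_of_all _ hF0)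
  have hIN : 0 ≤ ∫ τ in (0 : ℝ)..s, N τ :=
    intervalIntegral.integral_nonneg hs fun r _ => hN0 r
  have key : ENNReal.ofReal (∫ τ in (0 : ℝ)..s, G τ) ≤ ENNReal.ofReal
      (c * (∫ τ in (0 : ℝ)..s, N τ) + c * (∫⁻ τ in Icc 0 t, S τ).toReal) := by
    rw [ENNReal.ofReal_add (by positivity) (by positivity), ENNReal.ofReal_mul hc.le,
      ENNReal.ofReal_mul hc.le, ENNReal.ofReal_toReal hfin, conv G hG hG0, conv N hN hN0]
    calc ∫⁻ τ in Ioc 0 s, ENNReal.ofReal (G τ)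
        ≤ ∫⁻ τ in Ioc 0 s, (ENNReal.ofReal c * ENNReal.ofReal (N τ) + ENNReal.ofReal c * S τ) := by
          refine setLIntegral_mono' measurableSet_Ioc fun τ hτ => ?_
          -- In extended reals the bound is trivial where `S` is infinite, so no almost-everywhere
          -- finiteness of `S` is needed.
          rcases eq_or_ne (S τ) ⊤ with htop | hS
          · rw [htop, ENNReal.mul_top (by simpa using hc), add_top]
            exact le_top
          · rw [← mul_add, ← ENNReal.ofReal_toReal hS,
              ← ENNReal.ofReal_add (hN0 _) ENNReal.toReal_nonneg, ← ENNReal.ofReal_mul hc.le]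
            exact ENNReal.ofReal_le_ofReal (h τ ⟨hτ.1.le, hτ.2.trans hst⟩ hS)
      _ ≤ _ := by
          have hm : Measurable fun τ => ENNReal.ofReal c * ENNReal.ofReal (N τ) :=
            (ENNReal.continuous_ofReal.comp hN).measurable.const_mul _
          -- Splitting the integral requires measurability of one summand only, and the term with
          -- the continuous `N` provides it.
          rw [lintegral_add_left hm,
            lintegral_const_mul' _ _ (by simp), lintegral_const_mul' _ _ (by simp)]
          gcongr
          exact fun τ hτ => ⟨hτ.1.le, hτ.2.trans hst⟩
  exact (ENNReal.ofReal_le_ofReal_iff (by positivity)).1 key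

/-- The estimate at one point, in terms of `derivSize`. -/
lemma exists_derivSize_estimate (R : ℝ) (hR : 0 < R) (k : ℕ) (M : ℝ≥0) :
    ∃ C : ℝ, 0 ≤ C ∧ ∀ ε : ℝ, 0 < ε →
      ∀ (W₁ W₂ W₃ P Q : smoothAlg T) (w₁ w₂ w₃ ρ H : SpaceTime → ℝ),
      EqOn W₁ w₁ (spaceTimeDomain T) → EqOn W₂ w₂ (spaceTimeDomain T) →
      EqOn W₃ w₃ (spaceTimeDomain T) → EqOn P ρ (spaceTimeDomain T) →
      EqOn Q H (spaceTimeDomain T) →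
      (∀ t ∈ Icc 0 T, ∀ y₁ y₂ : ℝ, W₃ (t, y₁, y₂, 0) = 0) →
      (∀ t ∈ Icc 0 T, ∀ y₁ y₂ : ℝ, P (t, y₁, y₂, 0) = 0) →
      VanishesBelow R P → transport ε W₁ W₂ W₃ P = Q →
      (∀ t ∈ Icc 0 T,
        traceYNorm T k w₁ t + traceYNorm T k w₂ t + traceYNorm T k (dz T w₃) t ≤ M) →
      ∀ t ∈ Icc 0 T, YNorm T k ρ 0 ≠ ⊤ →
      ∫⁻ τ in Icc 0 t, sourceNorm T k w₁ w₂ w₃ ρ H τ ≠ ⊤ →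
      ∀ a₁ a₂ : ℝ, ∀ z ∈ Icc (-(R + 1)) 0,
        derivSize (vectorFields zc) (k + 1) P (t, a₁, a₂, z)
          ≤ C * ((YNorm T k ρ 0).toReal
            + (∫⁻ τ in Icc 0 t, sourceNorm T k w₁ w₂ w₃ ρ H τ).toReal) := by
  obtain ⟨C₁, hC₁, h₁⟩ := exists_source_bounds (T := T) R hR k M
  obtain ⟨C₂, hC₂, h₂⟩ := exists_cutoff (T := T)
  obtain ⟨C₃, hC₃, h₃⟩ := derivSize_le_of_words (vectorFields (zc : smoothAlg T)) (k + 1)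
  obtain ⟨C₅, hC₅, h₅⟩ := exists_derivSize_le_YNorm_toReal (T := T) (R + 1) k
  -- `C₁` comes from the differentiated equation and `C₁ * C₂` from the gradient of the cutoff; the
  -- `1` ensures positivity, as in `K`.
  set c := C₁ * (1 + C₂) + 1 with hc
  have hcpos : 0 < c := by positivity
  set K := C₃ * c + 1 with hK
  have hKpos : 0 < K := by positivity
  refine ⟨C₃ * (C₅ + c) * Real.exp (K * T), by positivity, fun ε hε W₁ W₂ W₃ P Q w₁ w₂ w₃ ρ H
    e₁ e₂ e₃ eP eQ htr hP0 hP heq hMt t ht hA hI a₁ a₂ z hz => ?_⟩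
  have hM : (0 : ℝ) ≤ M := M.2
  have hT0 : 0 ≤ T := hT.out.le
  have h0T : (0 : ℝ) ∈ Icc 0 T := ⟨le_rfl, hT0⟩
  obtain ⟨χ, hχ01, hχ1, hχz, hχy, hχt, hχs⟩ := h₂ M hM t ht a₁ a₂
  set X := vectorFields (zc : smoothAlg T) with hX
  set S := sourceNorm T k w₁ w₂ w₃ ρ H with hS
  set I := (∫⁻ τ in Icc 0 t, S τ).toReal with hIdef
  have hI0 : 0 ≤ I := ENNReal.toReal_nonneg
  set A := (YNorm T k ρ 0).toReal with hAdef
  have hA0 : 0 ≤ A := ENNReal.toReal_nonneg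
  have hr : 0 ≤ 2 + M * T := by positivity
  set B : Set (ℝ × ℝ × ℝ) := Icc (a₁ - (2 + M * T)) (a₁ + (2 + M * T)) ×ˢ
    (Icc (a₂ - (2 + M * T)) (a₂ + (2 + M * T)) ×ˢ Icc (-(R + 1)) 0) with hB
  have hBc : IsCompact B := isCompact_Icc.prod (isCompact_Icc.prod isCompact_Icc)
  have hzB : (a₁, a₂, z) ∈ B :=
    ⟨⟨by linarith, by linarith⟩, ⟨by linarith, by linarith⟩, hz⟩
  have hBn : B.Nonempty := ⟨_, hzB⟩
  -- the size of the solution over the box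
  set n : SpaceTime → ℝ := fun p => |χ p| * derivSize X (k + 1) P p with hn
  have hnc : Continuous n := (continuous_coe χ).abs.mul (continuous_derivSize _ _ _)
  have hn0 : ∀ p, 0 ≤ n p := fun p => mul_nonneg (abs_nonneg _) (derivSize_nonneg _ _ _ _)
  set N := supOn B n with hN
  have hNc : Continuous N := continuous_supOn hBc hnc
  have hN0 : ∀ s, 0 ≤ N s := supOn_nonneg hn0
  have hnN : ∀ s, ∀ x ∈ B, n (s, x) ≤ N s := fun s x hx => le_supOn hBc hnc s hx
  have htrace : ∀ s ∈ Icc 0 T, ∀ y₁ y₂ : ℝ,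
      |W₁ (s, y₁, y₂, 0)| + |W₂ (s, y₁, y₂, 0)| ≤ M := by
    intro s hs y₁ y₂
    have q₁ := ofReal_abs_word_le_traceYNorm e₁ (k := k) (u := []) (by simp) (by simp) hs y₁ y₂
    have q₂ := ofReal_abs_word_le_traceYNorm e₂ (k := k) (u := []) (by simp) (by simp) hs y₁ y₂
    have q₃ := (add_le_add q₁ q₂).trans (le_self_add.trans (hMt s hs))
    rw [← ENNReal.ofReal_add (abs_nonneg _) (abs_nonneg _),
      ENNReal.ofReal_le_iff_le_toReal (by simp), ENNReal.coe_toReal] at q₃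
    exact q₃
  -- the bound for each word
  have hword : ∀ u : List (Fin 4), u.length ≤ k → ∀ s ∈ Icc 0 t, ∀ x ∈ B,
      |χ (s, x)| * |word X u P (s, x)| ≤ N 0 + (c * (∫ τ in (0 : ℝ)..s, N τ) + c * I) := by
    intro u hu s hs x hx
    set g : SpaceTime → ℝ := fun p => |cutoffSource ε W₁ W₂ W₃ χ (word X u P) p| with hg
    have hgc : Continuous g := (continuous_cutoffSource _ _ _ _ _ _).abs
    set G := supOn B g with hG
    have hGc : Continuous G := continuous_supOn hBc hgc
    have hG0 : ∀ s, 0 ≤ G s := supOn_nonneg fun p => abs_nonneg _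
    -- The inequality closes with the weighted quantity `N` because `derivSize` of `P` appears only
    -- multiplied by `χ`. The term with derivatives of `χ`, where that factor is missing, is bounded
    -- by `S` alone.
    have hGS : ∀ τ ∈ Icc 0 t, S τ ≠ ⊤ → G τ ≤ c * (N τ + (S τ).toReal) := by
      intro τ hτ hSτ
      have hτT : τ ∈ Icc 0 T := ⟨hτ.1, hτ.2.trans ht.2⟩
      have hs0 : 0 ≤ (S τ).toReal := ENNReal.toReal_nonneg
      refine supOn_le hBn ?_
      rintro ⟨y₁, y₂, ζ⟩ ⟨hy₁, hy₂, hζ⟩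
      refine le_on_Icc_of_le_on_Ioo (h := fun ζ => g (τ, y₁, y₂, ζ)) (hgc.comp (by fun_prop))
        (by linarith : -(R + 1) < 0) (fun ζ hζ => ?_) ζ hζ
      obtain ⟨b₁, b₂⟩ := h₁ ε W₁ W₂ W₃ P Q w₁ w₂ w₃ ρ H e₁ e₂ e₃ eP eQ htr hP heq τ hτT
        (hMt τ hτT) hSτ y₁ y₂ ζ hζ.2 hζ.1.le u hu
      have hp : ((τ, y₁, y₂, ζ) : SpaceTime) ∈ spaceTimeDomain T := ⟨hτT, hζ.2.le⟩
      have hxN := hnN τ (y₁, y₂, ζ) ⟨hy₁, hy₂, Ioo_subset_Icc_self hζ⟩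
      obtain ⟨c₁, c₂⟩ := hχy _ hp
      obtain ⟨c₃, c₄⟩ := hχ01 _ hp
      simp only [hg, cutoffSource]
      simp only [hn, abs_of_nonneg c₃] at hxN
      refine (abs_add_le _ _).trans ?_
      rw [abs_mul, abs_mul, abs_of_nonneg c₃]
      have f₁ : χ (τ, y₁, y₂, ζ) * |transport ε W₁ W₂ W₃ (word X u P) (τ, y₁, y₂, ζ)|
          ≤ C₁ * N τ + C₁ * (S τ).toReal := by
        refine (mul_le_mul_of_nonneg_left b₁ c₃).trans ?_
        have g₁ := mul_le_mul_of_nonneg_left hxN hC₁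
        have g₂ : χ (τ, y₁, y₂, ζ) * (C₁ * (S τ).toReal) ≤ 1 * (C₁ * (S τ).toReal) :=
          mul_le_mul_of_nonneg_right c₄ (by positivity)
        linarith
      have f₂ : |(W₁ (τ, y₁, y₂, ζ) - W₁ (τ, y₁, y₂, 0)) * pd (0, 1, 0, 0) χ (τ, y₁, y₂, ζ)
          + (W₂ (τ, y₁, y₂, ζ) - W₂ (τ, y₁, y₂, 0)) * pd (0, 0, 1, 0) χ (τ, y₁, y₂, ζ)|
          ≤ C₂ * (|W₁ (τ, y₁, y₂, ζ) - W₁ (τ, y₁, y₂, 0)|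
            + |W₂ (τ, y₁, y₂, ζ) - W₂ (τ, y₁, y₂, 0)|) := by
        refine (abs_add_le _ _).trans ?_
        rw [abs_mul, abs_mul, mul_add, mul_comm C₂, mul_comm C₂]
        gcongr
      have f₃ := mul_le_mul_of_nonneg_left f₂ (abs_nonneg (word X u P (τ, y₁, y₂, ζ)))
      have f₄ := mul_le_mul_of_nonneg_left b₂ hC₂
      have f₅ : 0 ≤ C₁ * C₂ * N τ := mul_nonneg (mul_nonneg hC₁ hC₂) (hN0 τ)
      have f₆ := hN0 τ
      rw [hc]
      linarith
    have key := abs_cutoff_mul_le hε W₁ W₂ W₃ χ (word X u P) (R := R) (M := M) (a₁ := a₁)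
      (a₂ := a₂) (B := N 0) (fun p hp => (hχ01 p hp).1) hχz hχt hχs htrace (hP.word zc u)
      (abs_word_trace_eq_zero hP0 zc zc_trace u) hGc hG0 (hN0 0)
      (fun τ hτ y₁ hy₁ y₂ hy₂ ζ hζ => le_supOn hBc hgc τ (x := (y₁, y₂, ζ)) ⟨hy₁, hy₂, hζ⟩)
      (fun y₁ hy₁ y₂ hy₂ ζ hζ => by
        refine le_trans ?_ (hnN 0 (y₁, y₂, ζ) ⟨hy₁, hy₂, hζ⟩)
        exact mul_le_mul (le_abs_self _) (abs_word_le X (Nat.lt_succ_of_le hu) P _)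
          (abs_nonneg _) (abs_nonneg _))
      (t := s) ⟨hs.1, hs.2.trans ht.2⟩ hx.1 hx.2.1 hx.2.2
    rw [abs_of_nonneg (hχ01 (s, x) ⟨⟨hs.1, hs.2.trans ht.2⟩, hx.2.2.2⟩).1]
    refine key.trans (add_le_add_right ?_ _)
    exact integral_le_of_le_toReal hGc hG0 hNc hN0 hcpos hs.1 hs.2 hGS hI
  -- the integral inequality
  have hineq : ∀ s ∈ Icc 0 t, N s ≤ C₃ * (N 0 + c * I) + K * ∫ τ in (0 : ℝ)..s, N τ := by
    intro s hs
    have hint : 0 ≤ ∫ τ in (0 : ℝ)..s, N τ :=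
      intervalIntegral.integral_nonneg hs.1 fun r _ => hN0 r
    refine supOn_le hBn fun x hx => ?_
    have hb : n (s, x) ≤ C₃ * (N 0 + (c * (∫ τ in (0 : ℝ)..s, N τ) + c * I)) := by
      simp only [hn]
      -- The bounds on `|χ|` times each word are divided by `|χ|` in order to sum over words, so the
      -- zeros of `χ` are set apart.
      rcases (abs_nonneg (χ (s, x))).eq_or_lt with h0 | hpos
      · rw [← h0, zero_mul]
        have := hN0 0
        positivity
      · have := h₃ P (s, x) ((N 0 + (c * (∫ τ in (0 : ℝ)..s, N τ) + c * I)) / |χ (s, x)|)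
          fun u hu => by
            rw [le_div_iff₀ hpos, mul_comm]
            exact hword u (Nat.le_of_lt_succ hu) s hs x hx
        rwa [← mul_div_assoc, le_div_iff₀ hpos, mul_comm] at this
    rw [hK]
    linarith
  have hgron := le_exp_of_le_integral hNc hN0 hKpos ht.1 hineq
  have hinit : N 0 ≤ C₅ * A := by
    refine supOn_le hBn ?_
    rintro ⟨y₁, y₂, ζ⟩ ⟨hy₁, hy₂, hζ⟩
    have hp : ((0, y₁, y₂, ζ) : SpaceTime) ∈ spaceTimeDomain T := ⟨h0T, hζ.2⟩
    have q := h₅ P ρ eP 0 h0T hA y₁ y₂ (-(R + 1)) (by linarith) le_rfl ζ hζ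
    simp only [hn, abs_of_nonneg (hχ01 _ hp).1]
    refine le_trans (mul_le_of_le_one_left (derivSize_nonneg _ _ _ _) (hχ01 _ hp).2) q
  have hfin := hnN t (a₁, a₂, z) hzB
  simp only [hn, hχ1 z hz.2, abs_one, one_mul] at hfin
  have hexp : Real.exp (K * t) ≤ Real.exp (K * T) := by
    apply Real.exp_le_exp.2
    exact mul_le_mul_of_nonneg_left ht.2 hKpos.le
  calc _ ≤ N t := hfin
    _ ≤ C₃ * (N 0 + c * I) * Real.exp (K * t) := hgron
    _ ≤ C₃ * ((C₅ + c) * (A + I)) * Real.exp (K * T) := by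
        have g₁ : N 0 + c * I ≤ (C₅ + c) * (A + I) := by
          have : 0 ≤ C₅ * I := by positivity
          have : 0 ≤ c * A := by positivity
          linarith
        gcongr
    _ = _ := by ring

end ConormalTransport
end

/-! ### The theorem, from the pointwise estimate -/

theorem mainTheorem5 (k : ℕ) (T : ℝ) (hT : 0 < T) (R : ℝ) (hR : 0 < R) (M : ℝ≥0) :
    ∃ C : ℝ≥0, ∀ (ε : ℝ), 0 < ε →
      ∀ (w₁ w₂ w₃ ρ H : SpaceTime → ℝ),
        ContDiffOn ℝ ∞ w₁ (spaceTimeDomain T) →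
        ContDiffOn ℝ ∞ w₂ (spaceTimeDomain T) →
        ContDiffOn ℝ ∞ w₃ (spaceTimeDomain T) →
        ContDiffOn ℝ ∞ ρ (spaceTimeDomain T) →
        ContDiffOn ℝ ∞ H (spaceTimeDomain T) →
        -- `w₃` and `ρ` vanish on the boundary
        (∀ t ∈ Set.Icc 0 T, ∀ y₁ y₂ : ℝ, w₃ (t, y₁, y₂, 0) = 0) →
        (∀ t ∈ Set.Icc 0 T, ∀ y₁ y₂ : ℝ, ρ (t, y₁, y₂, 0) = 0) →
        -- `ρ` and `H` are compactly supported in `z`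
        (∀ p ∈ spaceTimeDomain T, p.2.2.2 < -R → ρ p = 0 ∧ H p = 0) →
        -- the equation
        (∀ p ∈ spaceTimeDomain T, p.2.2.2 < 0 →
          dt T ρ p + (w₁ p * dy1 T ρ p + w₂ p * dy2 T ρ p + w₃ p * dz T ρ p)
            = ε * dz T (dz T ρ) p + H p) →
        -- the bound on the boundary values of `w` that enters the constant
        (∀ t ∈ Set.Icc 0 T,
          traceYNorm T k w₁ t + traceYNorm T k w₂ t + traceYNorm T k (dz T w₃) t ≤ M) →
        ∀ t ∈ Set.Icc 0 T, ∀ β : Fin 4 → ℕ, ∑ i, β i = k →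
          sliceNorm ⊤ (conormalDeriv T β ρ) t ≤
            C * (YNorm T k ρ 0 +
              ∫⁻ τ in Set.Icc 0 t,
                ((YNorm T k (dz T w₁) τ + YNorm T k (dz T w₂) τ
                    + YNorm T k (dz T (dz T w₃)) τ) * XNorm T (k + 3) ρ τ
                  + YNorm T k H τ)) := by
  have : Fact (0 < T) := ⟨hT⟩
  obtain ⟨C₁, hC₁, h₁⟩ := ConormalTransport.exists_derivSize_estimate (T := T) R hR k M
  obtain ⟨C₂, hC₂, h₂⟩ := ConormalTransport.exists_conormal_le_euler (T := T) (R + 1) (k + 1)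
  -- The constant must be nonzero for the case of an infinite right-hand side.
  refine ⟨(C₂ * C₁).toNNReal + 1, ?_⟩
  intro ε hε w₁ w₂ w₃ ρ H hw₁ hw₂ hw₃ hρ hH hw₃0 hρ0 hsupp heq hM t ht β hβ
  set A := YNorm T k ρ 0
  change _ ≤ _ * (A + ∫⁻ τ in Set.Icc 0 t,
    ConormalTransport.sourceNorm T k w₁ w₂ w₃ ρ H τ)
  set I := ∫⁻ τ in Set.Icc 0 t, ConormalTransport.sourceNorm T k w₁ w₂ w₃ ρ H τ with hI
  rcases eq_or_ne (A + I) ⊤ with htop | hfin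
  · rw [htop, ENNReal.mul_top (by simp)]
    exact le_top
  obtain ⟨hA, hIfin⟩ := ENNReal.add_ne_top.1 hfin
  set W₁ := ConormalTransport.ofFun w₁ hw₁
  set W₂ := ConormalTransport.ofFun w₂ hw₂
  set W₃ := ConormalTransport.ofFun w₃ hw₃
  set P := ConormalTransport.ofFun ρ hρ
  set Q := ConormalTransport.ofFun H hH
  have e₁ := ConormalTransport.eqOn_ofFun hw₁
  have e₂ := ConormalTransport.eqOn_ofFun hw₂
  have e₃ := ConormalTransport.eqOn_ofFun hw₃
  have eP := ConormalTransport.eqOn_ofFun hρ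
  have eQ := ConormalTransport.eqOn_ofFun hH
  have hP : ConormalTransport.VanishesBelow R P := fun p hp hz => by
    rw [eP hp]; exact (hsupp p hp hz).1
  have hPQ : ConormalTransport.transport ε W₁ W₂ W₃ P = Q := by
    refine ConormalTransport.smoothAlg_ext_neg fun p hp hz => ?_
    have h := heq p hp hz
    rw [ConormalTransport.transport_apply, e₁ hp, e₂ hp, e₃ hp, eQ hp,
      ConormalTransport.pd_apply_of_eqOn _ P eP hp, ConormalTransport.pd_apply_of_eqOn _ P eP hp,
      ConormalTransport.pd_apply_of_eqOn _ P eP hp, ConormalTransport.pd_apply_of_eqOn _ P eP hp,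
      ConormalTransport.pd_apply_of_eqOn _ _ (ConormalTransport.pd_apply_of_eqOn _ P eP) hp]
    simp only [dt, dy1, dy2, dz] at h
    linarith
  refine ConormalTransport.sliceNorm_top_le fun x hx => ?_
  obtain ⟨a₁, a₂, z⟩ := x
  have hz : z < 0 := hx
  have hp : ((t, a₁, a₂, z) : SpaceTime) ∈ spaceTimeDomain T := ⟨ht, hz.le⟩
  rw [← ConormalTransport.eqOn_conormalDeriv β P ρ eP hp]
  -- The two normal weights are compared on the strip only; below it the derivatives of `ρ` vanish.
  by_cases hzR : z < -R
  · rw [hP.word _ _ _ hp hzR, abs_zero, ENNReal.ofReal_zero]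
    exact zero_le
  have hzR' : -(R + 1) ≤ z := by linarith [not_lt.1 hzR]
  have hlen : (ConormalTransport.monomialWord β).length < k + 1 := by
    rw [ConormalTransport.length_monomialWord, hβ]; exact Nat.lt_succ_self k
  have b₁ := ConormalTransport.abs_word_le
    (ConormalTransport.vectorFields (ConormalTransport.phiZ (T := T))) hlen P (t, a₁, a₂, z)
  have b₂ := h₂ (t, a₁, a₂, z) ⟨hp, hzR'⟩ P
  have b₃ := h₁ ε hε W₁ W₂ W₃ P Q w₁ w₂ w₃ ρ H e₁ e₂ e₃ eP eQ
    (fun s hs y₁ y₂ => by rw [e₃ ⟨hs, le_rfl⟩]; exact hw₃0 s hs y₁ y₂)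
    (fun s hs y₁ y₂ => by rw [eP ⟨hs, le_rfl⟩]; exact hρ0 s hs y₁ y₂)
    hP hPQ hM t ht hA hIfin a₁ a₂ z ⟨hzR', hz.le⟩
  have b₄ := b₁.trans (b₂.trans (mul_le_mul_of_nonneg_left b₃ hC₂))
  rw [← mul_assoc, ← ENNReal.toReal_add hA hIfin] at b₄
  calc _ ≤ ENNReal.ofReal (C₂ * C₁ * (A + I).toReal) := ENNReal.ofReal_le_ofReal b₄
    _ = (C₂ * C₁).toNNReal * (A + I) := by
      rw [ENNReal.ofReal_mul (by positivity), ENNReal.ofReal_toReal hfin]; rfl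
    _ ≤ _ := by gcongr; simp
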